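/- **Setting.** Let $X$ be a second countable topological space. A *polyhedral structure* $\Pi$ on $X$ is a locally finite covering of $X$ by distinct closed subsets $\sigma$ (its *polyhedra*), each equipped with a finite dimensional vector space $M_\sigma$ of continuous real functions on $\sigma$ such that, with $N_\sigma=\operatorname{Hom}(M_\sigma,\mathbb{R})$, the evaluation map $\phi_\sigma\colon\sigma\to N_\sigma$ sends $\sigma$ homeomorphically onto a full-dimensional convex polyhedron of an affine hyperplane $H_\sigma\subset N_\sigma$ not passing through $0$; moreover every face $F$ of a polyhedron $\sigma$ of $\Pi$ is a polyhedron of $\Pi$, with $M_F$ the restriction of $M_\sigma$ to $F$, and two polyhedra of $\Pi$ intersect in a common (possibly empty) face. Thus $M_\sigma$ is the space of affine functions on $\sigma$, and $\dim\sigma=\dim M_\sigma-1$ for $\sigma\neq\emptyset$. We write $\tau\prec\sigma$ if $\tau$ is a face of $\sigma$. A polyhedral structure $\Pi'$ is a *subdivision* of $\Pi$ if each polyhedron of $\Pi'$ is contained in a polyhedron of $\Pi$, the inclusion being affine; two polyhedral structures are equivalent if they have a common subdivision. A *Euclidean polyhedral space* is such an $X$ with an equivalence class of polyhedral structures, a finite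 dimensional Euclidean vector space $N$, and a map $\iota\colon X\to N$ with image in an affine hyperplane not containing $0$, such that the class contains a structure on each of whose polyhedra $\iota$ is affine and injective. The structures in the class with this last property are the *polyhedral complexes on* $X$. The space $X$ has *pure dimension* $n$ if the maximal polyhedra of any polyhedral complex on $X$ have dimension $n$. For a polyhedron $\sigma$, let $L_\sigma\subset N$ be the affine span of $\iota(\sigma)$; for a facet $\tau\neq\emptyset$ of $\sigma$ let $v_{\sigma\setminus\tau}\in N$ be the unit vector that is parallel to $L_\sigma$, orthogonal to $L_\tau$, and points from $\tau$ towards $\sigma$. **Weights.** Let $U\subset X$ be open and $\Pi$ a polyhedral complex on $X$. Let $\Pi|_U$ be the set of polyhedra of $\Pi$ meeting $U$, and $\Pi|_U(k)$ the set of those of dimension $k$. A *$k$-dimensional Minkowski weight* on $\Pi|_U$ is a map $c\colon\Pi|_U(k)\to\mathbb{R}$ with $\sum_{\sigma\in\Pi|_U(k),\,\sigma\succ\tau}c(\sigma)\,v_{\sigma\setminus\tau}=0$ for all $\tau\in\Pi|_U(k-1)$; it is *positive* if $c\ge0$. Its pullback to a subdivision $\Pi'$ of $\Pi$ takes at $\sigma'\in\Pi'|_U(k)$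 the value $c(\sigma)$ if $\sigma'\subset\sigma\in\Pi|_U(k)$, and $0$ if there is no such $\sigma$. A *Minkowski cycle* on $U$ is an element of the direct limit, over the polyhedral complexes on $X$ ordered by subdivision, of the spaces of Minkowski weights of a given dimension; it is *positive* if it is represented by a positive Minkowski weight. A function $f\colon U\to\mathbb{R}$ is *defined on* $\Pi$ if for each $\sigma\in\Pi|_U$ its restriction to $\sigma\cap U$ is given by an element of $M_\sigma$, equivalently by $f_\sigma\circ\iota$ for some linear $f_\sigma\colon N\to\mathbb{R}$; it is *piecewise affine* if it is defined on some polyhedral complex on $X$. The product of such an $f$ with a $k$-dimensional Minkowski weight $c$ on $\Pi|_U$ is the $(k-1)$-dimensional Minkowski weight $$(f\cdot c)(\tau)=-\sum_{\sigma\in\Pi|_U(k),\,\sigma\succ\tau}c(\sigma)\,f_\sigma(v_{\sigma\setminus\tau}),\qquad \tau\in\Pi|_U(k-1);$$ this induces a product of piecewise affine functions on $U$ with Minkowski cycles on $U$. A piecewise affine function $f$ on $U$ is *concave* if for every open $V\subset U$ and every positive Minkowski cycle $\gamma$ on $V$, the product $f|_V\cdot\gamma$ is positive. **Balancing and weak concavity.**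 Let $X$ be of pure dimension $n$. A *balancing condition* on $U$ is an $n$-dimensional Minkowski cycle $\beta$ on $U$ represented, for some polyhedral complex $\Pi$ on $X$, by a Minkowski weight $b$ with $b(\sigma)>0$ for all $\sigma\in\Pi|_U(n)$; then $U$ (with $\beta$) is called *balanced*. A $k$-dimensional Minkowski weight is *$\beta$-positive* if its cycle has the form $\sum_{j=1}^s\alpha_j\,f_{1,j}\cdots f_{n-k,j}\cdot\beta$ with $s\ge1$, real $\alpha_j>0$ and concave piecewise affine functions $f_{i,j}$ on $U$. A *balanced convex combination* in $U$ consists of $x\in U$ and finite families $(x_i)_{i\in I}$ of points of $U$ and $(\nu_i)_{i\in I}$ of nonnegative real numbers with $\sum_i\nu_i=1$ and $\sum_i\nu_i\,\iota(x_i)=\iota(x)$, for which there are a polyhedral complex $\Pi$ on $X$, a polyhedron $\tau\in\Pi$ with $x\in\tau$, and polyhedra $\sigma_i\in\Pi$, $i\in I$, such that $x_i\in\sigma_i\subset U$; the $\sigma_i$ are the different polyhedra of $\Pi$ of dimension $k=\dim\tau+1$ having $\tau$ as a face; and there is a $\beta$-positive $k$-dimensional Minkowski weight $c$ on $\Pi|_U$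 with $\nu_i\,d(\iota(x_i),L_\tau)=c(\sigma_i)$ for all $i\in I$. A function $f\colon U\to\mathbb{R}$ is *weakly concave* if $f(x)\ge\sum_{i\in I}\nu_i f(x_i)$ for every balanced convex combination in $U$. **Proposition 5.5 (minimum principle).** Let $X$ be a Euclidean polyhedral space of pure dimension $n$ and $U\subset X$ a balanced open subset. Suppose that $U$ is connected, and let $f\colon U\to\mathbb{R}$ be a weakly concave function. If there is a point $y\in U$ such that $f(y)=\inf_{x\in U}f(x)$, then $f$ is constant. -/

import Mathlib

open scoped InnerProductSpace

namespace BalancedPolyhedral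

noncomputable section

/-! ### Polyhedra and polyhedral structures -/

/-- Evaluation map `φ : σ → Hom (M, ℝ)` of a vector space `M` of functions on `σ`. -/
def evalMap {X : Type*} {σ : Set X} (M : Submodule ℝ (σ → ℝ)) (x : σ) : Module.Dual ℝ M where
  toFun m := m.1 x
  map_add' _ _ := rfl
  map_smul' _ _ := rfl

/-- `σ`, with the finite dimensional space `M` of continuous functions on it, is a (nonempty)
polyhedron: the evaluation map sends `σ` homeomorphically onto a convex polyhedron (a finite
intersection of closed half-spaces) of a hyperplane `{p | p m₀ = 1}` of the dual of `M`, not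
passing through the origin.

The topology of the finite dimensional space `Hom (M, ℝ)` is that of pointwise convergence on `M`.
The affine functions on the hyperplane are the maps `p ↦ p m` with `m ∈ M`, so its closed
half-spaces are the sets `{p | 0 ≤ p a}` with `a ∈ M`. The image of `σ` is automatically
full-dimensional in the hyperplane: an `m ∈ M` vanishing at all points of `σ` is zero. -/
structure IsPolyhedron {X : Type*} [TopologicalSpace X] (σ : Set X) (M : Submodule ℝ (σ → ℝ)) :
    Prop where
  nonempty : σ.Nonempty
  finite : Module.Finite ℝ M
  continuous : ∀ m ∈ M, Continuous m
  isEmbedding : Topology.IsEmbedding (fun (x : σ) (m : M) => evalMap M x m)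
  range_eq : ∃ (m₀ : M) (A : Finset M),
    Set.range (evalMap M) = {p : Module.Dual ℝ M | p m₀ = 1 ∧ ∀ a ∈ A, 0 ≤ p a}

/-- `F` is a face of the polyhedron `σ` with space of affine functions `M`: it is the zero set of
an affine function that is nonnegative on `σ` (`σ` itself, and the empty set, are faces). -/
def IsFaceOf {X : Type*} {σ : Set X} (M : Submodule ℝ (σ → ℝ)) (F : Set X) : Prop :=
  ∃ m ∈ M, (∀ x, 0 ≤ m x) ∧ F = {x | ∃ hx : x ∈ σ, m ⟨x, hx⟩ = 0}

/-- Restriction to `τ ⊆ σ` of a space of functions on `σ`. -/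
def restrictFuns {X : Type*} {τ σ : Set X} (h : τ ⊆ σ) (M : Submodule ℝ (σ → ℝ)) :
    Submodule ℝ (τ → ℝ) :=
  M.map (LinearMap.funLeft ℝ ℝ (Set.inclusion h))

/-- A polyhedral structure on `X`. The set `cells` consists of its nonempty polyhedra (the empty
face, which plays no role, is not listed), and `funs σ` is the space `M_σ` of affine functions on
the polyhedron `σ`; the value of `funs` at a set that is not in `cells` is irrelevant. -/
structure PolyhedralStructure (X : Type*) [TopologicalSpace X] where
  cells : Set (Set X)
  funs : (σ : Set X) → Submodule ℝ (σ → ℝ)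
  isClosed : ∀ σ ∈ cells, IsClosed σ
  covers : ⋃₀ cells = Set.univ
  locallyFinite : LocallyFinite (fun σ : cells => (σ : Set X))
  isPolyhedron : ∀ σ ∈ cells, IsPolyhedron σ (funs σ)
  face_mem : ∀ σ ∈ cells, ∀ F : Set X, IsFaceOf (funs σ) F → F.Nonempty → F ∈ cells
  face_funs : ∀ σ ∈ cells, ∀ F : Set X, IsFaceOf (funs σ) F → F.Nonempty →
    ∀ h : F ⊆ σ, funs F = restrictFuns h (funs σ)
  inter_face : ∀ σ ∈ cells, ∀ τ ∈ cells, (σ ∩ τ).Nonempty →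
    IsFaceOf (funs σ) (σ ∩ τ) ∧ IsFaceOf (funs τ) (σ ∩ τ)

namespace PolyhedralStructure

variable {X : Type*} [TopologicalSpace X]

/-- `Π'` is a subdivision of `Π`: every polyhedron of `Π'` is contained in a polyhedron of `Π`,
the inclusion being an affine map (affine functions restrict to affine functions). -/
def IsSubdivision (P' P : PolyhedralStructure X) : Prop :=
  ∀ σ' ∈ P'.cells, ∃ σ ∈ P.cells, ∃ h : σ' ⊆ σ, restrictFuns h (P.funs σ) ≤ P'.funs σ'

/-- Two polyhedral structures are equivalent if they have a common subdivision. -/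
def Equivalent (P Q : PolyhedralStructure X) : Prop :=
  ∃ R : PolyhedralStructure X, R.IsSubdivision P ∧ R.IsSubdivision Q

/-- The dimension of a polyhedron, `dim M_σ - 1`. -/
def dim (P : PolyhedralStructure X) (σ : Set X) : ℕ := Module.finrank ℝ (P.funs σ) - 1

/-- The restriction `Π|_U`: the polyhedra of `Π` that meet `U`. -/
def restrict (P : PolyhedralStructure X) (U : Set X) : Set (Set X) :=
  {σ | σ ∈ P.cells ∧ (σ ∩ U).Nonempty}

/-- `Π|_U(k)`: the polyhedra of `Π|_U` of dimension `k`. -/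
def restrictDim (P : PolyhedralStructure X) (U : Set X) (k : ℕ) : Set (Set X) :=
  {σ | σ ∈ P.restrict U ∧ P.dim σ = k}

/-- The polyhedra of `Π|_U` that have `τ` as a facet, that is, as a face of codimension one. -/
def cofacets (P : PolyhedralStructure X) (U : Set X) (τ : Set X) : Set (Set X) :=
  {σ | σ ∈ P.restrictDim U (P.dim τ + 1) ∧ IsFaceOf (P.funs σ) τ}

/-- The sums over `P.cofacets U τ` used below are finite. -/
theorem finite_cofacets (P : PolyhedralStructure X) (U : Set X) {τ : Set X} (hτ : τ ∈ P.cells) :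
    (P.cofacets U τ).Finite := by
  obtain ⟨x, hx⟩ := (P.isPolyhedron τ hτ).nonempty
  have h := (P.locallyFinite.point_finite x).image (fun σ : P.cells => (σ : Set X))
  refine h.subset ?_
  rintro σ ⟨⟨⟨hσ, -⟩, -⟩, m, -, -, hF⟩
  refine ⟨⟨σ, hσ⟩, ?_, rfl⟩
  rw [hF] at hx
  exact hx.1

/-- `f|_U` is defined on `Π`: on each `σ ∩ U`, `σ ∈ Π|_U`, it is given by an element of `M_σ`.
Functions on `U` are given as functions on `X` of which only the values on `U` matter. -/
def DefinedOn (P : PolyhedralStructure X) (U : Set X) (f : X → ℝ) : Prop :=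
  ∀ σ ∈ P.restrict U, ∃ m ∈ P.funs σ, ∀ (x : X) (hx : x ∈ σ), x ∈ U → f x = m ⟨x, hx⟩

open Classical in
/-- Pullback `c_{Π'}` to a subdivision `Π'` of `Π` of a weight `c` on `Π|_U`. -/
def pullback (P P' : PolyhedralStructure X) (U : Set X) (c : Set X → ℝ) (σ' : Set X) : ℝ :=
  if h : ∃ σ, σ ∈ P.restrict U ∧ σ' ⊆ σ ∧ P.dim σ = P'.dim σ' then c h.choose else 0

end PolyhedralStructure

/-! ### Euclidean polyhedral spaces -/

variable {X : Type*} [TopologicalSpace X]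
variable {N : Type*} [NormedAddCommGroup N] [InnerProductSpace ℝ N]

/-- `ι` is affine and injective on every polyhedron of `Π`. -/
def IsCompatible (P : PolyhedralStructure X) (ι : X → N) : Prop :=
  ∀ σ ∈ P.cells, (∀ l : N →ₗ[ℝ] ℝ, (fun x : σ => l (ι x)) ∈ P.funs σ) ∧ Set.InjOn ι σ

variable (X N) in
/-- The structure of a Euclidean polyhedral space on the (second countable) space `X`: an
equivalence class of polyhedral structures, and a quasi-embedding `ι` of `X` into the Euclidean
space `N`. The class is given by a representative `base`, chosen among those on whose polyhedra
`ι` is affine and injective. -/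
structure EuclideanPolyhedralSpace where
  base : PolyhedralStructure X
  ι : X → N
  exists_hyperplane : ∃ h : N →ₗ[ℝ] ℝ, ∀ x, h (ι x) = 1
  base_compatible : IsCompatible base ι

namespace EuclideanPolyhedralSpace

variable (E : EuclideanPolyhedralSpace X N)

/-- `Π` is a polyhedral complex on the Euclidean polyhedral space: it belongs to the given
equivalence class, and `ι` is affine and injective on each of its polyhedra. -/
def IsComplex (P : PolyhedralStructure X) : Prop :=
  P.Equivalent E.base ∧ IsCompatible P E.ι

/-- The space has pure dimension `n`: for any polyhedral complex on it, every maximal polyhedron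
has dimension `n`. -/
def HasPureDimension (n : ℕ) : Prop :=
  ∀ P : PolyhedralStructure X, E.IsComplex P →
    ∀ σ ∈ P.cells, (∀ σ' ∈ P.cells, σ ⊆ σ' → σ' = σ) → P.dim σ = n

/-- The affine subspace `ι_σ(H_σ)` of `N` spanned by the image of the polyhedron `σ`. -/
def span (σ : Set X) : AffineSubspace ℝ N := affineSpan ℝ (E.ι '' σ)

/-- `v` is the unit vector normal to `τ` in the direction of `σ`. -/
def IsUnitNormal (σ τ : Set X) (v : N) : Prop :=
  ‖v‖ = 1 ∧ v ∈ (E.span σ).direction ∧ (∀ w ∈ (E.span τ).direction, ⟪w, v⟫_ℝ = 0) ∧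
    ∀ x ∈ σ, ∀ y ∈ τ, 0 ≤ ⟪v, E.ι x - E.ι y⟫_ℝ

open Classical in
/-- The vector `v_{σ ∖ τ}`; it exists and is unique when `τ` is a facet of `σ`. -/
def unitNormal (σ τ : Set X) : N :=
  if h : ∃ v, E.IsUnitNormal σ τ v then h.choose else 0

open Classical in
/-- A linear function `f_σ` on `N` with `f = f_σ ∘ ι` on `σ ∩ U`. It exists if `f` is defined on a
polyhedral complex `Π` with `σ ∈ Π|_U`, and then its values on vectors parallel to `ι_σ(H_σ)` do
not depend on choices. -/
def linearPart (U : Set X) (f : X → ℝ) (σ : Set X) : N →ₗ[ℝ] ℝ :=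
  if h : ∃ l : N →ₗ[ℝ] ℝ, ∀ x ∈ σ ∩ U, f x = l (E.ι x) then h.choose else 0

/-! ### Minkowski weights

A weight of dimension `k` on `Π|_U` is given by a function `c : Set X → ℝ` of which only the
values on `Π|_U(k)` matter. -/

/-- The weight `c` of dimension `k` on `Π|_U` is a Minkowski weight. -/
def IsMinkowskiWeight (P : PolyhedralStructure X) (U : Set X) (k : ℕ) (c : Set X → ℝ) : Prop :=
  ∀ τ ∈ P.restrict U, P.dim τ + 1 = k →
    ∑ᶠ (σ : Set X) (_ : σ ∈ P.cofacets U τ), c σ • E.unitNormal σ τ = 0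

/-- The product `f · c` of a piecewise affine function with a weight on `Π|_U`. If `c` has
dimension `k`, this is a weight of dimension `k - 1`, and its values on `Π|_U(k - 1)` only involve
the values of `c` on `Π|_U(k)`. -/
def product (P : PolyhedralStructure X) (U : Set X) (f : X → ℝ) (c : Set X → ℝ) (τ : Set X) : ℝ :=
  -∑ᶠ (σ : Set X) (_ : σ ∈ P.cofacets U τ), c σ * E.linearPart U f σ (E.unitNormal σ τ)

/-- Iterated product `f₁ · (f₂ · (⋯ (f_m · c)))`. -/
def iteratedProduct (P : PolyhedralStructure X) (U : Set X) (fs : List (X → ℝ)) (c : Set X → ℝ) :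
    Set X → ℝ :=
  fs.foldr (fun f d => E.product P U f d) c

/-- `c` is a positive `k`-dimensional Minkowski weight on `Π|_U`, `c ∈ M_k⁺(Π|_U)`. -/
def IsPositiveMinkowskiWeight (P : PolyhedralStructure X) (U : Set X) (k : ℕ) (c : Set X → ℝ) :
    Prop :=
  E.IsMinkowskiWeight P U k c ∧ ∀ σ ∈ P.restrictDim U k, 0 ≤ c σ

/-- `f` is a piecewise affine function on `U`. -/
def IsPiecewiseAffine (U : Set X) (f : X → ℝ) : Prop :=
  ∃ P : PolyhedralStructure X, E.IsComplex P ∧ P.DefinedOn U f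

/-- The piecewise affine function `f` on `U` is concave: its product with every positive Minkowski
cycle on an open subset `V` of `U` is a positive Minkowski cycle. A positive Minkowski cycle on `V`
is the class of a positive Minkowski weight `c` on `Π|_V`, where `Π` may be refined so that `f|_V`
is defined on it, and then the product is the class of `f · c`. (In dimension zero there is nothing
to check, the product being zero.) -/
def IsConcavePiecewiseAffine (U : Set X) (f : X → ℝ) : Prop :=
  E.IsPiecewiseAffine U f ∧
    ∀ V : Set X, IsOpen V → V ⊆ U →
      ∀ P : PolyhedralStructure X, E.IsComplex P → P.DefinedOn V f →
        ∀ (k : ℕ) (c : Set X → ℝ), E.IsPositiveMinkowskiWeight P V (k + 1) c →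
          E.IsPositiveMinkowskiWeight P V k (E.product P V f c)

/-- A balancing condition on `U` (for `X` of pure dimension `n`): an `n`-dimensional Minkowski
cycle on `U`, given by a representing Minkowski weight with strictly positive values on the
`n`-dimensional polyhedra. -/
structure BalancingCondition (n : ℕ) (U : Set X) where
  complex : PolyhedralStructure X
  isComplex : E.IsComplex complex
  weight : Set X → ℝ
  isMinkowskiWeight : E.IsMinkowskiWeight complex U n weight
  pos : ∀ σ ∈ complex.restrictDim U n, 0 < weight σ

variable {E}

/-- The `k`-dimensional weight `c` on `Π|_U` is a `β`-positive Minkowski weight: it is a Minkowski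
weight, and its cycle is a combination, with positive coefficients `α j`, of products of the
balancing condition with `n - k` concave piecewise affine functions. Cycles are classes of weights
modulo pullback to subdivisions, so that the equality of cycles means an equality of weights on a
common subdivision on which everything is defined. -/
def BalancingCondition.IsPositiveWeight {n : ℕ} {U : Set X} (β : E.BalancingCondition n U)
    (P : PolyhedralStructure X) (k : ℕ) (c : Set X → ℝ) : Prop :=
  E.IsMinkowskiWeight P U k c ∧
    ∃ (s : ℕ) (α : Fin s → ℝ) (fs : Fin s → List (X → ℝ)) (Q : PolyhedralStructure X),
      0 < s ∧ (∀ j, 0 < α j) ∧ (∀ j, (fs j).length + k = n) ∧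
      (∀ j, ∀ f ∈ fs j, E.IsConcavePiecewiseAffine U f ∧ Q.DefinedOn U f) ∧
      E.IsComplex Q ∧ Q.IsSubdivision P ∧ Q.IsSubdivision β.complex ∧
      ∀ σ ∈ Q.restrictDim U k,
        P.pullback Q U c σ =
          ∑ j, α j * E.iteratedProduct Q U (fs j) (β.complex.pullback Q U β.weight) σ

/-! ### Convex combinations and weakly concave functions -/

variable (E) in
/-- `(x, (xᵢ), (νᵢ))` is a convex combination in `U`. -/
structure IsConvexCombination (U : Set X) {r : ℕ} (x : X) (xs : Fin r → X) (ν : Fin r → ℝ) :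
    Prop where
  center_mem : x ∈ U
  point_mem : ∀ i, xs i ∈ U
  nonneg : ∀ i, 0 ≤ ν i
  sum_eq_one : ∑ i, ν i = 1
  sum_eq : ∑ i, ν i • E.ι (xs i) = E.ι x

variable (E) in
/-- The polyhedral complex `Π` and its polyhedra `τ`, `σᵢ` exhibit the convex combination
`(x, (xᵢ), (νᵢ))` in `U` as a polyhedral one. -/
structure IsPolyhedralCombination (U : Set X) {r : ℕ} (x : X) (xs : Fin r → X) (ν : Fin r → ℝ)
    (P : PolyhedralStructure X) (τ : Set X) (σ : Fin r → Set X) : Prop where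
  isConvexCombination : E.IsConvexCombination U x xs ν
  isComplex : E.IsComplex P
  cell_mem : τ ∈ P.cells
  center_mem : x ∈ τ
  cells_mem : ∀ i, σ i ∈ P.cells
  isFace : ∀ i, IsFaceOf (P.funs (σ i)) τ
  subset : ∀ i, σ i ⊆ U
  point_mem : ∀ i, xs i ∈ σ i

/-- `(x, (xᵢ), (νᵢ))` is a balanced convex combination in `U`: it is polyhedral, the `σᵢ` are the
different polyhedra of `Π` of dimension `k = dim τ + 1` having `τ` as a face, and there is a
`β`-positive Minkowski weight `c` on `Π|_U` of dimension `k` with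
`νᵢ * d(xᵢ, τ) = c(σᵢ)`, the distance being that from `ι xᵢ` to the affine span of `ι(τ)`. -/
def BalancingCondition.IsBalancedCombination {n : ℕ} {U : Set X} (β : E.BalancingCondition n U)
    {r : ℕ} (x : X) (xs : Fin r → X) (ν : Fin r → ℝ) : Prop :=
  ∃ (P : PolyhedralStructure X) (τ : Set X) (σ : Fin r → Set X),
    E.IsPolyhedralCombination U x xs ν P τ σ ∧
    Function.Injective σ ∧
    Set.range σ = {ρ | ρ ∈ P.cells ∧ P.dim ρ = P.dim τ + 1 ∧ IsFaceOf (P.funs ρ) τ} ∧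
    ∃ c : Set X → ℝ, β.IsPositiveWeight P (P.dim τ + 1) c ∧
      ∀ i, ν i * Metric.infDist (E.ι (xs i)) (E.span τ : Set N) = c (σ i)

/-- `f` is weakly concave on the balanced open subset `U`. -/
def BalancingCondition.WeaklyConcave {n : ℕ} {U : Set X} (β : E.BalancingCondition n U)
    (f : X → ℝ) : Prop :=
  ∀ (r : ℕ) (x : X) (xs : Fin r → X) (ν : Fin r → ℝ), β.IsBalancedCombination x xs ν →
    ∑ i, ν i * f (xs i) ≤ f x

end EuclideanPolyhedralSpace

end

end BalancedPolyhedral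

namespace BalancedPolyhedral

noncomputable section

/-! The principle is proved locally and then globalised. Every point of `U` has a neighbourhood on
which the minimal value is attained everywhere or nowhere (`exists_nhds`). So the set of minimum
points and its complement in `U` are both open, and connectedness concludes.

The local statement rests on propagation along a segment (`eq_of_segment`). Let `y` be a minimum
point and `x ≠ y` a point of an `n`-dimensional polyhedron `σ` of the complex carrying `β`, with `y
∈ σ`, one of the two in the relative interior, and both so close that everything below stays in `U`.
Choose `n - 1` linear functions `l` on `N`, independent on the direction of `σ` and vanishing at `ι
y` and `ι x`. The functions `-|l|` are concave, so their product with `β` is a `β`-positive weight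
`c` of dimension one. In a suitable subdivision `y` is a vertex and `x` lies on an edge `ρ` at `y`
with `c ρ > 0`. Balancing of `c` at `y` exhibits `ι y` as a convex combination of one point on each
edge at `y`; on `ρ` this point is `x`, and its coefficient is positive. Weak concavity bounds the
mean of the values by `f y`, and none of them is below `f y`, so `f x = f y`. Polyhedra that meet a
small neighbourhood of a point contain the point, so four such segments join any two points of it.

Three facts about weights carry this. A product of a piecewise affine function with a Minkowski
weight is again one (`isMinkowskiWeight_product`): a face of codimension two lies in exactly two
facets, and the sum over flags is reordered by the planar identity `smul_unitNormal_swap`. The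
balancing condition pulls back to subdivisions (`isMinkowskiWeight_pullback`). The iterated product
is strictly positive where needed (`iteratedProduct_pos`). The subdivisions are iterated hyperplane
cuts (`cut`), whose faces are controlled by a Farkas lemma. Underneath, `funs_eq` turns polyhedra
into subsets of `N` given by linear inequalities. -/

theorem exists_pos_forall_nonneg {κ : Type*} (A : Finset κ) (α β : κ → ℝ)
    (h : ∀ a ∈ A, 0 < α a ∨ (0 ≤ α a ∧ 0 ≤ β a)) :
    ∃ ε > 0, ∀ t, 0 ≤ t → t ≤ ε → ∀ a ∈ A, 0 ≤ α a + t * β a := by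
  classical
  induction A using Finset.induction_on with
  | empty => exact ⟨1, one_pos, by simp⟩
  | insert a A _ ih =>
    obtain ⟨ε, hε, H⟩ := ih fun b hb => h b (Finset.mem_insert_of_mem hb)
    rcases h a (Finset.mem_insert_self _ _) with ha | ⟨ha, hb⟩
    · refine ⟨min ε (α a / (|β a| + 1)), lt_min hε (by positivity), fun t ht hte b hb => ?_⟩
      rcases Finset.mem_insert.1 hb with rfl | hb
      · have h1 : t * (|β b| + 1) ≤ α b := by
          have := hte.trans (min_le_right _ _)
          rwa [le_div_iff₀ (by positivity)] at this
        have h2 := neg_abs_le (β b)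
        nlinarith [mul_le_mul_of_nonneg_left h2 ht]
      · exact H t ht (hte.trans (min_le_left _ _)) b hb
    · refine ⟨ε, hε, fun t ht hte b hb' => ?_⟩
      rcases Finset.mem_insert.1 hb' with rfl | hb'
      · positivity
      · exact H t ht hte b hb'

variable {X : Type*} [TopologicalSpace X] {N : Type*} [NormedAddCommGroup N]
  [InnerProductSpace ℝ N]

/-! ### Affine functions on polyhedra as restrictions of linear functions on `N`. -/

namespace EuclideanPolyhedralSpace

variable (E : EuclideanPolyhedralSpace X N)

/-- A linear function on `N` taking the value one on the image of `X`. -/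
def height : N →ₗ[ℝ] ℝ := E.exists_hyperplane.choose

@[simp] theorem height_ι (x : X) : E.height (E.ι x) = 1 := E.exists_hyperplane.choose_spec x

/-- The linear functions on `N`, seen as functions on `σ`. -/
def pullFuns (σ : Set X) : Module.Dual ℝ N →ₗ[ℝ] (σ → ℝ) where
  toFun l x := l (E.ι x)
  map_add' _ _ := rfl
  map_smul' _ _ := rfl

@[simp] theorem pullFuns_apply (σ : Set X) (l : Module.Dual ℝ N) (x : σ) :
    E.pullFuns σ l x = l (E.ι x) := rfl

/-- The functions on `σ` induced by linear functions on `N`. -/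
def affineFuns (σ : Set X) : Submodule ℝ (σ → ℝ) := LinearMap.range (E.pullFuns σ)

/-- The direction of the affine span of `ι(σ)`. -/
def dir (σ : Set X) : Submodule ℝ N := vectorSpan ℝ (E.ι '' σ)

theorem span_direction (σ : Set X) : (E.span σ).direction = E.dir σ :=
  direction_affineSpan _ _

variable {E}

theorem sub_mem_dir {σ : Set X} {x y : X} (hx : x ∈ σ) (hy : y ∈ σ) : E.ι x - E.ι y ∈ E.dir σ :=
  vsub_mem_vectorSpan ℝ (Set.mem_image_of_mem _ hx) (Set.mem_image_of_mem _ hy)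

theorem dir_le_iff {σ : Set X} {W : Submodule ℝ N} :
    E.dir σ ≤ W ↔ ∀ x ∈ σ, ∀ y ∈ σ, E.ι x - E.ι y ∈ W := by
  refine ⟨fun h x hx y hy => h (sub_mem_dir hx hy), fun h => ?_⟩
  rw [dir, vectorSpan_def, Submodule.span_le]
  rintro _ ⟨_, ⟨x, hx, rfl⟩, _, ⟨y, hy, rfl⟩, rfl⟩
  exact h x hx y hy

theorem dir_mono {σ τ : Set X} (h : σ ⊆ τ) : E.dir σ ≤ E.dir τ :=
  vectorSpan_mono ℝ (Set.image_mono h)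

theorem height_dir {σ : Set X} {w : N} (hw : w ∈ E.dir σ) : E.height w = 0 := by
  have : E.dir σ ≤ LinearMap.ker E.height := dir_le_iff.2 fun x _ y _ => by simp
  exact this hw

/-- A linear function constant on `ι(σ)` vanishes on the direction of `σ`. -/
theorem apply_dir_eq_zero {σ : Set X} {l : N →ₗ[ℝ] ℝ}
    (hl : ∀ x ∈ σ, ∀ y ∈ σ, l (E.ι x) = l (E.ι y)) {w : N} (hw : w ∈ E.dir σ) : l w = 0 := by
  have : E.dir σ ≤ LinearMap.ker l := dir_le_iff.2 fun x hx y hy => by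
    simp [hl x hx y hy]
  exact this hw

theorem pullFuns_mem {P : PolyhedralStructure X} (hP : IsCompatible P E.ι) {σ : Set X}
    (hσ : σ ∈ P.cells) (l : N →ₗ[ℝ] ℝ) : E.pullFuns σ l ∈ P.funs σ := (hP σ hσ).1 l

@[simp] theorem evalMap_apply {X : Type*} {σ : Set X} (M : Submodule ℝ (σ → ℝ)) (x : σ) (m : M) :
    evalMap M x m = m.1 x := rfl

/-- Each nonzero `a` is positive at some point of `σ`. The image of `σ` is convex, so midpoints are
available, and passing to a midpoint keeps the inequalities that are already strict. -/
theorem exists_relint_dual {X : Type*} {σ : Set X} {M : Submodule ℝ (σ → ℝ)} {m₀ : M} {A : Finset M}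
    (hr : Set.range (evalMap M) = {p : Module.Dual ℝ M | p m₀ = 1 ∧ ∀ a ∈ A, 0 ≤ p a})
    (hne : σ.Nonempty) :
    ∃ x : σ, ∀ a ∈ A, a ≠ 0 → 0 < evalMap M x a := by
  classical
  suffices H : ∀ B ⊆ A, ∃ x : σ, ∀ a ∈ B, a ≠ 0 → 0 < evalMap M x a from H A subset_rfl
  intro B
  have hmem : ∀ x, evalMap M x m₀ = 1 ∧ ∀ a ∈ A, 0 ≤ evalMap M x a := fun x => by
    have : evalMap M x ∈ Set.range (evalMap M) := ⟨x, rfl⟩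
    rwa [hr] at this
  induction B using Finset.induction_on with
  | empty => exact fun _ => ⟨⟨hne.some, hne.some_mem⟩, by simp⟩
  | insert b B _ ih =>
    intro hB
    obtain ⟨x, hx⟩ := ih ((Finset.subset_insert _ _).trans hB)
    by_cases hb : b = 0
    · refine ⟨x, fun a ha ha0 => ?_⟩
      rcases Finset.mem_insert.1 ha with rfl | ha
      · exact absurd hb ha0
      · exact hx a ha ha0
    · obtain ⟨y, hy⟩ : ∃ y : σ, b.1 y ≠ 0 := by
        by_contra! h
        exact hb (Subtype.ext (funext h))
      have hy' : 0 < evalMap M y b :=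
        lt_of_le_of_ne ((hmem y).2 b (hB (Finset.mem_insert_self _ _))) (Ne.symm hy)
      have hz : (1 / 2 : ℝ) • (evalMap M x + evalMap M y) ∈ Set.range (evalMap M) := by
        rw [hr]
        refine ⟨?_, fun a ha => ?_⟩
        · simp [(hmem x).1, (hmem y).1]; norm_num
        · have h1 := (hmem x).2 a ha
          have h2 := (hmem y).2 a ha
          simp only [LinearMap.smul_apply, LinearMap.add_apply, smul_eq_mul]
          positivity
      obtain ⟨z, hz⟩ := hz
      refine ⟨z, fun a ha ha0 => ?_⟩
      rw [hz]
      simp only [LinearMap.smul_apply, LinearMap.add_apply, smul_eq_mul]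
      have h1 := (hmem x).2 a (hB ha)
      have h2 := (hmem y).2 a (hB ha)
      rcases Finset.mem_insert.1 ha with rfl | ha
      · linarith
      · linarith [hx a ha ha0]

/-- On the polyhedra of a complex, all affine functions are induced by linear functions. -/
theorem funs_eq {P : PolyhedralStructure X} (hP : IsCompatible P E.ι) {σ : Set X}
    (hσ : σ ∈ P.cells) : P.funs σ = E.affineFuns σ := by
  refine le_antisymm ?_ (by rintro _ ⟨l, rfl⟩; exact pullFuns_mem hP hσ l)
  intro m hm
  by_contra hmn
  have hpoly := P.isPolyhedron σ hσ
  obtain ⟨m₀, A, hr⟩ := hpoly.range_eq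
  -- If `m` were not induced from `N`, some functional `w` would kill all induced functions but not
  -- `m`. Moving an interior point `x` by `ε • w` gives another point of `σ` with the same image
  -- under `ι`; injectivity of `ι` then forces `w m = 0`.
  obtain ⟨w, hw, hker⟩ := Submodule.exists_le_ker_of_notMem
    (p := (E.affineFuns σ).comap (P.funs σ).subtype) (v := ⟨m, hm⟩) (by simpa using hmn)
  have hw0 : ∀ l, w ⟨E.pullFuns σ l, pullFuns_mem hP hσ l⟩ = 0 := fun l => hker ⟨l, rfl⟩
  have hmem : ∀ x, evalMap (P.funs σ) x m₀ = 1 ∧ ∀ a ∈ A, 0 ≤ evalMap (P.funs σ) x a := fun x => by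
    have : evalMap (P.funs σ) x ∈ Set.range (evalMap (P.funs σ)) := ⟨x, rfl⟩
    rwa [hr] at this
  have hm₀ : m₀ = ⟨E.pullFuns σ E.height, pullFuns_mem hP hσ _⟩ := by
    refine Subtype.ext (funext fun x => ?_)
    simpa using (hmem x).1
  obtain ⟨x, hx⟩ := exists_relint_dual hr hpoly.nonempty
  obtain ⟨ε, hε, H⟩ := exists_pos_forall_nonneg A (fun a => evalMap (P.funs σ) x a) (fun a => w a)
    fun a ha => by
      by_cases h0 : a = 0
      · right; simp [h0]
      · left; exact hx a ha h0
  have hz : evalMap (P.funs σ) x + ε • w ∈ Set.range (evalMap (P.funs σ)) := by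
    rw [hr]
    refine ⟨?_, fun a ha => ?_⟩
    · have := hw0 E.height
      rw [← hm₀] at this
      simp [this, (hmem x).1]
    · simpa using H ε hε.le le_rfl a ha
  obtain ⟨z, hz⟩ := hz
  have hzx : z = x := by
    refine Subtype.ext ((hP σ hσ).2 z.2 x.2 ?_)
    by_contra hne
    obtain ⟨l, hl, -⟩ := Submodule.exists_le_ker_of_notMem (p := (⊥ : Submodule ℝ N))
      (v := E.ι z - E.ι x) (by simpa [sub_eq_zero] using hne)
    apply hl
    have := DFunLike.congr_fun hz ⟨E.pullFuns σ l, pullFuns_mem hP hσ l⟩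
    simp only [LinearMap.add_apply, LinearMap.smul_apply, hw0] at this
    rw [map_sub, sub_eq_zero]
    simpa [evalMap] using this
  apply hw
  rw [hzx] at hz
  have := DFunLike.congr_fun hz ⟨m, hm⟩
  simpa [hε.ne'] using this

/-- Faces, described by linear functions on `N`. -/
theorem isFaceOf_affineFuns {σ F : Set X} : IsFaceOf (E.affineFuns σ) F ↔
    ∃ l : N →ₗ[ℝ] ℝ, (∀ x ∈ σ, 0 ≤ l (E.ι x)) ∧ F = {x | x ∈ σ ∧ l (E.ι x) = 0} := by
  constructor
  · rintro ⟨_, ⟨l, rfl⟩, h, rfl⟩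
    refine ⟨l, fun x hx => h ⟨x, hx⟩, ?_⟩
    ext x; simp
  · rintro ⟨l, h, rfl⟩
    refine ⟨_, ⟨l, rfl⟩, fun x => h x x.2, ?_⟩
    ext x; simp

theorem isFaceOf_iff {P : PolyhedralStructure X} (hP : IsCompatible P E.ι) {σ F : Set X}
    (hσ : σ ∈ P.cells) : IsFaceOf (P.funs σ) F ↔
    ∃ l : N →ₗ[ℝ] ℝ, (∀ x ∈ σ, 0 ≤ l (E.ι x)) ∧ F = {x | x ∈ σ ∧ l (E.ι x) = 0} := by
  rw [funs_eq hP hσ, isFaceOf_affineFuns]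

theorem restrictFuns_affineFuns {τ σ : Set X} (h : τ ⊆ σ) :
    restrictFuns h (E.affineFuns σ) = E.affineFuns τ := by
  rw [restrictFuns, affineFuns, affineFuns, ← LinearMap.range_comp]
  rfl

variable (E) in
/-- `ι(σ)` is cut out in its affine span by finitely many linear inequalities. -/
def IsPoly (σ : Set X) : Prop :=
  ∃ A : Finset (N →ₗ[ℝ] ℝ), (∀ a ∈ A, ∀ x ∈ σ, 0 ≤ a (E.ι x)) ∧
    ∀ x ∈ σ, ∀ w ∈ E.dir σ, (∀ a ∈ A, 0 ≤ a (E.ι x + w)) → ∃ z ∈ σ, E.ι z = E.ι x + w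

theorem eq_of_forall_dual {p q : N} (h : ∀ l : N →ₗ[ℝ] ℝ, l p = l q) : p = q := by
  by_contra hne
  obtain ⟨l, hl, -⟩ := Submodule.exists_le_ker_of_notMem (p := (⊥ : Submodule ℝ N))
    (v := p - q) (by simpa [sub_eq_zero] using hne)
  exact hl (by simp [h l])

/-- For a difference `ι x - ι y` the difference of the two evaluations serves, and the rest is
linearity. Displacements in `N` thereby act on the dual of `M_σ`, where the inequalities of a
polyhedron are stated. -/
theorem exists_functional_of_mem_dir {P : PolyhedralStructure X} (hP : IsCompatible P E.ι)
    {σ : Set X} (hσ : σ ∈ P.cells) {w : N} (hw : w ∈ E.dir σ) :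
    ∃ W : Module.Dual ℝ (P.funs σ), ∀ l, W ⟨E.pullFuns σ l, pullFuns_mem hP hσ l⟩ = l w := by
  rw [dir, vectorSpan_def] at hw
  induction hw using Submodule.span_induction with
  | mem w hw =>
    obtain ⟨_, ⟨x, hx, rfl⟩, _, ⟨y, hy, rfl⟩, rfl⟩ := hw
    exact ⟨evalMap _ ⟨x, hx⟩ - evalMap _ ⟨y, hy⟩, fun l => by simp [evalMap]⟩
  | zero => exact ⟨0, fun l => by simp⟩
  | add v w _ _ hv hw =>
    obtain ⟨V, hV⟩ := hv
    obtain ⟨W, hW⟩ := hw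
    exact ⟨V + W, fun l => by simp [hV, hW]⟩
  | smul a w _ hw =>
    obtain ⟨W, hW⟩ := hw
    exact ⟨a • W, fun l => by simp [hW]⟩

/-- By `funs_eq` the defining inequalities lift to linear functions on `N`, and evaluation at `x`
plus the functional of `w` plays the role of the point `ι x + w`. -/
theorem isPoly_of_mem {P : PolyhedralStructure X} (hP : IsCompatible P E.ι)
    {σ : Set X} (hσ : σ ∈ P.cells) : E.IsPoly σ := by
  classical
  obtain ⟨m₀, A, hr⟩ := (P.isPolyhedron σ hσ).range_eq
  have hmem : ∀ x, evalMap (P.funs σ) x m₀ = 1 ∧ ∀ a ∈ A, 0 ≤ evalMap (P.funs σ) x a := fun x => by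
    have : evalMap (P.funs σ) x ∈ Set.range (evalMap (P.funs σ)) := ⟨x, rfl⟩
    rwa [hr] at this
  have hm₀ : m₀ = ⟨E.pullFuns σ E.height, pullFuns_mem hP hσ _⟩ := by
    refine Subtype.ext (funext fun x => ?_)
    simpa using (hmem x).1
  have hlift : ∀ a : P.funs σ, ∃ l : N →ₗ[ℝ] ℝ, E.pullFuns σ l = a.1 := fun a => by
    exact (funs_eq hP hσ).le a.2
  choose g hg using hlift
  refine ⟨A.image g, ?_, ?_⟩
  · intro a ha x hx
    obtain ⟨b, hb, rfl⟩ := Finset.mem_image.1 ha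
    have h1 := congrFun (hg b) ⟨x, hx⟩
    rw [pullFuns_apply] at h1
    have h2 := (hmem ⟨x, hx⟩).2 b hb
    simpa [h1] using h2
  · intro x hx w hw hA
    obtain ⟨W, hW⟩ := exists_functional_of_mem_dir hP hσ hw
    have hz : evalMap (P.funs σ) ⟨x, hx⟩ + W ∈ Set.range (evalMap (P.funs σ)) := by
      rw [hr]
      refine ⟨?_, fun a ha => ?_⟩
      · have := hW E.height
        rw [← hm₀, height_dir hw] at this
        simp [this, (hmem _).1]
      · have h1 := hA _ (Finset.mem_image_of_mem g ha)
        have h2 : a = ⟨E.pullFuns σ (g a), pullFuns_mem hP hσ _⟩ := Subtype.ext (hg a).symm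
        rw [h2, LinearMap.add_apply, hW]
        simpa [evalMap] using h1
    obtain ⟨z, hz⟩ := hz
    refine ⟨z, z.2, eq_of_forall_dual fun l => ?_⟩
    have := DFunLike.congr_fun hz ⟨E.pullFuns σ l, pullFuns_mem hP hσ l⟩
    rw [LinearMap.add_apply, hW] at this
    simpa [evalMap] using this

end EuclideanPolyhedralSpace

/-! ### Topology, recognition and dimension of polyhedra inside `N`. -/

namespace EuclideanPolyhedralSpace

variable {E : EuclideanPolyhedralSpace X N}

section FiniteDimensional

variable [FiniteDimensional ℝ N]

/-- The coordinates of `ι` belong to `M_σ`, so `ι` is continuous on `σ`. Conversely the evaluation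
embedding factors continuously through `ι`, since each `m` is a linear function of `ι x`. -/
theorem isEmbedding_restrict {P : PolyhedralStructure X} (hP : IsCompatible P E.ι) {σ : Set X}
    (hσ : σ ∈ P.cells) : Topology.IsEmbedding (fun x : σ => E.ι x) := by
  have hpoly := P.isPolyhedron σ hσ
  have hlift : ∀ a : P.funs σ, ∃ l : N →ₗ[ℝ] ℝ, E.pullFuns σ l = a.1 :=
    fun a => (funs_eq hP hσ).le a.2
  choose g hg using hlift
  have h1 : Continuous (fun (p : N) (m : P.funs σ) => g m p) :=
    continuous_pi fun m => (g m).continuous_of_finiteDimensional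
  have h2 : Continuous (fun x : σ => E.ι x) := by
    let b := Module.finBasis ℝ N
    have : (fun x : σ => E.ι x) = fun x : σ => ∑ i, (b.coord i) (E.ι x) • b i := by
      funext x
      exact (b.sum_repr _).symm
    rw [this]
    refine continuous_finsetSum _ fun i _ => Continuous.smul ?_ continuous_const
    exact hpoly.continuous _ (pullFuns_mem hP hσ (b.coord i))
  refine Topology.IsEmbedding.of_comp h2 h1 ?_
  convert hpoly.isEmbedding using 1
  funext x m
  exact congrFun (hg m) x

theorem continuous_ι (E : EuclideanPolyhedralSpace X N) : Continuous E.ι := by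
  refine E.base.locallyFinite.continuous ?_ (fun σ => E.base.isClosed _ σ.2) fun σ => ?_
  · rw [← Set.sUnion_eq_iUnion, E.base.covers]
  · exact continuousOn_iff_continuous_domRestrict.2
      (isEmbedding_restrict E.base_compatible σ.2).continuous

/-- Points of a polyhedron whose images in `N` are close are close in `X`. -/
theorem exists_forall_norm_lt_mem {P : PolyhedralStructure X} (hP : IsCompatible P E.ι) {σ : Set X}
    (hσ : σ ∈ P.cells) {x : X} (hx : x ∈ σ) {O : Set X} (hO : O ∈ nhds x) :
    ∃ δ > 0, ∀ z ∈ σ, ‖E.ι z - E.ι x‖ < δ → z ∈ O := by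
  have hO' : (Subtype.val ⁻¹' O : Set σ) ∈ nhds (⟨x, hx⟩ : σ) :=
    continuous_subtype_val.continuousAt hO
  rw [(isEmbedding_restrict hP hσ).nhds_eq_comap, Filter.mem_comap] at hO'
  obtain ⟨t, ht, hsub⟩ := hO'
  obtain ⟨δ, hδ, hball⟩ := Metric.mem_nhds_iff.1 ht
  refine ⟨δ, hδ, fun z hz hzx => ?_⟩
  exact @hsub ⟨z, hz⟩ (hball (by simpa [dist_eq_norm] using hzx))

omit [FiniteDimensional ℝ N] in
theorem mem_span_image_of_dual {σ : Set X} {q : N}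
    (h : ∀ l : N →ₗ[ℝ] ℝ, (∀ x ∈ σ, l (E.ι x) = 0) → l q = 0) :
    q ∈ Submodule.span ℝ (E.ι '' σ) := by
  by_contra hq
  obtain ⟨l, hl, hker⟩ := Submodule.exists_le_ker_of_notMem hq
  exact hl (h l fun x hx => hker (Submodule.subset_span ⟨x, hx, rfl⟩))

omit [FiniteDimensional ℝ N] in
theorem span_image_eq {σ : Set X} {x : X} (hx : x ∈ σ) :
    Submodule.span ℝ (E.ι '' σ) = E.dir σ ⊔ Submodule.span ℝ {E.ι x} := by
  apply le_antisymm
  · rw [Submodule.span_le]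
    rintro _ ⟨z, hz, rfl⟩
    have : E.ι z = (E.ι z - E.ι x) + E.ι x := by abel
    rw [this]
    exact Submodule.add_mem_sup (sub_mem_dir hz hx) (Submodule.mem_span_singleton_self _)
  · refine sup_le (dir_le_iff.2 fun a ha b hb => ?_) ?_
    · exact sub_mem (Submodule.subset_span ⟨a, ha, rfl⟩) (Submodule.subset_span ⟨b, hb, rfl⟩)
    · rw [Submodule.span_singleton_le_iff_mem]
      exact Submodule.subset_span ⟨x, hx, rfl⟩

omit [FiniteDimensional ℝ N] in
theorem sub_mem_dir_of_mem_span {σ : Set X} {x : X} (hx : x ∈ σ) {q : N}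
    (hq : q ∈ Submodule.span ℝ (E.ι '' σ)) (hh : E.height q = 1) : q - E.ι x ∈ E.dir σ := by
  rw [span_image_eq hx, Submodule.mem_sup] at hq
  obtain ⟨w, hw, v, hv, rfl⟩ := hq
  obtain ⟨a, rfl⟩ := Submodule.mem_span_singleton.1 hv
  rw [map_add, height_dir hw, map_smul, height_ι] at hh
  have : a = 1 := by simpa using hh
  simpa [this] using hw

/-- This is the converse of `isPoly_of_mem`, needed to build the cells of a subdivision. By
biduality a functional `p` is evaluation at some `q : N`; it kills functions vanishing on `σ`, so
`q` lies in the linear span of `ι(σ)`, and height one puts it in the affine span. -/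
theorem isPolyhedron_of_isPoly {σ : Set X} (hne : σ.Nonempty)
    (hemb : Topology.IsEmbedding (fun x : σ => E.ι x)) (hpoly : E.IsPoly σ) :
    IsPolyhedron σ (E.affineFuns σ) := by
  classical
  have hcont : ∀ m ∈ E.affineFuns σ, Continuous m := by
    rintro _ ⟨l, rfl⟩
    exact l.continuous_of_finiteDimensional.comp hemb.continuous
  refine ⟨hne, inferInstanceAs (Module.Finite ℝ (LinearMap.range _)), hcont, ?_, ?_⟩
  · let b := Module.finBasis ℝ N
    let c : Fin (Module.finrank ℝ N) → E.affineFuns σ := fun i => ⟨E.pullFuns σ (b.coord i), _, rfl⟩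
    refine Topology.IsEmbedding.of_comp
      (g := fun q : E.affineFuns σ → ℝ => ∑ i, q (c i) • b i) ?_ ?_ ?_
    · exact continuous_pi fun m => hcont m.1 m.2
    · exact continuous_finsetSum _ fun i _ => (continuous_apply _).smul continuous_const
    · convert hemb using 1
      funext x
      exact b.sum_repr _
  · obtain ⟨A, hA, hA'⟩ := hpoly
    refine ⟨⟨E.pullFuns σ E.height, _, rfl⟩, A.image fun a => ⟨E.pullFuns σ a, _, rfl⟩, ?_⟩
    ext p
    constructor
    · rintro ⟨x, rfl⟩
      refine ⟨by simp, fun a ha => ?_⟩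
      obtain ⟨b, hb, rfl⟩ := Finset.mem_image.1 ha
      exact hA b hb x x.2
    · rintro ⟨h1, h2⟩
      obtain ⟨q, hq⟩ : ∃ q : N, ∀ l : Module.Dual ℝ N, l q = p ⟨E.pullFuns σ l, _, rfl⟩ := by
        obtain ⟨q, hq⟩ := (Module.evalEquiv ℝ N).surjective
          (p ∘ₗ (E.pullFuns σ).rangeRestrict)
        exact ⟨q, fun l => DFunLike.congr_fun hq l⟩
      obtain ⟨x, hx⟩ := hne
      have hw : q - E.ι x ∈ E.dir σ := by
        refine sub_mem_dir_of_mem_span hx (mem_span_image_of_dual fun l hl => ?_) ?_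
        · rw [hq]
          have : (⟨E.pullFuns σ l, l, rfl⟩ : E.affineFuns σ) = 0 :=
            Subtype.ext (funext fun z => hl z z.2)
          rw [this, map_zero]
        · rw [hq]; exact h1
      obtain ⟨z, hz, hzq⟩ := hA' x hx _ hw fun a ha => by
        rw [add_sub_cancel, hq]
        exact h2 _ (Finset.mem_image_of_mem _ ha)
      rw [add_sub_cancel] at hzq
      refine ⟨⟨z, hz⟩, LinearMap.ext ?_⟩
      rintro ⟨_, l, rfl⟩
      rw [← hq, ← hzq]
      rfl

/-- The kernel of `pullFuns` is the annihilator of the linear span of `ι(σ)`. That span exceeds the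
direction of `σ` by one dimension because the hyperplane of height one misses the origin. -/
theorem finrank_affineFuns {σ : Set X} (hne : σ.Nonempty) :
    Module.finrank ℝ (E.affineFuns σ) = Module.finrank ℝ (E.dir σ) + 1 := by
  obtain ⟨x, hx⟩ := hne
  have hker : LinearMap.ker (E.pullFuns σ) =
      (Submodule.span ℝ (E.ι '' σ)).dualAnnihilator := by
    ext l
    rw [LinearMap.mem_ker, Submodule.mem_dualAnnihilator]
    constructor
    · intro h w hw
      have : Submodule.span ℝ (E.ι '' σ) ≤ LinearMap.ker l := by
        rw [Submodule.span_le]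
        rintro _ ⟨z, hz, rfl⟩
        exact congrFun h ⟨z, hz⟩
      exact this hw
    · intro h
      funext z
      exact h _ (Submodule.subset_span ⟨z, z.2, rfl⟩)
  have h1 := LinearMap.finrank_range_add_finrank_ker (E.pullFuns σ)
  have h2 := Subspace.finrank_add_finrank_dualAnnihilator_eq (Submodule.span ℝ (E.ι '' σ))
  rw [hker, Subspace.dual_finrank_eq] at h1
  have h3 : E.dir σ ⊓ Submodule.span ℝ {E.ι x} = ⊥ := by
    rw [eq_bot_iff]
    rintro w ⟨hw, hw'⟩
    obtain ⟨a, rfl⟩ := Submodule.mem_span_singleton.1 hw'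
    have := height_dir hw
    rw [map_smul, height_ι] at this
    have : a = 0 := by simpa using this
    simp [this]
  have h4 := Submodule.finrank_sup_add_finrank_inf_eq (E.dir σ) (Submodule.span ℝ {E.ι x})
  have hx0 : E.ι x ≠ 0 := fun h0 => by
    have := E.height_ι x
    rw [h0, map_zero] at this
    exact zero_ne_one this
  rw [h3, finrank_bot, ← span_image_eq hx, finrank_span_singleton hx0] at h4
  change Module.finrank ℝ (LinearMap.range (E.pullFuns σ)) = _
  omega

theorem dim_eq {P : PolyhedralStructure X} (hP : IsCompatible P E.ι) {σ : Set X}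
    (hσ : σ ∈ P.cells) : P.dim σ = Module.finrank ℝ (E.dir σ) := by
  rw [PolyhedralStructure.dim, funs_eq hP hσ, finrank_affineFuns (P.isPolyhedron σ hσ).nonempty]
  rfl

end FiniteDimensional

end EuclideanPolyhedralSpace

/-! ### Combinatorics of the polyhedra containing a point. -/

namespace PolyhedralStructure

variable (P : PolyhedralStructure X)

theorem finite_cells_at (x : X) : {σ | σ ∈ P.cells ∧ x ∈ σ}.Finite := by
  refine ((P.locallyFinite.point_finite x).image (fun σ : P.cells => (σ : Set X))).subset ?_
  rintro σ ⟨hσ, hx⟩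
  exact ⟨⟨σ, hσ⟩, hx, rfl⟩

theorem exists_cell (x : X) : ∃ σ ∈ P.cells, x ∈ σ := by
  have : x ∈ ⋃₀ P.cells := by rw [P.covers]; trivial
  simpa using this

theorem inter_mem {σ τ : Set X} (hσ : σ ∈ P.cells) (hτ : τ ∈ P.cells) (h : (σ ∩ τ).Nonempty) :
    σ ∩ τ ∈ P.cells := P.face_mem σ hσ _ (P.inter_face σ hσ τ hτ h).1 h

theorem isFaceOf_of_subset {σ τ : Set X} (hσ : σ ∈ P.cells) (hτ : τ ∈ P.cells) (h : τ ⊆ σ) :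
    IsFaceOf (P.funs σ) τ := by
  have h1 : σ ∩ τ = τ := Set.inter_eq_self_of_subset_right h
  have h2 := (P.inter_face σ hσ τ hτ (by rw [h1]; exact (P.isPolyhedron τ hτ).nonempty)).1
  rwa [h1] at h2

/-- The smallest polyhedron containing a point. -/
def carrier (x : X) : Set X := ⋂₀ {σ | σ ∈ P.cells ∧ x ∈ σ}

theorem mem_carrier (x : X) : x ∈ P.carrier x := fun _ h => h.2

theorem carrier_subset {x : X} {σ : Set X} (hσ : σ ∈ P.cells) (hx : x ∈ σ) : P.carrier x ⊆ σ :=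
  Set.sInter_subset_of_mem ⟨hσ, hx⟩

theorem carrier_mem (x : X) : P.carrier x ∈ P.cells := by
  have hfin := P.finite_cells_at x
  suffices H : ∀ S : Set (Set X), S.Finite → S ⊆ {σ | σ ∈ P.cells ∧ x ∈ σ} → S.Nonempty →
      ⋂₀ S ∈ P.cells by
    obtain ⟨σ, hσ, hx⟩ := P.exists_cell x
    exact H _ hfin subset_rfl ⟨σ, hσ, hx⟩
  intro S hS
  induction S, hS using Set.Finite.induction_on with
  | empty => exact fun _ h => absurd h Set.not_nonempty_empty
  | @insert σ S _ _ ih =>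
    intro hsub _
    rw [Set.sInter_insert]
    have hσ := hsub (Set.mem_insert _ _)
    rcases S.eq_empty_or_nonempty with rfl | hne
    · simpa using hσ.1
    · have hS' := (Set.subset_insert σ S).trans hsub
      exact P.inter_mem hσ.1 (ih hS' hne) ⟨x, hσ.2, fun τ hτ => (hS' hτ).2⟩

/-- A neighbourhood of `x` can be shrunk to meet only polyhedra containing `x`. -/
theorem exists_isOpen_forall_mem {x : X} {O : Set X} (hO : O ∈ nhds x) :
    ∃ V ⊆ O, IsOpen V ∧ x ∈ V ∧ ∀ σ ∈ P.cells, (σ ∩ V).Nonempty → x ∈ σ := by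
  obtain ⟨t, ht, hfin⟩ := P.locallyFinite x
  obtain ⟨V, hVsub, hVo, hxV⟩ := mem_nhds_iff.1 (Filter.inter_mem ht hO)
  have hC : IsClosed (⋃ σ ∈ {σ : P.cells | ((σ : Set X) ∩ t).Nonempty ∧ x ∉ (σ : Set X)},
      (σ : Set X)) :=
    (hfin.subset fun σ h => h.1).isClosed_biUnion fun σ _ => P.isClosed σ σ.2
  refine ⟨V \ _, Set.sdiff_subset.trans (hVsub.trans Set.inter_subset_right),
    hVo.sdiff hC, ⟨hxV, ?_⟩, ?_⟩
  · simp only [Set.mem_iUnion, not_exists]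
    rintro σ ⟨-, h⟩ h'
    exact h h'
  · rintro σ hσ ⟨z, hzσ, hzV, hzC⟩
    by_contra hx
    apply hzC
    simp only [Set.mem_iUnion]
    exact ⟨⟨σ, hσ⟩, ⟨⟨z, hzσ, (hVsub hzV).1⟩, hx⟩, hzσ⟩

theorem exists_maximal {σ : Set X} (hσ : σ ∈ P.cells) :
    ∃ σ' ∈ P.cells, σ ⊆ σ' ∧ ∀ ρ ∈ P.cells, σ' ⊆ ρ → ρ = σ' := by
  obtain ⟨x, hx⟩ := (P.isPolyhedron σ hσ).nonempty
  obtain ⟨σ', hle, hmax⟩ := (P.finite_cells_at x).exists_le_maximal (a := σ) ⟨hσ, hx⟩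
  exact ⟨σ', hmax.1.1, hle, fun ρ hρ h => (hmax.2 ⟨hρ, h hmax.1.2⟩ h).antisymm h⟩

end PolyhedralStructure

/-! ### Convexity, relative interiors and faces. -/

namespace EuclideanPolyhedralSpace

variable {E : EuclideanPolyhedralSpace X N}

theorem IsPoly.exists_combo {σ : Set X} (hσ : E.IsPoly σ) {x z : X} (hx : x ∈ σ) (hz : z ∈ σ)
    {t : ℝ} (h0 : 0 ≤ t) (h1 : t ≤ 1) : ∃ w ∈ σ, E.ι w = E.ι x + t • (E.ι z - E.ι x) := by
  obtain ⟨A, hA, hA'⟩ := hσ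
  refine hA' x hx _ (Submodule.smul_mem _ _ (sub_mem_dir hz hx)) fun a ha => ?_
  have h2 := hA a ha x hx
  have h3 := hA a ha z hz
  simp only [map_add, map_smul, map_sub, smul_eq_mul]
  nlinarith

variable (E) in
/-- The relative interior of a polyhedron: the points on no proper face. -/
def relint (σ : Set X) : Set X :=
  {x | x ∈ σ ∧ ∀ l : N →ₗ[ℝ] ℝ, (∀ z ∈ σ, 0 ≤ l (E.ι z)) → l (E.ι x) = 0 →
    ∀ z ∈ σ, l (E.ι z) = 0}

/-- An inequality tight at `x` vanishes on all of `σ`, hence on its direction; the others have slack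
at `x`. The hypothesis concerns only the given system `A`, so that the lemma can be used to prove
that relative interiors are nonempty. -/
theorem exists_extend_of_forall {σ : Set X} {A : Finset (N →ₗ[ℝ] ℝ)}
    (hA : ∀ a ∈ A, ∀ x ∈ σ, 0 ≤ a (E.ι x))
    (hA' : ∀ x ∈ σ, ∀ w ∈ E.dir σ, (∀ a ∈ A, 0 ≤ a (E.ι x + w)) → ∃ z ∈ σ, E.ι z = E.ι x + w)
    {x : X} (hx : x ∈ σ) (hgood : ∀ a ∈ A, a (E.ι x) = 0 → ∀ z ∈ σ, a (E.ι z) = 0)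
    {w : N} (hw : w ∈ E.dir σ) :
    ∃ ε > 0, ∀ t : ℝ, 0 ≤ t → t ≤ ε → ∃ z ∈ σ, E.ι z = E.ι x + t • w := by
  obtain ⟨ε, hε, H⟩ := exists_pos_forall_nonneg A (fun a => a (E.ι x)) (fun a => a w)
    fun a ha => by
      by_cases h0 : a (E.ι x) = 0
      · right
        refine ⟨h0.ge, le_of_eq (Eq.symm ?_)⟩
        have h1 := hgood a ha h0
        exact apply_dir_eq_zero (fun u hu v hv => by rw [h1 u hu, h1 v hv]) hw
      · left
        exact lt_of_le_of_ne (hA a ha x hx) (Ne.symm h0)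
  refine ⟨ε, hε, fun t ht hte => hA' x hx _ (Submodule.smul_mem _ _ hw) fun a ha => ?_⟩
  simpa using H t ht hte a ha

theorem IsPoly.exists_extend {σ : Set X} (hσ : E.IsPoly σ) {x : X} (hx : x ∈ E.relint σ) {w : N}
    (hw : w ∈ E.dir σ) :
    ∃ ε > 0, ∀ t : ℝ, 0 ≤ t → t ≤ ε → ∃ z ∈ σ, E.ι z = E.ι x + t • w := by
  obtain ⟨A, hA, hA'⟩ := hσ
  exact exists_extend_of_forall hA hA' hx.1 (fun a ha h0 => hx.2 a (hA a ha) h0) hw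

theorem mem_relint_of_combo {σ : Set X} {x z w : X} (hx : x ∈ E.relint σ) (hz : z ∈ σ) (hw : w ∈ σ)
    {t : ℝ} (h0 : 0 ≤ t) (h1 : t < 1) (h : E.ι w = E.ι x + t • (E.ι z - E.ι x)) :
    w ∈ E.relint σ := by
  refine ⟨hw, fun l hl hlw => hx.2 l hl ?_⟩
  rw [h] at hlw
  simp only [map_add, map_smul, map_sub, smul_eq_mul] at hlw
  have h2 := hl x hx.1
  have h3 := hl z hz
  have h4 : 0 ≤ t * l (E.ι z) := mul_nonneg h0 h3
  have h5 : (1 - t) * l (E.ι x) = 0 := by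
    have : 0 ≤ (1 - t) * l (E.ι x) := mul_nonneg (by linarith) h2
    linarith
  rcases mul_eq_zero.1 h5 with h5 | h5
  · linarith
  · exact h5

theorem IsPoly.exists_extend_relint {σ : Set X} (hσ : E.IsPoly σ) {x : X} (hx : x ∈ E.relint σ)
    {w : N} (hw : w ∈ E.dir σ) :
    ∃ ε > 0, ∀ t : ℝ, 0 ≤ t → t ≤ ε → ∃ z ∈ E.relint σ, E.ι z = E.ι x + t • w := by
  obtain ⟨ε, hε, H⟩ := hσ.exists_extend hx hw
  obtain ⟨y, hy, hy'⟩ := H ε hε.le le_rfl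
  refine ⟨ε / 2, by positivity, fun t ht hte => ?_⟩
  obtain ⟨z, hz, hz'⟩ := H t ht (by linarith)
  refine ⟨z, mem_relint_of_combo hx hy hz (t := t / ε) (by positivity) ?_ ?_, hz'⟩
  · rw [div_lt_one hε]; linarith
  · rw [hz', hy', add_sub_cancel_left, smul_smul, div_mul_cancel₀ _ hε.ne']

/-- Taking midpoints yields `x ∈ σ` at which only those inequalities of `A` are tight that are tight
on all of `σ`. From such an `x` one can move a little away from any `z ∈ σ`; a function nonnegative
on `σ` and zero at `x` must then vanish at `z`. -/
theorem IsPoly.relint_nonempty {σ : Set X} (hσ : E.IsPoly σ) (hne : σ.Nonempty) :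
    (E.relint σ).Nonempty := by
  classical
  have hconv := @hσ.exists_combo
  obtain ⟨A, hA, hA'⟩ := hσ
  obtain ⟨x, hx, hgood⟩ : ∃ x ∈ σ, ∀ a ∈ A, a (E.ι x) = 0 → ∀ z ∈ σ, a (E.ι z) = 0 := by
    suffices H : ∀ B ⊆ A, ∃ x ∈ σ, ∀ a ∈ B, a (E.ι x) = 0 → ∀ z ∈ σ, a (E.ι z) = 0 from
      H A subset_rfl
    intro B
    induction B using Finset.induction_on with
    | empty => exact fun _ => ⟨hne.some, hne.some_mem, by simp⟩
    | insert b B _ ih =>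
      intro hB
      obtain ⟨x, hx, hgood⟩ := ih ((Finset.subset_insert _ _).trans hB)
      by_cases hb : ∀ z ∈ σ, b (E.ι z) = 0
      · refine ⟨x, hx, fun a ha => ?_⟩
        rcases Finset.mem_insert.1 ha with rfl | ha
        · exact fun _ => hb
        · exact hgood a ha
      · push Not at hb
        obtain ⟨y, hy, hby⟩ := hb
        obtain ⟨z, hz, hz'⟩ := hconv hx hy (t := 1 / 2) (by norm_num) (by norm_num)
        have key : ∀ a ∈ A, a (E.ι z) = 0 → a (E.ι x) = 0 ∧ a (E.ι y) = 0 := by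
          intro a ha h0
          rw [hz'] at h0
          simp only [map_add, map_smul, map_sub, smul_eq_mul] at h0
          have h1 := hA a ha x hx
          have h2 := hA a ha y hy
          constructor <;> linarith
        refine ⟨z, hz, fun a ha h0 => ?_⟩
        have h1 := key a (hB ha) h0
        rcases Finset.mem_insert.1 ha with rfl | ha
        · exact absurd h1.2 hby
        · exact hgood a ha h1.1
  refine ⟨x, hx, fun l hl h0 z hz => ?_⟩
  obtain ⟨ε, hε, H⟩ := exists_extend_of_forall hA hA' hx hgood (sub_mem_dir hx hz)
  obtain ⟨u, hu, hu'⟩ := H ε hε.le le_rfl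
  have h1 := hl u hu
  rw [hu'] at h1
  simp only [map_add, map_smul, map_sub, smul_eq_mul, h0] at h1
  have h2 := hl z hz
  nlinarith

section FiniteDimensional

variable [FiniteDimensional ℝ N] {P : PolyhedralStructure X} (hP : IsCompatible P E.ι)

include hP

omit [FiniteDimensional ℝ N] in
theorem exists_exposing {σ τ : Set X} (hσ : σ ∈ P.cells) (hτ : τ ∈ P.cells) (h : τ ⊆ σ) :
    ∃ l : N →ₗ[ℝ] ℝ, (∀ x ∈ σ, 0 ≤ l (E.ι x)) ∧ τ = {x | x ∈ σ ∧ l (E.ι x) = 0} :=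
  (isFaceOf_iff hP hσ).1 (P.isFaceOf_of_subset hσ hτ h)

omit [FiniteDimensional ℝ N] in
theorem zeroSet_mem {σ : Set X} (hσ : σ ∈ P.cells) {l : N →ₗ[ℝ] ℝ} (hl : ∀ x ∈ σ, 0 ≤ l (E.ι x))
    {x : X} (hx : x ∈ σ) (h0 : l (E.ι x) = 0) : {x | x ∈ σ ∧ l (E.ι x) = 0} ∈ P.cells :=
  P.face_mem σ hσ _ ((isFaceOf_iff hP hσ).2 ⟨l, hl, rfl⟩) ⟨x, hx, h0⟩

omit [FiniteDimensional ℝ N] in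
-- The intersection `τ ∩ σ` is a face of `τ`, and the function exposing it vanishes at a relative
-- interior point of `τ`, hence on `τ`.
theorem subset_of_mem_relint {σ τ : Set X} (hσ : σ ∈ P.cells) (hτ : τ ∈ P.cells) {x : X}
    (hx : x ∈ E.relint τ) (hxσ : x ∈ σ) : τ ⊆ σ := by
  have hne : (τ ∩ σ).Nonempty := ⟨x, hx.1, hxσ⟩
  obtain ⟨l, hl, h⟩ := (isFaceOf_iff hP hτ).1 (P.inter_face τ hτ σ hσ hne).1
  have hx0 : x ∈ τ ∩ σ := ⟨hx.1, hxσ⟩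
  rw [h] at hx0
  intro z hz
  have : z ∈ τ ∩ σ := by
    rw [h]
    exact ⟨hz, hx.2 l hl hx0.2 z hz⟩
  exact this.2

omit [FiniteDimensional ℝ N] in
-- A face of the carrier through `x` is itself a polyhedron containing `x`, so it contains the
-- carrier.
theorem mem_relint_carrier (x : X) : x ∈ E.relint (P.carrier x) := by
  refine ⟨P.mem_carrier x, fun l hl h0 z hz => ?_⟩
  have h1 := zeroSet_mem hP (P.carrier_mem x) hl (P.mem_carrier x) h0
  exact (P.carrier_subset h1 ⟨P.mem_carrier x, h0⟩ hz).2

omit [FiniteDimensional ℝ N] in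
theorem carrier_eq {τ : Set X} (hτ : τ ∈ P.cells) {x : X} (hx : x ∈ E.relint τ) :
    P.carrier x = τ :=
  (P.carrier_subset hτ hx.1).antisymm
    (subset_of_mem_relint hP (P.carrier_mem x) hτ hx (P.mem_carrier x))

theorem dim_le_of_subset {σ τ : Set X} (hσ : σ ∈ P.cells) (hτ : τ ∈ P.cells) (h : τ ⊆ σ) :
    P.dim τ ≤ P.dim σ := by
  rw [dim_eq hP hσ, dim_eq hP hτ]
  exact Submodule.finrank_mono (dir_mono h)

/-- Equal dimensions give equal directions, so the function exposing `τ` in `σ` is constant on `σ`.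
-/
theorem eq_of_dim_le {σ τ : Set X} (hσ : σ ∈ P.cells) (hτ : τ ∈ P.cells) (h : τ ⊆ σ)
    (hd : P.dim σ ≤ P.dim τ) : τ = σ := by
  rw [dim_eq hP hσ, dim_eq hP hτ] at hd
  obtain ⟨l, hl, hF⟩ := exists_exposing hP hσ hτ h
  have hdir := Submodule.eq_of_le_of_finrank_le (dir_mono (E := E) h) hd
  refine h.antisymm fun z hz => ?_
  obtain ⟨x, hx⟩ := (P.isPolyhedron τ hτ).nonempty
  have h1 : E.ι z - E.ι x ∈ E.dir τ := by
    rw [hdir]; exact sub_mem_dir hz (h hx)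
  have hτ0 : ∀ u ∈ τ, l (E.ι u) = 0 := fun u hu => by rw [hF] at hu; exact hu.2
  have h2 := apply_dir_eq_zero (l := l) (fun u hu v hv => by rw [hτ0 u hu, hτ0 v hv]) h1
  rw [map_sub, hτ0 x hx, sub_zero] at h2
  rw [hF]
  exact ⟨hz, h2⟩

theorem dim_lt_of_notMem {σ τ : Set X} (hσ : σ ∈ P.cells) (hτ : τ ∈ P.cells) (h : τ ⊆ σ) {x : X}
    (hx : x ∈ σ) (hx' : x ∉ τ) : P.dim τ < P.dim σ := by
  by_contra hd
  rw [eq_of_dim_le hP hσ hτ h (not_lt.1 hd)] at hx'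
  exact hx' hx

end FiniteDimensional

theorem HasPureDimension.dim_le [FiniteDimensional ℝ N] {n : ℕ} (hn : E.HasPureDimension n)
    {P : PolyhedralStructure X} (hP : E.IsComplex P) {σ : Set X} (hσ : σ ∈ P.cells) :
    P.dim σ ≤ n := by
  obtain ⟨σ', hσ', hsub, hmax⟩ := P.exists_maximal hσ
  rw [← hn P hP σ' hσ' hmax]
  exact dim_le_of_subset hP.2 hσ' hσ hsub

theorem HasPureDimension.exists_dim_eq {n : ℕ} (hn : E.HasPureDimension n)
    {P : PolyhedralStructure X} (hP : E.IsComplex P) {σ : Set X} (hσ : σ ∈ P.cells) :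
    ∃ σ' ∈ P.cells, σ ⊆ σ' ∧ P.dim σ' = n := by
  obtain ⟨σ', hσ', hsub, hmax⟩ := P.exists_maximal hσ
  exact ⟨σ', hσ', hsub, hn P hP σ' hσ' hmax⟩

end EuclideanPolyhedralSpace

/-! ### Facets and their unit normals. -/

theorem exists_unit_orthogonal {N : Type*} [NormedAddCommGroup N] [InnerProductSpace ℝ N]
    [FiniteDimensional ℝ N] {S T : Submodule ℝ N} {z : N} (hle : T ≤ S) (hz : z ∈ S) (hzT : z ∉ T) :
    ∃ v ∈ S, ‖v‖ = 1 ∧ ∀ w ∈ T, ⟪w, v⟫_ℝ = 0 := by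
  set u := z - T.starProjection z with hu
  have huT : ∀ w ∈ T, ⟪w, u⟫_ℝ = 0 := fun w hw =>
    (Submodule.mem_orthogonal T u).1 (Submodule.sub_starProjection_mem_orthogonal z) w hw
  have hmem : T.starProjection z ∈ T := Submodule.starProjection_apply_mem T z
  have hu0 : u ≠ 0 := fun h0 => hzT (by
    rw [hu, sub_eq_zero] at h0
    rw [h0]; exact hmem)
  refine ⟨‖u‖⁻¹ • u, S.smul_mem _ (S.sub_mem hz (hle hmem)), ?_, fun w hw => ?_⟩
  · rw [norm_smul, norm_inv, norm_norm, inv_mul_cancel₀ (norm_ne_zero_iff.2 hu0)]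
  · rw [inner_smul_right, huT w hw, mul_zero]

theorem sub_inner_smul_mem {N : Type*} [NormedAddCommGroup N] [InnerProductSpace ℝ N]
    [FiniteDimensional ℝ N] {S T : Submodule ℝ N} {v z : N} (hle : T ≤ S)
    (hfin : Module.finrank ℝ S = Module.finrank ℝ T + 1) (hv : v ∈ S) (hv1 : ‖v‖ = 1)
    (hvT : ∀ w ∈ T, ⟪w, v⟫_ℝ = 0) (hz : z ∈ S) : z - ⟪v, z⟫_ℝ • v ∈ T := by
  have hv0 : v ≠ 0 := fun h => by simp [h] at hv1
  have hinf : T ⊓ Submodule.span ℝ {v} = ⊥ := by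
    rw [eq_bot_iff]
    rintro w ⟨hw, hw'⟩
    obtain ⟨a, rfl⟩ := Submodule.mem_span_singleton.1 hw'
    have := hvT _ hw
    rw [inner_smul_left, real_inner_self_eq_norm_sq, hv1] at this
    have : a = 0 := by simpa using this
    simp [this]
  have h1 := Submodule.finrank_sup_add_finrank_inf_eq T (Submodule.span ℝ {v})
  rw [hinf, finrank_bot, finrank_span_singleton hv0] at h1
  have h2 : T ⊔ Submodule.span ℝ {v} = S :=
    Submodule.eq_of_le_of_finrank_le
      (sup_le hle ((Submodule.span_singleton_le_iff_mem _ _).2 hv)) (by omega)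
  rw [← h2, Submodule.mem_sup] at hz
  obtain ⟨t, ht, u, hu, rfl⟩ := hz
  obtain ⟨a, rfl⟩ := Submodule.mem_span_singleton.1 hu
  have : ⟪v, t + a • v⟫_ℝ = a := by
    rw [inner_add_right, inner_smul_right, real_inner_self_eq_norm_sq, hv1, real_inner_comm, hvT t ht]
    simp
  rw [this, add_sub_cancel_right]
  exact ht

/-- A unit vector `v` orthogonal to a hyperplane `T` of `S` is unique up to sign. -/
theorem eq_inner_smul {N : Type*} [NormedAddCommGroup N] [InnerProductSpace ℝ N]
    [FiniteDimensional ℝ N] {S T : Submodule ℝ N} {v z : N} (hle : T ≤ S)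
    (hfin : Module.finrank ℝ S = Module.finrank ℝ T + 1) (hv : v ∈ S) (hv1 : ‖v‖ = 1)
    (hvT : ∀ w ∈ T, ⟪w, v⟫_ℝ = 0) (hz : z ∈ S) (hzT : ∀ w ∈ T, ⟪w, z⟫_ℝ = 0) :
    z = ⟪v, z⟫_ℝ • v := by
  have h1 := sub_inner_smul_mem hle hfin hv hv1 hvT hz
  have h2 : ⟪z - ⟪v, z⟫_ℝ • v, z - ⟪v, z⟫_ℝ • v⟫_ℝ = 0 := by
    rw [inner_sub_right, inner_smul_right, hzT _ h1, hvT _ h1]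
    simp
  exact sub_eq_zero.1 (inner_self_eq_zero.1 h2)

namespace PolyhedralStructure

/-- `τ` is a facet of `σ`. -/
structure IsFacet (P : PolyhedralStructure X) (σ τ : Set X) : Prop where
  cell : σ ∈ P.cells
  facet : τ ∈ P.cells
  subset : τ ⊆ σ
  dim_eq : P.dim σ = P.dim τ + 1

theorem IsFacet.exists_notMem {P : PolyhedralStructure X} {σ τ : Set X} (h : P.IsFacet σ τ) :
    ∃ z ∈ σ, z ∉ τ := by
  by_contra! hsub
  have : τ = σ := h.subset.antisymm hsub
  have := h.dim_eq
  simp_all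

/-- A polyhedron containing `τ` meets `U` as soon as `τ` does, so `U` plays no role. -/
theorem mem_cofacets_iff {P : PolyhedralStructure X} {U τ : Set X} (hτ : τ ∈ P.restrict U)
    {σ : Set X} : σ ∈ P.cofacets U τ ↔ P.IsFacet σ τ := by
  constructor
  · rintro ⟨⟨⟨hσ, -⟩, hd⟩, m, -, -, hF⟩
    refine ⟨hσ, hτ.1, fun x hx => ?_, hd⟩
    rw [hF] at hx
    exact hx.1
  · rintro ⟨hσ, _, hsub, hd⟩
    exact ⟨⟨⟨hσ, hτ.2.mono (Set.inter_subset_inter_left _ hsub)⟩, hd⟩,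
      P.isFaceOf_of_subset hσ hτ.1 hsub⟩

end PolyhedralStructure

namespace EuclideanPolyhedralSpace

variable {E : EuclideanPolyhedralSpace X N}

theorem isUnitNormal_iff {σ τ : Set X} {v : N} : E.IsUnitNormal σ τ v ↔
    ‖v‖ = 1 ∧ v ∈ E.dir σ ∧ (∀ w ∈ E.dir τ, ⟪w, v⟫_ℝ = 0) ∧
      ∀ x ∈ σ, ∀ y ∈ τ, 0 ≤ ⟪v, E.ι x - E.ι y⟫_ℝ := by
  rw [IsUnitNormal, span_direction, span_direction]

theorem apply_eq_zero_of_subset_zeroSet {τ : Set X} {l : N →ₗ[ℝ] ℝ}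
    (hτ0 : ∀ u ∈ τ, l (E.ι u) = 0) {w : N} (hw : w ∈ E.dir τ) : l w = 0 :=
  apply_dir_eq_zero (fun u hu v hv => by rw [hτ0 u hu, hτ0 v hv]) hw

section FiniteDimensional

variable [FiniteDimensional ℝ N] {P : PolyhedralStructure X} (hP : IsCompatible P E.ι)

include hP

theorem finrank_dir_facet {σ τ : Set X} (h : P.IsFacet σ τ) :
    Module.finrank ℝ (E.dir σ) = Module.finrank ℝ (E.dir τ) + 1 := by
  rw [← dim_eq hP h.cell, ← dim_eq hP h.facet, h.dim_eq]

/-- Were the product zero, `ι z - ι y` would be parallel to `τ`, and the function exposing `τ` would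
vanish at `z`. -/
theorem inner_pos_of_isUnitNormal {σ τ : Set X} (h : P.IsFacet σ τ) {v : N}
    (hv : E.IsUnitNormal σ τ v) {z y : X} (hz : z ∈ σ) (hzτ : z ∉ τ) (hy : y ∈ τ) :
    0 < ⟪v, E.ι z - E.ι y⟫_ℝ := by
  obtain ⟨h1, h2, h3, h4⟩ := isUnitNormal_iff.1 hv
  refine lt_of_le_of_ne (h4 z hz y hy) fun h0 => ?_
  obtain ⟨l, hl, hF⟩ := exists_exposing hP h.cell h.facet h.subset
  have hτ0 : ∀ u ∈ τ, l (E.ι u) = 0 := fun u hu => by rw [hF] at hu; exact hu.2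
  have h5 := sub_inner_smul_mem (dir_mono h.subset) (finrank_dir_facet hP h) h2 h1 h3
    (sub_mem_dir hz (h.subset hy))
  rw [← h0, zero_smul, sub_zero] at h5
  have h6 := apply_eq_zero_of_subset_zeroSet hτ0 h5
  rw [map_sub, hτ0 y hy, sub_zero] at h6
  apply hzτ
  rw [hF]
  exact ⟨hz, h6⟩

theorem exists_isUnitNormal {σ τ : Set X} (h : P.IsFacet σ τ) : ∃ v, E.IsUnitNormal σ τ v := by
  have hfin := finrank_dir_facet hP h
  obtain ⟨l, hl, hF⟩ := exists_exposing hP h.cell h.facet h.subset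
  have hτ0 : ∀ u ∈ τ, l (E.ι u) = 0 := fun u hu => by rw [hF] at hu; exact hu.2
  obtain ⟨z, hz, hzτ⟩ := h.exists_notMem
  obtain ⟨y, hy⟩ := (P.isPolyhedron τ h.facet).nonempty
  have hlz : 0 < l (E.ι z) := lt_of_le_of_ne (hl z hz) fun h0 => hzτ (by rw [hF]; exact ⟨hz, h0.symm⟩)
  have hmem : E.ι z - E.ι y ∉ E.dir τ := fun hm => by
    have := apply_eq_zero_of_subset_zeroSet hτ0 hm
    rw [map_sub, hτ0 y hy, sub_zero] at this
    exact hlz.ne' this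
  obtain ⟨v, hv, hv1, hvτ⟩ := exists_unit_orthogonal (dir_mono (E := E) h.subset)
    (sub_mem_dir hz (h.subset hy)) hmem
  -- On the direction of `σ` the exposing function is a multiple of `⟪v, ·⟫`, so the sign of `l v`
  -- decides between `v` and `-v`.
  have hlv : ∀ w ∈ E.dir σ, l w = ⟪v, w⟫_ℝ * l v := fun w hw => by
    have h1 := apply_eq_zero_of_subset_zeroSet hτ0
      (sub_inner_smul_mem (dir_mono h.subset) hfin hv hv1 hvτ hw)
    rw [map_sub, map_smul, smul_eq_mul] at h1
    linarith
  have hlv0 : l v ≠ 0 := fun h0 => by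
    have := hlv _ (sub_mem_dir hz (h.subset hy))
    rw [h0, mul_zero, map_sub, hτ0 y hy, sub_zero] at this
    exact hlz.ne' this
  have hpos : ∀ a ∈ σ, ∀ b ∈ τ, 0 ≤ ⟪v, E.ι a - E.ι b⟫_ℝ * l v := fun a ha b hb => by
    rw [← hlv _ (sub_mem_dir ha (h.subset hb)), map_sub, hτ0 b hb, sub_zero]
    exact hl a ha
  rcases lt_or_gt_of_ne hlv0 with hneg | hpos'
  · refine ⟨-v, isUnitNormal_iff.2 ⟨by rwa [norm_neg], neg_mem hv, fun w hw => ?_, fun a ha b hb => ?_⟩⟩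
    · rw [inner_neg_right, hvτ w hw, neg_zero]
    · rw [inner_neg_left]
      have := hpos a ha b hb
      nlinarith
  · exact ⟨v, isUnitNormal_iff.2 ⟨hv1, hv, hvτ, fun a ha b hb =>
      nonneg_of_mul_nonneg_left (hpos a ha b hb) hpos'⟩⟩

theorem isUnitNormal_unitNormal {σ τ : Set X} (h : P.IsFacet σ τ) :
    E.IsUnitNormal σ τ (E.unitNormal σ τ) := by
  rw [unitNormal, dif_pos (exists_isUnitNormal hP h)]
  exact (exists_isUnitNormal hP h).choose_spec

theorem isUnitNormal_unique {σ τ : Set X} (h : P.IsFacet σ τ) {v v' : N}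
    (hv : E.IsUnitNormal σ τ v) (hv' : E.IsUnitNormal σ τ v') : v = v' := by
  obtain ⟨z, hz, hzτ⟩ := h.exists_notMem
  obtain ⟨y, hy⟩ := (P.isPolyhedron τ h.facet).nonempty
  have p1 := inner_pos_of_isUnitNormal hP h hv hz hzτ hy
  have p2 := inner_pos_of_isUnitNormal hP h hv' hz hzτ hy
  obtain ⟨h1, h2, h3, h4⟩ := isUnitNormal_iff.1 hv
  obtain ⟨h1', h2', h3', h4'⟩ := isUnitNormal_iff.1 hv'
  have h5 := eq_inner_smul (dir_mono h.subset) (finrank_dir_facet hP h) h2 h1 h3 h2' h3'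
  set a := ⟪v, v'⟫_ℝ
  rw [h5, inner_smul_left] at p2
  have ha : 0 < a := by simpa using (pos_iff_pos_of_mul_pos p2).2 p1
  have h6 : ‖v'‖ = |a| * ‖v‖ := by
    conv_lhs => rw [h5]
    rw [norm_smul, Real.norm_eq_abs]
  rw [h1, h1', abs_of_pos ha, mul_one] at h6
  rw [h5, ← h6, one_smul]

theorem unitNormal_eq {σ τ : Set X} (h : P.IsFacet σ τ) {v : N} (hv : E.IsUnitNormal σ τ v) :
    E.unitNormal σ τ = v :=
  isUnitNormal_unique hP h (isUnitNormal_unitNormal hP h) hv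

/-- Moving from the relative interior of a facet in the normal direction, one enters the relative
interior of the polyhedron. -/
theorem exists_germ {σ τ : Set X} (h : P.IsFacet σ τ) {x : X} (hx : x ∈ E.relint τ) :
    ∃ ε > 0, ∀ t : ℝ, 0 < t → t ≤ ε →
      ∃ z ∈ E.relint σ, E.ι z = E.ι x + t • E.unitNormal σ τ := by
  have hv := isUnitNormal_unitNormal hP h
  obtain ⟨h1, h2, h3, h4⟩ := isUnitNormal_iff.1 hv
  set v := E.unitNormal σ τ
  have hpσ := isPoly_of_mem hP h.cell
  obtain ⟨z, hz, hzτ⟩ := h.exists_notMem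
  obtain ⟨q, hq⟩ := hpσ.relint_nonempty (P.isPolyhedron σ h.cell).nonempty
  have hqτ : q ∉ τ := fun hqτ => hzτ (subset_of_mem_relint hP h.facet h.cell hq hqτ hz)
  have hs := inner_pos_of_isUnitNormal hP h hv hq.1 hqτ hx.1
  have hd := sub_inner_smul_mem (dir_mono h.subset) (finrank_dir_facet hP h) h2 h1 h3
    (sub_mem_dir hq.1 (h.subset hx.1))
  set s := ⟪v, E.ι q - E.ι x⟫_ℝ with hs_def
  obtain ⟨ε, hε, H⟩ := (isPoly_of_mem hP h.facet).exists_extend hx (neg_mem hd)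
  -- The point `ι x + t • v` is a convex combination of `ι q`, with coefficient `a = t / s`, and of
  -- `ι x'`, where `x' ∈ τ` compensates the component of `ι q - ι x` parallel to `τ`. The bounds on
  -- `a` give `a / (1 - a) ≤ 2 * a ≤ ε`.
  refine ⟨s * min (1 / 2) (ε / 2), by positivity, fun t ht hte => ?_⟩
  set a := t / s with ha
  have hta : t = a * s := by rw [ha]; field_simp
  have ha0 : 0 < a := by positivity
  have ha1 : a ≤ min (1 / 2) (ε / 2) := by
    rw [ha, div_le_iff₀ hs, mul_comm]; exact hte
  have ha2 : a ≤ 1 / 2 := ha1.trans (min_le_left _ _)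
  have ha3 : a ≤ ε / 2 := ha1.trans (min_le_right _ _)
  have ha4 : 0 < 1 - a := by linarith
  obtain ⟨x', hx', hx''⟩ := H (a / (1 - a)) (by positivity) (by
    rw [div_le_iff₀ ha4]
    nlinarith)
  obtain ⟨w, hw, hw'⟩ := hpσ.exists_combo hq.1 (h.subset hx') (t := 1 - a) ha4.le (by linarith)
  refine ⟨w, mem_relint_of_combo hq (h.subset hx') hw ha4.le (by linarith) hw', ?_⟩
  rw [hw', hx'', hta]
  have : (1 - a) * (a / (1 - a)) = a := by field_simp
  have e : (1 - a) • (E.ι x + (a / (1 - a)) • -(E.ι q - E.ι x - s • v) - E.ι q) =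
      (1 - a) • (E.ι x - E.ι q) + ((1 - a) * (a / (1 - a))) • -(E.ι q - E.ι x - s • v) := by
    module
  rw [e, this]
  module

/-- Points of the segment from a relative interior point `q` to `x`, other than `x`, stay in the
relative interior and come arbitrarily close to `x`. -/
theorem exists_mem_relint_inter {σ : Set X} (hσ : σ ∈ P.cells) {x : X} (hx : x ∈ σ) {O : Set X}
    (hO : O ∈ nhds x) : ∃ z ∈ E.relint σ, z ∈ O := by
  have hpσ := isPoly_of_mem hP hσ
  obtain ⟨q, hq⟩ := hpσ.relint_nonempty (P.isPolyhedron σ hσ).nonempty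
  obtain ⟨δ, hδ, H⟩ := exists_forall_norm_lt_mem hP hσ hx hO
  set r := ‖E.ι q - E.ι x‖
  have hr : 0 ≤ r := norm_nonneg _
  set a := min (1 / 2) (δ / (2 * (r + 1)))
  have ha0 : 0 < a := by positivity
  have ha1 : a ≤ 1 / 2 := min_le_left _ _
  have ha2 : a * (2 * (r + 1)) ≤ δ := by
    rw [← le_div_iff₀ (by positivity)]; exact min_le_right _ _
  obtain ⟨w, hw, hw'⟩ := hpσ.exists_combo hq.1 hx (t := 1 - a) (by linarith) (by linarith)
  refine ⟨w, mem_relint_of_combo hq hx hw (by linarith) (by linarith) hw', H w hw ?_⟩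
  have : E.ι w - E.ι x = a • (E.ι q - E.ι x) := by rw [hw']; module
  rw [this, norm_smul, Real.norm_of_nonneg ha0.le]
  change a * r < δ
  nlinarith

/-- Points of `σ` close to `x` on a line through `x` lie in a given neighbourhood of `x`. -/
theorem exists_forall_smul_mem {σ : Set X} (hσ : σ ∈ P.cells) {x : X} (hx : x ∈ σ) {O : Set X}
    (hO : O ∈ nhds x) (w : N) :
    ∃ δ > 0, ∀ t : ℝ, 0 ≤ t → t ≤ δ → ∀ z ∈ σ, E.ι z = E.ι x + t • w → z ∈ O := by
  obtain ⟨δ, hδ, H⟩ := exists_forall_norm_lt_mem hP hσ hx hO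
  have hr : 0 ≤ ‖w‖ := norm_nonneg _
  refine ⟨δ / (2 * (‖w‖ + 1)), by positivity, fun t ht hte z hz hzx => H z hz ?_⟩
  rw [hzx, add_sub_cancel_left, norm_smul, Real.norm_of_nonneg ht]
  rw [le_div_iff₀ (by positivity)] at hte
  nlinarith

/-- From a relative interior point of `τ` in `V` one can move a little in any direction of `τ`
without leaving `τ ∩ V`. Hence the choice made in `linearPart` is immaterial on directions. -/
theorem apply_eq_of_eqOn {τ V : Set X} (hV : IsOpen V) (hτ : τ ∈ P.restrict V)
    {l₁ l₂ : N →ₗ[ℝ] ℝ} (hl : ∀ x ∈ τ ∩ V, l₁ (E.ι x) = l₂ (E.ι x)) {w : N} (hw : w ∈ E.dir τ) :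
    l₁ w = l₂ w := by
  obtain ⟨hτ, x, hx, hxV⟩ := hτ
  obtain ⟨z, hz, hzV⟩ := exists_mem_relint_inter hP hτ hx (hV.mem_nhds hxV)
  obtain ⟨ε, hε, H⟩ := (isPoly_of_mem hP hτ).exists_extend hz hw
  obtain ⟨δ, hδ, K⟩ := exists_forall_smul_mem hP hτ hz.1 (hV.mem_nhds hzV) w
  have ht : 0 < min ε δ := by positivity
  obtain ⟨u, hu, hu'⟩ := H (min ε δ) ht.le (min_le_left _ _)
  have h1 := hl u ⟨hu, K _ ht.le (min_le_right _ _) u hu hu'⟩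
  have h2 := hl z ⟨hz.1, hzV⟩
  rw [hu'] at h1
  simp only [map_add, map_smul, smul_eq_mul, h2, add_right_inj] at h1
  exact mul_left_cancel₀ ht.ne' h1

omit [FiniteDimensional ℝ N] in
theorem linearPart_spec {V : Set X} {f : X → ℝ} (hf : P.DefinedOn V f) {σ : Set X}
    (hσ : σ ∈ P.restrict V) {x : X} (hx : x ∈ σ) (hxV : x ∈ V) :
    f x = E.linearPart V f σ (E.ι x) := by
  have hex : ∃ l : N →ₗ[ℝ] ℝ, ∀ x ∈ σ ∩ V, f x = l (E.ι x) := by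
    obtain ⟨m, hm, h⟩ := hf σ hσ
    obtain ⟨l, rfl⟩ := (funs_eq hP hσ.1).le hm
    exact ⟨l, fun x hx => h x hx.1 hx.2⟩
  rw [linearPart, dif_pos hex]
  exact hex.choose_spec x ⟨hx, hxV⟩

theorem linearPart_eq_of_subset {V : Set X} (hV : IsOpen V) {f : X → ℝ} (hf : P.DefinedOn V f)
    {σ τ : Set X} (hσ : σ ∈ P.cells) (hτ : τ ∈ P.restrict V) (h : τ ⊆ σ) {w : N}
    (hw : w ∈ E.dir τ) : E.linearPart V f σ w = E.linearPart V f τ w := by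
  refine apply_eq_of_eqOn hP hV hτ (fun x hx => ?_) hw
  rw [← linearPart_spec hP hf hτ hx.1 hx.2, ← linearPart_spec hP hf
    ⟨hσ, hτ.2.mono (Set.inter_subset_inter_left _ h)⟩ (h hx.1) hx.2]

end FiniteDimensional

end EuclideanPolyhedralSpace

/-! ### Faces of codimension two and balancing of products. -/

theorem finrank_inf_ker_add_one {V : Type*} [AddCommGroup V] [Module ℝ V] [FiniteDimensional ℝ V]
    {S : Submodule ℝ V} {l : V →ₗ[ℝ] ℝ} {e : V} (he : e ∈ S) (hle : l e ≠ 0) :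
    Module.finrank ℝ (S ⊓ LinearMap.ker l : Submodule ℝ V) + 1 = Module.finrank ℝ S := by
  have he0 : e ≠ 0 := fun h => hle (by simp [h])
  have hinf : (S ⊓ LinearMap.ker l) ⊓ Submodule.span ℝ {e} = ⊥ := by
    rw [eq_bot_iff]
    rintro w ⟨⟨-, hw⟩, hw'⟩
    obtain ⟨a, rfl⟩ := Submodule.mem_span_singleton.1 hw'
    have : a = 0 := by simpa [hle] using hw
    simp [this]
  have hsup : (S ⊓ LinearMap.ker l) ⊔ Submodule.span ℝ {e} = S := by
    apply le_antisymm
    · exact sup_le inf_le_left ((Submodule.span_singleton_le_iff_mem _ _).2 he)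
    · intro w hw
      have : w = (w - (l w / l e) • e) + (l w / l e) • e := by abel
      rw [this]
      refine Submodule.add_mem_sup ⟨S.sub_mem hw (S.smul_mem _ he), ?_⟩
        (Submodule.smul_mem _ _ (Submodule.mem_span_singleton_self _))
      simp [hle]
  have h1 := Submodule.finrank_sup_add_finrank_inf_eq (S ⊓ LinearMap.ker l) (Submodule.span ℝ {e})
  rw [hinf, hsup, finrank_bot, finrank_span_singleton he0] at h1
  omega

theorem exists_smul_add_mem {V : Type*} [AddCommGroup V] [Module ℝ V] [FiniteDimensional ℝ V]
    {S T : Submodule ℝ V} (hle : T ≤ S) (hfin : Module.finrank ℝ S = Module.finrank ℝ T + 1)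
    {k : V} (hk : k ∈ S) (hkT : k ∉ T) {w : V} (hw : w ∈ S) : ∃ b : ℝ, w - b • k ∈ T := by
  have h1 : T < T ⊔ Submodule.span ℝ {k} :=
    lt_of_le_of_ne le_sup_left fun h => hkT (by
      rw [h]; exact Submodule.mem_sup_right (Submodule.mem_span_singleton_self _))
  have h2 := Submodule.finrank_lt_finrank_of_lt h1
  have h3 : T ⊔ Submodule.span ℝ {k} = S :=
    Submodule.eq_of_le_of_finrank_le
      (sup_le hle ((Submodule.span_singleton_le_iff_mem _ _).2 hk)) (by omega)
  rw [← h3, Submodule.mem_sup] at hw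
  obtain ⟨t, ht, u, hu, rfl⟩ := hw
  obtain ⟨a, rfl⟩ := Submodule.mem_span_singleton.1 hu
  exact ⟨a, by simpa using ht⟩

namespace PolyhedralStructure

variable (P : PolyhedralStructure X)

/-- The finite set of polyhedra containing a point. -/
def cellsAt (x : X) : Finset (Set X) := (P.finite_cells_at x).toFinset

variable {P}

@[simp] theorem mem_cellsAt {x : X} {σ : Set X} : σ ∈ P.cellsAt x ↔ σ ∈ P.cells ∧ x ∈ σ := by
  simp [cellsAt]

open Classical in
theorem finsum_cofacets {M : Type*} [AddCommMonoid M] {U τ : Set X} (hτ : τ ∈ P.restrict U)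
    {x : X} (hx : x ∈ τ) (F : Set X → M) :
    ∑ᶠ (σ : Set X) (_ : σ ∈ P.cofacets U τ), F σ =
      ∑ σ ∈ (P.cellsAt x).filter (fun σ => P.IsFacet σ τ), F σ := by
  rw [finsum_mem_eq_finite_toFinset_sum _ (P.finite_cofacets U hτ.1)]
  refine Finset.sum_congr ?_ fun _ _ => rfl
  ext σ
  simp only [Set.Finite.mem_toFinset, mem_cofacets_iff hτ, Finset.mem_filter, mem_cellsAt]
  exact ⟨fun h => ⟨⟨h.cell, h.subset hx⟩, h⟩, fun h => h.2⟩

end PolyhedralStructure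

namespace EuclideanPolyhedralSpace

variable {E : EuclideanPolyhedralSpace X N}

variable [FiniteDimensional ℝ N] {P : PolyhedralStructure X} (hP : IsCompatible P E.ι)

include hP

/-- Let `ρ` be a face of codimension two of `σ`, exposed by `l`. Turning from a vector `e` pointing
inside `σ` into the direction `k` one meets an intermediate facet. -/
theorem exists_facet_between {σ ρ : Set X} (hσ : σ ∈ P.cells) (hρ : ρ ∈ P.cells) (hsub : ρ ⊆ σ)
    (hd : P.dim σ = P.dim ρ + 2) {x q : X} (hx : x ∈ E.relint ρ) (hq : q ∈ E.relint σ)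
    {l : N →ₗ[ℝ] ℝ} (hF : ρ = {x | x ∈ σ ∧ l (E.ι x) = 0})
    (hlq : 0 < l (E.ι q)) {k : N} (hk : k ∈ E.dir σ) (hlk : l k = 0) (hkρ : k ∉ E.dir ρ) :
    ∃ (t : ℝ) (τ : Set X) (g : N →ₗ[ℝ] ℝ) (s : ℝ) (z : X), 0 < t ∧ 0 < s ∧
      P.IsFacet σ τ ∧ P.IsFacet τ ρ ∧ z ∈ τ ∧ z ∉ ρ ∧
      E.ι z = E.ι x + s • (E.ι q - E.ι x + t • k) ∧
      (∀ u ∈ σ, 0 ≤ g (E.ι u)) ∧ τ = {u | u ∈ σ ∧ g (E.ι u) = 0} ∧ (∀ u ∈ ρ, g (E.ι u) = 0) ∧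
      g k < 0 ∧ g (E.ι q - E.ι x + t • k) = 0 := by
  classical
  obtain ⟨A, hA, hA'⟩ := isPoly_of_mem hP hσ
  have hxσ := hsub hx.1
  have hlx : l (E.ι x) = 0 := by
    have := hx.1
    rw [hF] at this
    exact this.2
  set C := A.filter fun a => a (E.ι x) = 0 ∧ a k < 0 with hC
  -- If no inequality tight at `x` decreased along `k`, one could move from `x` along `k` inside
  -- `σ`. As `l k = 0` this motion stays in `ρ`, contradicting `k ∉ E.dir ρ`.
  have hCne : C.Nonempty := by
    by_contra hemp
    rw [Finset.not_nonempty_iff_eq_empty] at hemp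
    obtain ⟨ε, hε, H⟩ := exists_pos_forall_nonneg A (fun a => a (E.ι x)) (fun a => a k)
      fun a ha => by
        by_cases h0 : a (E.ι x) = 0
        · right
          refine ⟨h0.ge, ?_⟩
          by_contra hneg
          have : a ∈ C := Finset.mem_filter.2 ⟨ha, h0, not_le.1 hneg⟩
          rw [hemp] at this
          exact Finset.notMem_empty _ this
        · left
          exact lt_of_le_of_ne (hA a ha x hxσ) (Ne.symm h0)
    obtain ⟨z, hz, hz'⟩ := hA' x hxσ _ (Submodule.smul_mem _ ε hk) fun a ha => by
      simpa using H ε hε.le le_rfl a ha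
    have hzρ : z ∈ ρ := by
      rw [hF]
      exact ⟨hz, by simp [hz', hlx, hlk]⟩
    have h1 : E.ι z - E.ι x ∈ E.dir ρ := sub_mem_dir hzρ hx.1
    rw [hz', add_sub_cancel_left] at h1
    exact hkρ ((Submodule.smul_mem_iff _ hε.ne').1 h1)
  -- The minimal ratio is the first time at which the ray from `ι q - ι x` in direction `k` reaches
  -- the boundary of the tangent cone of `σ` at `x`; `g` is the inequality that becomes tight there.
  obtain ⟨g, hg, hmin⟩ := C.exists_min_image (fun a => a (E.ι q) / (-a k)) hCne
  obtain ⟨hgA, hgx, hgk⟩ := Finset.mem_filter.1 hg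
  have hgpos : 0 < g (E.ι q) := by
    refine lt_of_le_of_ne (hA g hgA q hq.1) fun h0 => hgk.ne ?_
    exact apply_eq_zero_of_subset_zeroSet (hq.2 g (hA g hgA) h0.symm) hk
  set t := g (E.ι q) / (-g k) with ht
  have htpos : 0 < t := div_pos hgpos (by linarith)
  have hgt : g (E.ι q - E.ι x + t • k) = 0 := by
    simp only [map_add, map_sub, map_smul, hgx, smul_eq_mul]
    have hk0 : g k ≠ 0 := hgk.ne
    rw [ht]
    field_simp
    ring
  have hdirσ : E.ι q - E.ι x + t • k ∈ E.dir σ :=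
    add_mem (sub_mem_dir hq.1 hxσ) (Submodule.smul_mem _ _ hk)
  obtain ⟨s, hs, H⟩ := exists_pos_forall_nonneg A (fun a => a (E.ι x))
    (fun a => a (E.ι q - E.ι x + t • k)) fun a ha => by
      by_cases h0 : a (E.ι x) = 0
      · right
        refine ⟨h0.ge, ?_⟩
        have haq := hA a ha q hq.1
        simp only [map_add, map_sub, map_smul, h0, smul_eq_mul, sub_zero]
        rcases le_or_gt 0 (a k) with hak | hak
        · positivity
        · have h1 : t ≤ a (E.ι q) / (-a k) := hmin a (Finset.mem_filter.2 ⟨ha, h0, hak⟩)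
          rw [le_div_iff₀ (by linarith)] at h1
          linarith
      · left
        exact lt_of_le_of_ne (hA a ha x hxσ) (Ne.symm h0)
  obtain ⟨z, hz, hz'⟩ := hA' x hxσ _ (Submodule.smul_mem _ s hdirσ) fun a ha => by
    have h1 := H s hs.le le_rfl a ha
    rwa [← smul_eq_mul, ← map_smul, ← map_add] at h1
  have hτ := zeroSet_mem hP hσ (hA g hgA) hxσ hgx
  set τ : Set X := {u | u ∈ σ ∧ g (E.ι u) = 0} with hτdef
  have hτσ : τ ⊆ σ := fun u hu => hu.1
  have hgρ : ∀ u ∈ ρ, g (E.ι u) = 0 := hx.2 g (fun u hu => hA g hgA u (hsub hu)) hgx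
  have hρτ : ρ ⊆ τ := fun u hu => ⟨hsub hu, hgρ u hu⟩
  have hzτ : z ∈ τ := ⟨hz, by rw [hz', map_add, map_smul, hgt, hgx]; simp⟩
  have hzρ : z ∉ ρ := fun h => by
    rw [hF] at h
    have h2 := h.2
    rw [hz'] at h2
    simp only [map_add, map_sub, map_smul, hlx, hlk, smul_eq_mul] at h2
    have : 0 < s * l (E.ι q) := mul_pos hs hlq
    linarith
  have hqτ : q ∉ τ := fun h => hgpos.ne' h.2
  -- Two strict inclusions across a dimension gap of two make both steps facets.
  have d1 := dim_lt_of_notMem hP hτ hρ hρτ hzτ hzρ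
  have d2 := dim_lt_of_notMem hP hσ hτ hτσ hq.1 hqτ
  exact ⟨t, τ, g, s, z, htpos, hs, ⟨hσ, hτ, hτσ, by omega⟩, ⟨hτ, hρ, hρτ, by omega⟩, hzτ, hzρ, hz',
    hA g hgA, rfl, hgρ, hgk, hgt⟩

/-- A face of codimension two lies in exactly two facets. -/
theorem exists_two_facets {σ ρ : Set X} (hσ : σ ∈ P.cells) (hρ : ρ ∈ P.cells) (hsub : ρ ⊆ σ)
    (hd : P.dim σ = P.dim ρ + 2) :
    ∃ τ₁ τ₂, τ₁ ≠ τ₂ ∧ ∀ τ, P.IsFacet σ τ ∧ P.IsFacet τ ρ ↔ τ = τ₁ ∨ τ = τ₂ := by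
  obtain ⟨x, hx⟩ := (isPoly_of_mem hP hρ).relint_nonempty (P.isPolyhedron ρ hρ).nonempty
  obtain ⟨q, hq⟩ := (isPoly_of_mem hP hσ).relint_nonempty (P.isPolyhedron σ hσ).nonempty
  obtain ⟨l, hl, hF⟩ := exists_exposing hP hσ hρ hsub
  have hlρ : ∀ u ∈ ρ, l (E.ι u) = 0 := fun u hu => by rw [hF] at hu; exact hu.2
  have hxσ := hsub hx.1
  have hlq : 0 < l (E.ι q) := by
    refine lt_of_le_of_ne (hl q hq.1) fun h0 => ?_
    have hqρ : q ∈ ρ := by rw [hF]; exact ⟨hq.1, h0.symm⟩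
    have := dim_le_of_subset hP hρ hσ (subset_of_mem_relint hP hρ hσ hq hqρ)
    omega
  have hedir : E.ι q - E.ι x ∈ E.dir σ := sub_mem_dir hq.1 hxσ
  have hle : l (E.ι q - E.ι x) = l (E.ι q) := by rw [map_sub, hlρ x hx.1, sub_zero]
  have hfin := finrank_inf_ker_add_one hedir (l := l) (by rw [hle]; exact hlq.ne')
  have hle' : E.dir ρ ≤ E.dir σ ⊓ LinearMap.ker l := fun w hw =>
    ⟨dir_mono hsub hw, apply_eq_zero_of_subset_zeroSet hlρ hw⟩
  rw [dim_eq hP hσ, dim_eq hP hρ] at hd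
  -- Modulo the direction of `ρ`, the direction of `σ` is a plane with basis `ι q - ι x` and `k`.
  -- Turning towards `k` and towards `-k` produces the two facets.
  obtain ⟨k, ⟨hk, hlk⟩, hkρ⟩ : ∃ k ∈ E.dir σ ⊓ LinearMap.ker l, k ∉ E.dir ρ := by
    by_contra! h
    have := Submodule.finrank_mono (show E.dir σ ⊓ LinearMap.ker l ≤ E.dir ρ from h)
    omega
  have hlk' : l k = 0 := hlk
  rw [← dim_eq hP hσ, ← dim_eq hP hρ] at hd
  obtain ⟨t₁, τ₁, g₁, s₁, z₁, ht₁, hs₁, f₁, f₁', hz₁, hz₁ρ, hz₁', hg₁, hτ₁, hg₁ρ, hg₁k, hg₁t⟩ :=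
    exists_facet_between hP hσ hρ hsub hd hx hq hF hlq hk hlk' hkρ
  obtain ⟨t₂, τ₂, g₂, s₂, z₂, ht₂, hs₂, f₂, f₂', hz₂, hz₂ρ, hz₂', hg₂, hτ₂, hg₂ρ, hg₂k, hg₂t⟩ :=
    exists_facet_between hP hσ hρ hsub hd hx hq hF hlq (neg_mem hk) (by simp [hlk'])
      (by simpa using hkρ)
  rw [map_neg] at hg₂k
  have key : ∀ {τ τ' : Set X} {z : X}, P.IsFacet τ ρ → P.IsFacet τ' ρ → z ∈ τ → z ∈ τ' → z ∉ ρ →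
      τ = τ' := by
    intro τ τ' z h h' hz hz' hzρ
    have hmem := P.inter_mem h.cell h'.cell ⟨z, hz, hz'⟩
    have d := dim_lt_of_notMem hP hmem hρ (Set.subset_inter h.subset h'.subset) ⟨hz, hz'⟩ hzρ
    have d1 := h.dim_eq
    have d2 := h'.dim_eq
    rw [← eq_of_dim_le hP h.cell hmem Set.inter_subset_left (by omega)]
    exact eq_of_dim_le hP h'.cell hmem Set.inter_subset_right (by omega)
  refine ⟨τ₁, τ₂, ?_, fun τ => ⟨?_, ?_⟩⟩
  · rintro rfl
    have h1 : g₂ (E.ι z₁) = 0 := by rw [hτ₂] at hz₁; exact hz₁.2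
    rw [hz₁', map_add, hg₂ρ x hx.1, map_smul, smul_eq_mul, zero_add] at h1
    have h2 := (mul_eq_zero.1 h1).resolve_left hs₁.ne'
    simp only [map_add, map_sub, map_smul, map_neg, smul_eq_mul] at h2 hg₂t
    nlinarith
  · rintro ⟨f, f'⟩
    by_contra! hne
    obtain ⟨l', hl', hτ⟩ := exists_exposing hP f.cell f.facet f.subset
    have hl'ρ : ∀ u ∈ ρ, l' (E.ι u) = 0 := fun u hu => by
      have := f'.subset hu
      rw [hτ] at this
      exact this.2
    have p₁ : 0 < l' (E.ι z₁) := by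
      refine lt_of_le_of_ne (hl' z₁ (f₁.subset hz₁)) fun h0 => hne.1 (key f' f₁' (z := z₁) ?_ hz₁ hz₁ρ)
      rw [hτ]; exact ⟨f₁.subset hz₁, h0.symm⟩
    have p₂ : 0 < l' (E.ι z₂) := by
      refine lt_of_le_of_ne (hl' z₂ (f₂.subset hz₂)) fun h0 => hne.2 (key f' f₂' (z := z₂) ?_ hz₂ hz₂ρ)
      rw [hτ]; exact ⟨f₂.subset hz₂, h0.symm⟩
    rw [hz₁', map_add, hl'ρ x hx.1, map_smul, smul_eq_mul, zero_add] at p₁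
    rw [hz₂', map_add, hl'ρ x hx.1, map_smul, smul_eq_mul, zero_add] at p₂
    replace p₁ := (pos_iff_pos_of_mul_pos p₁).1 hs₁
    replace p₂ := (pos_iff_pos_of_mul_pos p₂).1 hs₂
    obtain ⟨u, hu, huρ⟩ := f'.exists_notMem
    have huσ := f.subset hu
    have hlu : 0 < l (E.ι u) := lt_of_le_of_ne (hl u huσ) fun h0 => huρ (by
      rw [hF]; exact ⟨huσ, h0.symm⟩)
    have hl'u : l' (E.ι u) = 0 := by rw [hτ] at hu; exact hu.2
    set e := E.ι q - E.ι x with he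
    set α := l (E.ι u) / l (E.ι q) with hα
    have hαpos : 0 < α := div_pos hlu hlq
    obtain ⟨b, hb⟩ := exists_smul_add_mem hle' (by rw [dim_eq hP hσ, dim_eq hP hρ] at hd; omega)
      ⟨hk, hlk⟩ hkρ (w := E.ι u - E.ι x - α • e)
      ⟨sub_mem (sub_mem_dir huσ hxσ) (Submodule.smul_mem _ _ hedir), by
        change l _ = 0
        rw [map_sub, map_smul, hle, map_sub, hlρ x hx.1, hα, smul_eq_mul]
        field_simp
        ring⟩
    -- Modulo the direction of `ρ`, a point `u` of a third facet is `α • e + b • k` with `α > 0`.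
    -- The inequalities `g₁` and `g₂` confine `b` to `[-(α * t₂), α * t₁]`. The function `l'`
    -- exposing that facet is positive at both ends, hence at `u`, which is absurd.
    have expand : ∀ g : N →ₗ[ℝ] ℝ, (∀ v ∈ ρ, g (E.ι v) = 0) →
        g (E.ι u) = α * g e + b * g k := fun g hg => by
      have h1 := apply_eq_zero_of_subset_zeroSet hg hb
      simp only [map_sub, map_smul, smul_eq_mul, hg x hx.1] at h1
      linarith
    have e₁ := hg₁ u huσ
    have e₂ := hg₂ u huσ
    have e₃ := expand l' hl'ρ
    rw [expand g₁ hg₁ρ] at e₁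
    rw [expand g₂ hg₂ρ] at e₂
    rw [hl'u] at e₃
    simp only [map_add, map_smul, map_neg, smul_eq_mul] at hg₁t hg₂t p₁ p₂
    have b₁ : b ≤ α * t₁ := by
      have : 0 ≤ (b - α * t₁) * g₁ k := by
        have h1 : g₁ e = -(t₁ * g₁ k) := by linarith
        rw [h1] at e₁
        linarith
      nlinarith
    have b₂ : -(α * t₂) ≤ b := by
      have : 0 ≤ (b + α * t₂) * g₂ k := by
        have h1 : g₂ e = t₂ * g₂ k := by linarith
        rw [h1] at e₂
        linarith
      nlinarith
    have p₁' := mul_pos hαpos p₁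
    have p₂' := mul_pos hαpos p₂
    rcases le_or_gt 0 (l' k) with h0 | h0
    · nlinarith
    · nlinarith
  · rintro (rfl | rfl)
    · exact ⟨f₁, f₁'⟩
    · exact ⟨f₂, f₂'⟩

/-- Normals across two facets sharing a face of codimension two. -/
theorem unitNormal_eq_add {σ τ₁ τ₂ ρ : Set X} (f₁ : P.IsFacet σ τ₁) (f₁' : P.IsFacet τ₁ ρ)
    (f₂ : P.IsFacet σ τ₂) (f₂' : P.IsFacet τ₂ ρ) (hne : τ₁ ≠ τ₂) :
    ∃ s > 0, s ^ 2 + ⟪E.unitNormal τ₁ ρ, E.unitNormal τ₂ ρ⟫_ℝ ^ 2 = 1 ∧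
      E.unitNormal τ₂ ρ = s • E.unitNormal σ τ₁ +
        ⟪E.unitNormal τ₁ ρ, E.unitNormal τ₂ ρ⟫_ℝ • E.unitNormal τ₁ ρ := by
  have hn := isUnitNormal_unitNormal hP f₁
  obtain ⟨n1, n2, n3, -⟩ := isUnitNormal_iff.1 hn
  obtain ⟨u1, u2, u3, -⟩ := isUnitNormal_iff.1 (isUnitNormal_unitNormal hP f₁')
  obtain ⟨w1, w2, w3, -⟩ := isUnitNormal_iff.1 (isUnitNormal_unitNormal hP f₂')
  obtain ⟨x, hx⟩ := (isPoly_of_mem hP f₁'.facet).relint_nonempty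
    (P.isPolyhedron ρ f₁'.facet).nonempty
  obtain ⟨ε, hε, H⟩ := exists_germ hP f₂' hx
  obtain ⟨z, hz, hz'⟩ := H ε hε le_rfl
  have hzτ₁ : z ∉ τ₁ := fun h => by
    have h1 := subset_of_mem_relint hP f₁.facet f₂.facet hz h
    have d1 := f₁'.dim_eq
    have d2 := f₂'.dim_eq
    exact hne (eq_of_dim_le hP f₁.facet f₂.facet h1 (by omega)).symm
  -- The coefficient `s` is `⟪n, w⟫`; it is positive because a short move from `ρ` along `w` enters
  -- `τ₂` off `τ₁`.
  have hpos := inner_pos_of_isUnitNormal hP f₁ hn (f₂.subset hz.1) hzτ₁ (f₁'.subset hx.1)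
  set n := E.unitNormal σ τ₁
  set u := E.unitNormal τ₁ ρ
  set w := E.unitNormal τ₂ ρ
  rw [hz', add_sub_cancel_left, inner_smul_right] at hpos
  have hs := (pos_iff_pos_of_mul_pos hpos).1 hε
  have hun : ⟪u, n⟫_ℝ = 0 := n3 u u2
  have h1 := sub_inner_smul_mem (dir_mono f₁.subset) (finrank_dir_facet hP f₁) n2 n1 n3
    (dir_mono f₂.subset w2)
  have h2 := eq_inner_smul (dir_mono f₁'.subset) (finrank_dir_facet hP f₁') u2 u1 u3 h1
    fun v hv => by
      rw [inner_sub_right, inner_smul_right, w3 v hv, n3 v (dir_mono f₁'.subset hv)]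
      simp
  have h3 : w = ⟪n, w⟫_ℝ • n + ⟪u, w⟫_ℝ • u := by
    rw [inner_sub_right, inner_smul_right, hun, mul_zero, sub_zero] at h2
    rw [← h2]; abel
  refine ⟨⟪n, w⟫_ℝ, hs, ?_, h3⟩
  have h4 : ⟪w, w⟫_ℝ = 1 := by rw [real_inner_self_eq_norm_sq, w1, one_pow]
  have h5 : ⟪w, w⟫_ℝ = ⟪n, w⟫_ℝ ^ 2 + ⟪u, w⟫_ℝ ^ 2 := by
    conv_lhs => rw [h3]
    rw [inner_add_left, inner_smul_left, inner_smul_left]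
    rw [← h3]
    simp [sq]
  rw [← h5, h4]

/-- Write `u₁`, `u₂` for the normals of `τ₁`, `τ₂` along `ρ`, and `c` for their inner product. The
normals of `σ` along `τ₁`, `τ₂`, scaled by the same `s`, are `u₂ - c • u₁` and `u₁ - c • u₂`. After
multiplication by `s` both sides become the same expression in `u₁` and `u₂`. -/
theorem smul_unitNormal_swap {σ τ₁ τ₂ ρ : Set X} (f₁ : P.IsFacet σ τ₁) (f₁' : P.IsFacet τ₁ ρ)
    (f₂ : P.IsFacet σ τ₂) (f₂' : P.IsFacet τ₂ ρ) (hne : τ₁ ≠ τ₂) (g : N →ₗ[ℝ] ℝ) :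
    g (E.unitNormal σ τ₁) • E.unitNormal τ₁ ρ + g (E.unitNormal σ τ₂) • E.unitNormal τ₂ ρ =
      g (E.unitNormal τ₁ ρ) • E.unitNormal σ τ₁ + g (E.unitNormal τ₂ ρ) • E.unitNormal σ τ₂ := by
  obtain ⟨s, hs, hs2, h1⟩ := unitNormal_eq_add hP f₁ f₁' f₂ f₂' hne
  obtain ⟨s', hs', hs2', h2⟩ := unitNormal_eq_add hP f₂ f₂' f₁ f₁' hne.symm
  rw [real_inner_comm] at hs2' h2
  set c := ⟪E.unitNormal τ₁ ρ, E.unitNormal τ₂ ρ⟫_ℝ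
  have hss : s' = s := by nlinarith
  subst hss
  have e1 : s' • E.unitNormal σ τ₁ = E.unitNormal τ₂ ρ - c • E.unitNormal τ₁ ρ := by
    rw [eq_sub_iff_add_eq]; exact h1.symm
  have e2 : s' • E.unitNormal σ τ₂ = E.unitNormal τ₁ ρ - c • E.unitNormal τ₂ ρ := by
    rw [eq_sub_iff_add_eq]; exact h2.symm
  have g1 := congrArg g e1
  have g2 := congrArg g e2
  rw [map_smul, map_sub, map_smul, smul_eq_mul, smul_eq_mul] at g1 g2
  refine smul_right_injective N hs.ne' ?_
  simp only [smul_add, smul_smul, g1, g2]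
  rw [mul_comm s', mul_comm s', ← smul_smul _ s', ← smul_smul _ s', e1, e2]
  module

/-- The product of a piecewise affine function with a Minkowski weight is a Minkowski weight. -/
theorem isMinkowskiWeight_product {V : Set X} (hV : IsOpen V) {f : X → ℝ} (hf : P.DefinedOn V f)
    {k : ℕ} {c : Set X → ℝ} (hc : E.IsMinkowskiWeight P V (k + 1) c) :
    E.IsMinkowskiWeight P V k (E.product P V f c) := by
  classical
  intro ρ hρ hk
  obtain ⟨x, hx⟩ := (P.isPolyhedron ρ hρ.1).nonempty
  rw [PolyhedralStructure.finsum_cofacets hρ hx]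
  have hres : ∀ {τ}, P.IsFacet τ ρ → τ ∈ P.restrict V := fun h =>
    ⟨h.cell, hρ.2.mono (Set.inter_subset_inter_left _ h.subset)⟩
  have hprod : ∀ τ ∈ (P.cellsAt x).filter (fun σ => P.IsFacet σ ρ),
      E.product P V f c τ • E.unitNormal τ ρ =
        -∑ σ ∈ (P.cellsAt x).filter (fun σ => P.IsFacet σ τ),
          (c σ * E.linearPart V f σ (E.unitNormal σ τ)) • E.unitNormal τ ρ := by
    intro τ hτ
    have h := (Finset.mem_filter.1 hτ).2
    rw [product, PolyhedralStructure.finsum_cofacets (hres h) (h.subset hx), neg_smul,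
      Finset.sum_smul]
  rw [Finset.sum_congr rfl hprod, Finset.sum_neg_distrib, neg_eq_zero]
  -- Sums over flags `ρ ≺ τ ≺ σ`, grouped by `τ` or by `σ`.
  have hcomm : ∀ F : Set X → Set X → N,
      ∑ τ ∈ (P.cellsAt x).filter (fun σ => P.IsFacet σ ρ),
        ∑ σ ∈ (P.cellsAt x).filter (fun σ => P.IsFacet σ τ), F τ σ =
      ∑ σ ∈ (P.cellsAt x).filter (fun σ => ρ ⊆ σ ∧ P.dim σ = P.dim ρ + 2),
        ∑ τ ∈ (P.cellsAt x).filter (fun τ => P.IsFacet σ τ ∧ P.IsFacet τ ρ), F τ σ := by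
    intro F
    refine Finset.sum_comm' fun τ σ => ?_
    simp only [Finset.mem_filter]
    constructor
    · rintro ⟨⟨h1, h2⟩, h3, h4⟩
      have d1 := h2.dim_eq
      have d2 := h4.dim_eq
      exact ⟨⟨h1, h4, h2⟩, h3, h2.subset.trans h4.subset, by omega⟩
    · rintro ⟨⟨h1, h4, h2⟩, h3, -⟩
      exact ⟨⟨h1, h2⟩, h3, h4⟩
  -- For fixed `σ` only two facets contribute, and the planar identity trades slopes of `f` across
  -- `τ` for slopes across `ρ`. Regrouped by `τ`, the inner sums are then the balancing sums of `c`.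
  have hswap : ∀ σ ∈ (P.cellsAt x).filter (fun σ => ρ ⊆ σ ∧ P.dim σ = P.dim ρ + 2),
      ∑ τ ∈ (P.cellsAt x).filter (fun τ => P.IsFacet σ τ ∧ P.IsFacet τ ρ),
        (c σ * E.linearPart V f σ (E.unitNormal σ τ)) • E.unitNormal τ ρ =
      ∑ τ ∈ (P.cellsAt x).filter (fun τ => P.IsFacet σ τ ∧ P.IsFacet τ ρ),
        E.linearPart V f τ (E.unitNormal τ ρ) • c σ • E.unitNormal σ τ := by
    intro σ hσ
    obtain ⟨hσx, hsub, hd⟩ := Finset.mem_filter.1 hσ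
    rw [PolyhedralStructure.mem_cellsAt] at hσx
    obtain ⟨τ₁, τ₂, hne, hiff⟩ := exists_two_facets hP hσx.1 hρ.1 hsub hd
    have hset : (P.cellsAt x).filter (fun τ => P.IsFacet σ τ ∧ P.IsFacet τ ρ) = {τ₁, τ₂} := by
      ext τ
      simp only [Finset.mem_filter, hiff, PolyhedralStructure.mem_cellsAt, Finset.mem_insert,
        Finset.mem_singleton, and_iff_right_iff_imp]
      intro h
      obtain ⟨h1, h2⟩ := (hiff τ).2 h
      exact ⟨h2.cell, h2.subset hx⟩
    obtain ⟨f₁, f₁'⟩ := (hiff τ₁).2 (Or.inl rfl)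
    obtain ⟨f₂, f₂'⟩ := (hiff τ₂).2 (Or.inr rfl)
    rw [hset, Finset.sum_pair hne, Finset.sum_pair hne]
    have hl : ∀ {τ}, P.IsFacet σ τ → P.IsFacet τ ρ → E.linearPart V f τ (E.unitNormal τ ρ) =
        E.linearPart V f σ (E.unitNormal τ ρ) := fun h h' =>
      (linearPart_eq_of_subset hP hV hf hσx.1 (hres h') h.subset
        (isUnitNormal_iff.1 (isUnitNormal_unitNormal hP h')).2.1).symm
    rw [hl f₁ f₁', hl f₂ f₂', smul_comm _ (c σ), smul_comm _ (c σ), ← smul_add,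
      ← smul_unitNormal_swap hP f₁ f₁' f₂ f₂' hne, mul_smul, mul_smul, ← smul_add]
  rw [hcomm, Finset.sum_congr rfl hswap, ← hcomm fun τ σ =>
    E.linearPart V f τ (E.unitNormal τ ρ) • c σ • E.unitNormal σ τ]
  refine Finset.sum_eq_zero fun τ hτ => ?_
  have h := (Finset.mem_filter.1 hτ).2
  rw [← Finset.smul_sum, ← PolyhedralStructure.finsum_cofacets (hres h) (h.subset hx),
    hc τ (hres h) (by rw [h.dim_eq, hk]), smul_zero]

end EuclideanPolyhedralSpace

/-! ### Subdivision by a hyperplane. -/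

namespace EuclideanPolyhedralSpace

variable {E : EuclideanPolyhedralSpace X N}

variable (E) in
/-- The two half-spaces and the hyperplane of `X` defined by a linear function on `N`. -/
def halves (l : N →ₗ[ℝ] ℝ) : Set (Set X) :=
  {{x | 0 ≤ l (E.ι x)}, {x | l (E.ι x) ≤ 0}, {x | l (E.ι x) = 0}}

theorem exists_exposing_halves {l : N →ₗ[ℝ] ℝ} {H H' : Set X} (hH : H ∈ E.halves l)
    (hH' : H' ∈ E.halves l) :
    ∃ e : N →ₗ[ℝ] ℝ, ∀ x ∈ H, 0 ≤ e (E.ι x) ∧ (e (E.ι x) = 0 ↔ x ∈ H') := by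
  rcases hH with rfl | rfl | rfl
  · rcases hH' with rfl | rfl | rfl
    · exact ⟨0, fun x hx => by simpa using hx⟩
    · exact ⟨l, fun x hx => ⟨hx, fun h => h.le, fun h => le_antisymm h hx⟩⟩
    · exact ⟨l, fun x hx => ⟨hx, Iff.rfl⟩⟩
  · rcases hH' with rfl | rfl | rfl
    · refine ⟨-l, fun x (hx : l (E.ι x) ≤ 0) => ⟨by simpa using hx, fun h => ?_, fun h => ?_⟩⟩
      · exact (neg_eq_zero.1 h).ge
      · exact neg_eq_zero.2 (le_antisymm hx h)
    · exact ⟨0, fun x hx => by simpa using hx⟩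
    · exact ⟨-l, fun x (hx : l (E.ι x) ≤ 0) => ⟨by simpa using hx, neg_eq_zero⟩⟩
  · refine ⟨0, fun x (hx : l (E.ι x) = 0) => ?_⟩
    rcases hH' with rfl | rfl | rfl <;> simp [hx]

theorem isPoly_inter_halves {l : N →ₗ[ℝ] ℝ} {σ H : Set X} (hσ : E.IsPoly σ)
    (hH : H ∈ E.halves l) : E.IsPoly (σ ∩ H) := by
  classical
  obtain ⟨A, hA, hA'⟩ := hσ
  have main : ∀ l : N →ₗ[ℝ] ℝ, E.IsPoly (σ ∩ {x | 0 ≤ l (E.ι x)}) := fun l => by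
    refine ⟨insert l A, fun a ha x hx => ?_, fun x hx w hw h => ?_⟩
    · rcases Finset.mem_insert.1 ha with rfl | ha
      · exact hx.2
      · exact hA a ha x hx.1
    · obtain ⟨z, hz, hz'⟩ := hA' x hx.1 w (dir_mono Set.inter_subset_left hw)
        fun a ha => h a (Finset.mem_insert_of_mem ha)
      refine ⟨z, ⟨hz, ?_⟩, hz'⟩
      change 0 ≤ l (E.ι z)
      rw [hz']
      exact h l (Finset.mem_insert_self _ _)
  rcases hH with rfl | rfl | rfl
  · exact main l
  · simpa using main (-l)
  -- No new inequality is needed for the hyperplane: `l` vanishes on the direction of the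
  -- intersection.
  · refine ⟨A, fun a ha x hx => hA a ha x hx.1, fun x hx w hw h => ?_⟩
    obtain ⟨z, hz, hz'⟩ := hA' x hx.1 w (dir_mono Set.inter_subset_left hw) h
    refine ⟨z, ⟨hz, ?_⟩, hz'⟩
    have h1 : l w = 0 := apply_eq_zero_of_subset_zeroSet (τ := σ ∩ {x | l (E.ι x) = 0})
      (fun u hu => hu.2) hw
    change l (E.ι z) = 0
    rw [hz', map_add, h1, add_zero]
    exact hx.2

/-- Farkas' lemma for a single additional inequality on a convex set. -/
theorem exists_multiplier {σ : Set X} (hσ : E.IsPoly σ) {l m : N →ₗ[ℝ] ℝ}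
    (h0 : ∀ x ∈ σ, l (E.ι x) = 0 → 0 ≤ m (E.ι x)) {x₀ : X} (hx₀ : x₀ ∈ σ) (hlx₀ : 0 < l (E.ι x₀)) :
    (∀ x ∈ σ, ∀ z ∈ σ, 0 < l (E.ι x) → l (E.ι z) < 0 →
      m (E.ι z) / l (E.ι z) ≤ m (E.ι x) / l (E.ι x)) ∧
    ∀ c : ℝ, (∀ x ∈ σ, 0 < l (E.ι x) → c ≤ m (E.ι x) / l (E.ι x)) →
      ∃ a, c ≤ a ∧ ∀ x ∈ σ, a * l (E.ι x) ≤ m (E.ι x) := by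
  have cross : ∀ x ∈ σ, ∀ z ∈ σ, 0 < l (E.ι x) → l (E.ι z) < 0 →
      m (E.ι z) / l (E.ι z) ≤ m (E.ι x) / l (E.ι x) := by
    intro x hx z hz hlx hlz
    have hpos : 0 < l (E.ι x) - l (E.ι z) := by linarith
    -- The parameter locates the point of the segment where `l` vanishes; there `m` is nonnegative.
    obtain ⟨w, hw, hw'⟩ := hσ.exists_combo hx hz (t := l (E.ι x) / (l (E.ι x) - l (E.ι z)))
      (by positivity) (by rw [div_le_one hpos]; linarith)
    have h1 := h0 w hw (by
      rw [hw']
      simp only [map_add, map_smul, map_sub, smul_eq_mul]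
      field_simp
      ring)
    rw [hw'] at h1
    simp only [map_add, map_smul, map_sub, smul_eq_mul] at h1
    have h2 : m (E.ι x) + l (E.ι x) / (l (E.ι x) - l (E.ι z)) * (m (E.ι z) - m (E.ι x)) =
        (m (E.ι z) * l (E.ι x) - m (E.ι x) * l (E.ι z)) / (l (E.ι x) - l (E.ι z)) := by
      field_simp
      ring
    rw [h2, le_div_iff₀ hpos, zero_mul] at h1
    rw [div_le_iff_of_neg hlz, div_mul_eq_mul_div, div_le_iff₀ hlx]
    linarith
  refine ⟨cross, fun c hc => ?_⟩
  set S : Set ℝ := {r | ∃ x ∈ σ, 0 < l (E.ι x) ∧ r = m (E.ι x) / l (E.ι x)} with hS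
  have hne : S.Nonempty := ⟨_, x₀, hx₀, hlx₀, rfl⟩
  have hbdd : BddBelow S := ⟨c, by rintro _ ⟨x, hx, hlx, rfl⟩; exact hc x hx hlx⟩
  -- The multiplier is the infimum of `m / l` over the part where `l > 0`; by `cross` it dominates
  -- the ratios where `l < 0`.
  refine ⟨sInf S, le_csInf hne (by rintro _ ⟨x, hx, hlx, rfl⟩; exact hc x hx hlx), fun x hx => ?_⟩
  rcases lt_trichotomy (l (E.ι x)) 0 with h | h | h
  · rw [← div_le_iff_of_neg h]
    refine le_csInf hne ?_
    rintro _ ⟨z, hz, hlz, rfl⟩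
    exact cross z hz x hx hlz h
  · rw [h, mul_zero]
    exact h0 x hx h
  · rw [← le_div_iff₀ h]
    exact csInf_le hbdd ⟨x, hx, h, rfl⟩

/-- A face of a piece of `σ` is a piece of a face of `σ`. -/
theorem exists_face_inter_halves {P : PolyhedralStructure X} (hP : IsCompatible P E.ι)
    {l : N →ₗ[ℝ] ℝ} {σ H : Set X} (hσ : σ ∈ P.cells) (hH : H ∈ E.halves l) {m : N →ₗ[ℝ] ℝ}
    (hm : ∀ x ∈ σ ∩ H, 0 ≤ m (E.ι x)) (hne : {x | x ∈ σ ∩ H ∧ m (E.ι x) = 0}.Nonempty) :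
    ∃ G ∈ P.cells, ∃ H' ∈ E.halves l, {x | x ∈ σ ∩ H ∧ m (E.ι x) = 0} = G ∩ H' := by
  have hpσ := isPoly_of_mem hP hσ
  have hzero : {x | l (E.ι x) = 0} ∈ E.halves l := by simp [halves]
  have hpart : ∀ H ∈ E.halves l, ({x | l (E.ι x) = 0} : Set X) ⊆ H := by
    rintro H (rfl | rfl | rfl) x (hx : l (E.ι x) = 0)
    · exact hx.ge
    · exact hx.le
    · exact hx
  -- the hyperplane supports `σ`
  have supp : ∀ e : N →ₗ[ℝ] ℝ, (∀ x ∈ σ, 0 ≤ e (E.ι x)) →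
      (∀ x, e (E.ι x) = 0 ↔ l (E.ι x) = 0) → (∀ x ∈ σ ∩ H, l (E.ι x) = 0) →
      ∃ G ∈ P.cells, ∃ H' ∈ E.halves l, {x | x ∈ σ ∩ H ∧ m (E.ι x) = 0} = G ∩ H' := by
    intro e he hel hlH
    obtain ⟨x, hx, hmx⟩ := hne
    have h1 := zeroSet_mem hP hσ he hx.1 ((hel x).2 (hlH x hx))
    have h2 := zeroSet_mem hP h1 (l := m) (fun z hz => hm z ⟨hz.1, hpart H hH ((hel z).1 hz.2)⟩)
      ⟨hx.1, (hel x).2 (hlH x hx)⟩ hmx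
    refine ⟨_, h2, _, hzero, ?_⟩
    ext z
    constructor
    · rintro ⟨hz, hmz⟩
      exact ⟨⟨⟨hz.1, (hel z).2 (hlH z hz)⟩, hmz⟩, hlH z hz⟩
    · rintro ⟨⟨⟨hz, _⟩, hmz⟩, hlz⟩
      exact ⟨⟨hz, hpart H hH hlz⟩, hmz⟩
  -- a multiplier is available
  have mult : ∀ (a : ℝ) (H' : Set X), H' ∈ E.halves l →
      (∀ x ∈ σ, a * l (E.ι x) ≤ m (E.ι x)) →
      (∀ x ∈ σ, x ∈ H → 0 ≤ a * l (E.ι x)) →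
      (∀ x ∈ σ, (x ∈ H ∧ a * l (E.ι x) = 0) ↔ x ∈ H') →
      ∃ G ∈ P.cells, ∃ H' ∈ E.halves l, {x | x ∈ σ ∩ H ∧ m (E.ι x) = 0} = G ∩ H' := by
    intro a H' hH' h1 h2 h3
    obtain ⟨x, hx, hmx⟩ := hne
    have k1 : ∀ z ∈ σ, 0 ≤ (m - a • l) (E.ι z) := fun z hz => by
      have := h1 z hz
      simpa using this
    have k2 : ∀ z ∈ σ ∩ H, m (E.ι z) = 0 → (m - a • l) (E.ι z) = 0 ∧ a * l (E.ι z) = 0 :=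
      fun z hz hmz => by
        have e1 := h1 z hz.1
        have e2 := h2 z hz.1 hz.2
        simp only [LinearMap.sub_apply, LinearMap.smul_apply, smul_eq_mul]
        constructor <;> linarith
    -- On the piece, `m` is the sum of the nonnegative functions `m - a • l` and `a • l`, so it
    -- vanishes exactly where both do. The first exposes a face of all of `σ`, the second cuts out
    -- `H'`.
    refine ⟨_, zeroSet_mem hP hσ k1 hx.1 (k2 x hx hmx).1, H', hH', ?_⟩
    ext z
    constructor
    · rintro ⟨hz, hmz⟩
      exact ⟨⟨hz.1, (k2 z hz hmz).1⟩, (h3 z hz.1).1 ⟨hz.2, (k2 z hz hmz).2⟩⟩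
    · rintro ⟨⟨hz, hmz⟩, hz'⟩
      obtain ⟨h4, h5⟩ := (h3 z hz).2 hz'
      simp only [LinearMap.sub_apply, LinearMap.smul_apply, smul_eq_mul, h5, sub_zero] at hmz
      exact ⟨⟨hz, h4⟩, hmz⟩
  have hneg : ∀ x, (-l) (E.ι x) = -l (E.ι x) := fun _ => rfl
  rcases hH with rfl | rfl | rfl
  · by_cases hex : ∃ x₀ ∈ σ, 0 < l (E.ι x₀)
    · obtain ⟨x₀, hx₀, hlx₀⟩ := hex
      obtain ⟨a, ha, h⟩ := (exists_multiplier hpσ (l := l) (m := m)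
        (fun x hx h => hm x ⟨hx, h.ge⟩) hx₀ hlx₀).2 0
        fun x hx h => div_nonneg (hm x ⟨hx, h.le⟩) h.le
      rcases ha.eq_or_lt with rfl | ha
      · exact mult 0 {x | 0 ≤ l (E.ι x)} (by simp [halves]) h (by simp) (by simp)
      · refine mult a _ hzero h (fun x _ hx => mul_nonneg ha.le hx) fun x _ => ?_
        simp only [Set.mem_ofPred_eq, mul_eq_zero, ha.ne', false_or, and_iff_right_iff_imp]
        exact fun h => h.ge
    · push Not at hex
      exact supp (-l) (fun x hx => by simpa using hex x hx) (fun x => neg_eq_zero)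
        fun x hx => le_antisymm (hex x hx.1) hx.2
  · by_cases hex : ∃ x₀ ∈ σ, l (E.ι x₀) < 0
    · obtain ⟨x₀, hx₀, hlx₀⟩ := hex
      obtain ⟨a, ha, h⟩ := (exists_multiplier hpσ (l := -l) (m := m)
        (fun x hx h => hm x ⟨hx, (neg_eq_zero.1 h).le⟩) hx₀ (by simpa using hlx₀)).2 0
        fun x hx h => div_nonneg (hm x ⟨hx, by rw [hneg] at h; exact (neg_pos.1 h).le⟩) h.le
      have h' : ∀ x ∈ σ, (-a) * l (E.ι x) ≤ m (E.ι x) := fun x hx => by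
        have := h x hx
        rw [hneg] at this
        linarith
      rcases ha.eq_or_lt with rfl | ha
      · exact mult (-0) {x | l (E.ι x) ≤ 0} (by simp [halves]) h' (by simp) (by simp)
      · refine mult (-a) _ hzero h' (fun x _ (hx : l (E.ι x) ≤ 0) => by nlinarith) fun x _ => ?_
        simp only [Set.mem_ofPred_eq, mul_eq_zero, neg_eq_zero, ha.ne', false_or,
          and_iff_right_iff_imp]
        exact fun h => h.le
    · push Not at hex
      exact supp l hex (fun x => Iff.rfl) fun x hx => le_antisymm hx.2 (hex x hx.1)
  · by_cases hex : ∃ x₀ ∈ σ, 0 < l (E.ι x₀)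
    · by_cases hex' : ∃ z₀ ∈ σ, l (E.ι z₀) < 0
      · obtain ⟨x₀, hx₀, hlx₀⟩ := hex
        obtain ⟨z₀, hz₀, hlz₀⟩ := hex'
        obtain ⟨h1, h2⟩ := exists_multiplier hpσ (l := l) (m := m)
          (fun x hx h => hm x ⟨hx, h⟩) hx₀ hlx₀
        -- The lower bound required of the ratios is the value of `m / l` at `z₀`.
        obtain ⟨a, -, h⟩ := h2 _ fun x hx h => h1 x hx z₀ hz₀ h hlz₀
        refine mult a _ hzero h (fun x _ (hx : l (E.ι x) = 0) => by simp [hx]) fun x _ => ?_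
        simp +contextual
      · push Not at hex'
        exact supp l hex' (fun x => Iff.rfl) fun x hx => hx.2
    · push Not at hex
      exact supp (-l) (fun x hx => by simpa using hex x hx) (fun x => neg_eq_zero)
        fun x hx => hx.2

variable [FiniteDimensional ℝ N]

variable (E) in
/-- The subdivision of a polyhedral structure by the hyperplane defined by a linear function. -/
def cut (P : PolyhedralStructure X) (hP : IsCompatible P E.ι) (l : N →ₗ[ℝ] ℝ) :
    PolyhedralStructure X where
  cells := {κ | κ.Nonempty ∧ ∃ σ ∈ P.cells, ∃ H ∈ E.halves l, κ = σ ∩ H}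
  funs := E.affineFuns
  isClosed := by
    rintro _ ⟨-, σ, hσ, H, hH, rfl⟩
    refine (P.isClosed σ hσ).inter ?_
    have hc : Continuous fun x => l (E.ι x) :=
      l.continuous_of_finiteDimensional.comp (continuous_ι E)
    rcases hH with rfl | rfl | rfl
    · exact isClosed_le continuous_const hc
    · exact isClosed_le hc continuous_const
    · exact isClosed_eq hc continuous_const
  covers := by
    refine Set.eq_univ_of_forall fun x => ?_
    obtain ⟨σ, hσ, hx⟩ := P.exists_cell x
    rcases le_total 0 (l (E.ι x)) with h | h
    · exact ⟨σ ∩ {x | 0 ≤ l (E.ι x)}, ⟨⟨x, hx, h⟩, σ, hσ, _, by simp [halves], rfl⟩, hx, h⟩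
    · exact ⟨σ ∩ {x | l (E.ι x) ≤ 0}, ⟨⟨x, hx, h⟩, σ, hσ, _, by simp [halves], rfl⟩, hx, h⟩
  locallyFinite := by
    intro x
    obtain ⟨t, ht, hfin⟩ := P.locallyFinite x
    refine ⟨t, ht, Set.Finite.of_finite_image (f := Subtype.val) ?_ Subtype.val_injective.injOn⟩
    have hfin2 : (E.halves l).Finite := by simp [halves]
    refine ((hfin.image Subtype.val).image2 (fun σ H => σ ∩ H) hfin2).subset ?_
    rintro _ ⟨⟨_, _, σ, hσ, H, hH, rfl⟩, hne, rfl⟩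
    refine ⟨σ, ⟨⟨σ, hσ⟩, ?_, rfl⟩, H, hH, rfl⟩
    exact hne.mono (Set.inter_subset_inter_left _ Set.inter_subset_left)
  isPolyhedron := by
    rintro _ ⟨hne, σ, hσ, H, hH, rfl⟩
    refine isPolyhedron_of_isPoly hne ?_ (isPoly_inter_halves (isPoly_of_mem hP hσ) hH)
    exact (isEmbedding_restrict hP hσ).comp
      (Topology.IsEmbedding.inclusion Set.inter_subset_left)
  face_mem := by
    rintro _ ⟨hne, σ, hσ, H, hH, rfl⟩ F hF hFne
    obtain ⟨m, hm, rfl⟩ := isFaceOf_affineFuns.1 hF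
    exact ⟨hFne, exists_face_inter_halves hP hσ hH hm hFne⟩
  face_funs := fun _ _ _ _ _ h => (restrictFuns_affineFuns h).symm
  inter_face := by
    have key : ∀ σ ∈ P.cells, ∀ τ ∈ P.cells, ∀ H ∈ E.halves l, ∀ H' ∈ E.halves l,
        ((σ ∩ H) ∩ (τ ∩ H')).Nonempty →
        IsFaceOf (E.affineFuns (σ ∩ H)) ((σ ∩ H) ∩ (τ ∩ H')) := by
      intro σ hσ τ hτ H hH H' hH' hne
      obtain ⟨m, hm, hF⟩ := (isFaceOf_iff hP hσ).1 (P.inter_face σ hσ τ hτ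
        (hne.mono (Set.inter_subset_inter Set.inter_subset_left Set.inter_subset_left))).1
      obtain ⟨e, he⟩ := exists_exposing_halves hH hH'
      refine isFaceOf_affineFuns.2 ⟨m + e, fun x hx => add_nonneg (hm x hx.1) (he x hx.2).1, ?_⟩
      ext x
      have hFx : x ∈ σ ∩ τ ↔ x ∈ σ ∧ m (E.ι x) = 0 := by rw [hF]; rfl
      simp only [Set.mem_inter_iff, Set.mem_ofPred_eq, LinearMap.add_apply]
      constructor
      · rintro ⟨⟨h1, h2⟩, h3, h4⟩
        refine ⟨⟨h1, h2⟩, ?_⟩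
        rw [(hFx.1 ⟨h1, h3⟩).2, (he x h2).2.2 h4, add_zero]
      · rintro ⟨⟨h1, h2⟩, h3⟩
        obtain ⟨h4, h5⟩ := (add_eq_zero_iff_of_nonneg (hm x h1) (he x h2).1).1 h3
        exact ⟨⟨h1, h2⟩, (hFx.2 ⟨h1, h4⟩).2, (he x h2).2.1 h5⟩
    rintro _ ⟨-, σ, hσ, H, hH, rfl⟩ _ ⟨-, τ, hτ, H', hH', rfl⟩ hne
    refine ⟨key σ hσ τ hτ H hH H' hH' hne, ?_⟩
    rw [Set.inter_comm (σ ∩ H)] at hne ⊢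
    exact key τ hτ σ hσ H' hH' H hH hne

omit [FiniteDimensional ℝ N] in
theorem isCompatible_of_isSubdivision {P P' : PolyhedralStructure X} (h : P'.IsSubdivision P)
    (hP : IsCompatible P E.ι) : IsCompatible P' E.ι := by
  intro σ' hσ'
  obtain ⟨σ, hσ, hsub, hle⟩ := h σ' hσ'
  refine ⟨fun l => hle ?_, (hP σ hσ).2.mono hsub⟩
  exact ⟨_, (hP σ hσ).1 l, rfl⟩

omit [FiniteDimensional ℝ N] in
-- By `funs_eq` all affine functions come from `N`, so affineness of the inclusions is automatic.
theorem isSubdivision_iff {P P' : PolyhedralStructure X} (hP : IsCompatible P E.ι)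
    (hP' : IsCompatible P' E.ι) :
    P'.IsSubdivision P ↔ ∀ σ' ∈ P'.cells, ∃ σ ∈ P.cells, σ' ⊆ σ := by
  constructor
  · intro h σ' hσ'
    obtain ⟨σ, hσ, hsub, -⟩ := h σ' hσ'
    exact ⟨σ, hσ, hsub⟩
  · intro h σ' hσ'
    obtain ⟨σ, hσ, hsub⟩ := h σ' hσ'
    refine ⟨σ, hσ, hsub, ?_⟩
    rw [funs_eq hP hσ, funs_eq hP' hσ', restrictFuns_affineFuns]

omit [FiniteDimensional ℝ N] in
theorem isSubdivision_trans {P Q R : PolyhedralStructure X} (hP : IsCompatible P E.ι)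
    (h : Q.IsSubdivision P) (h' : R.IsSubdivision Q) : R.IsSubdivision P := by
  have hQ := isCompatible_of_isSubdivision h hP
  have hR := isCompatible_of_isSubdivision h' hQ
  rw [isSubdivision_iff hP hR]
  intro σ hσ
  obtain ⟨τ, hτ, hsub⟩ := (isSubdivision_iff hQ hR).1 h' σ hσ
  obtain ⟨ρ, hρ, hsub'⟩ := (isSubdivision_iff hP hQ).1 h τ hτ
  exact ⟨ρ, hρ, hsub.trans hsub'⟩

theorem isCompatible_cut {P : PolyhedralStructure X} (hP : IsCompatible P E.ι) (l : N →ₗ[ℝ] ℝ) :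
    IsCompatible (E.cut P hP l) E.ι := by
  rintro _ ⟨-, σ, hσ, H, -, rfl⟩
  exact ⟨fun l => ⟨l, rfl⟩, (hP σ hσ).2.mono Set.inter_subset_left⟩

theorem isSubdivision_cut {P : PolyhedralStructure X} (hP : IsCompatible P E.ι)
    (l : N →ₗ[ℝ] ℝ) : (E.cut P hP l).IsSubdivision P := by
  rw [isSubdivision_iff hP (isCompatible_cut hP l)]
  rintro _ ⟨-, σ, hσ, H, -, rfl⟩
  exact ⟨σ, hσ, Set.inter_subset_left⟩

/-- A common subdivision of `P` and the base structure, cut by the same hyperplane, subdivides both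
the cut of `P` and the base. -/
theorem isComplex_cut {P : PolyhedralStructure X} (hP : E.IsComplex P) (l : N →ₗ[ℝ] ℝ) :
    E.IsComplex (E.cut P hP.2 l) := by
  obtain ⟨R, hRP, hRb⟩ := hP.1
  have hR := isCompatible_of_isSubdivision hRP hP.2
  refine ⟨⟨E.cut R hR l, ?_, ?_⟩, isCompatible_cut hP.2 l⟩
  · rw [isSubdivision_iff (isCompatible_cut hP.2 l) (isCompatible_cut hR l)]
    rintro _ ⟨hne, σ, hσ, H, hH, rfl⟩
    obtain ⟨τ, hτ, hsub⟩ := (isSubdivision_iff hP.2 hR).1 hRP σ hσ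
    have := Set.inter_subset_inter_left H hsub
    exact ⟨τ ∩ H, ⟨hne.mono this, τ, hτ, H, hH, rfl⟩, this⟩
  · exact isSubdivision_trans E.base_compatible hRb (isSubdivision_cut hR l)

/-- Every complex has a subdivision on whose polyhedra given linear functions do not change sign,
and which is no finer than needed for this. -/
theorem exists_subdivision {P : PolyhedralStructure X} (hP : E.IsComplex P)
    (L : List (N →ₗ[ℝ] ℝ)) :
    ∃ Q : PolyhedralStructure X, E.IsComplex Q ∧ Q.IsSubdivision P ∧
      (∀ l ∈ L, ∀ κ ∈ Q.cells, (∀ x ∈ κ, 0 ≤ l (E.ι x)) ∨ ∀ x ∈ κ, l (E.ι x) ≤ 0) ∧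
      ∀ κ ∈ Q.cells, ∀ p ∈ κ, ∀ x, (∀ σ ∈ P.cells, p ∈ σ → x ∈ σ) →
        (∀ l ∈ L, (0 ≤ l (E.ι p) → 0 ≤ l (E.ι x)) ∧ (l (E.ι p) ≤ 0 → l (E.ι x) ≤ 0)) → x ∈ κ := by
  induction L with
  | nil =>
    refine ⟨P, hP, ?_, by simp, fun κ hκ p hp x h _ => h κ hκ hp⟩
    rw [isSubdivision_iff hP.2 hP.2]
    exact fun σ hσ => ⟨σ, hσ, subset_rfl⟩
  | cons l L ih =>
    obtain ⟨Q, hQ, hQP, hsign, hsat⟩ := ih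
    refine ⟨E.cut Q hQ.2 l, isComplex_cut hQ l,
      isSubdivision_trans hP.2 hQP (isSubdivision_cut hQ.2 l), ?_, ?_⟩
    · intro l' hl' κ hκ
      rcases List.mem_cons.1 hl' with rfl | hl'
      · obtain ⟨-, σ, hσ, H, rfl | rfl | rfl, rfl⟩ := hκ
        · exact Or.inl fun x hx => hx.2
        · exact Or.inr fun x hx => hx.2
        · exact Or.inl fun x hx => ge_of_eq hx.2
      · obtain ⟨-, σ, hσ, H, -, rfl⟩ := hκ
        rcases hsign l' hl' σ hσ with h | h
        · exact Or.inl fun x hx => h x hx.1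
        · exact Or.inr fun x hx => h x hx.1
    · rintro κ ⟨-, σ, hσ, H, hH, rfl⟩ p hp x hx hL
      refine ⟨hsat σ hσ p hp.1 x hx fun l' hl' => hL l' (List.mem_cons_of_mem _ hl'), ?_⟩
      obtain ⟨h1, h2⟩ := hL l List.mem_cons_self
      have hpH := hp.2
      rcases hH with rfl | rfl | rfl
      · exact h1 hpH
      · exact h2 hpH
      · exact le_antisymm (h2 (le_of_eq hpH)) (h1 (ge_of_eq hpH))

end EuclideanPolyhedralSpace

/-! ### Pullback of top-dimensional weights. -/

namespace EuclideanPolyhedralSpace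

variable {E : EuclideanPolyhedralSpace X N} [FiniteDimensional ℝ N]
  {P Q : PolyhedralStructure X}

omit [FiniteDimensional ℝ N] in
-- The function exposing the carrier of `z` in a polyhedron of `P` containing `κ` vanishes at a
-- relative interior point of `κ`, hence on `κ`.
theorem subset_carrier (hP : IsCompatible P E.ι) (hQP : Q.IsSubdivision P) {κ : Set X}
    (hκ : κ ∈ Q.cells) {z : X} (hz : z ∈ E.relint κ) : κ ⊆ P.carrier z := by
  obtain ⟨σ, hσ, hsub, -⟩ := hQP κ hκ
  obtain ⟨l, hl, hF⟩ := exists_exposing hP hσ (P.carrier_mem z) (P.carrier_subset hσ (hsub hz.1))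
  have hz0 : l (E.ι z) = 0 := by
    have := P.mem_carrier z
    rw [hF] at this
    exact this.2
  intro u hu
  rw [hF]
  exact ⟨hsub hu, hz.2 l (fun v hv => hl v (hsub hv)) hz0 u hu⟩

theorem dim_le_dim_of_subset (hP : IsCompatible P E.ι) (hQ : IsCompatible Q E.ι) {κ σ : Set X}
    (hκ : κ ∈ Q.cells) (hσ : σ ∈ P.cells) (h : κ ⊆ σ) : Q.dim κ ≤ P.dim σ := by
  rw [dim_eq hP hσ, dim_eq hQ hκ]
  exact Submodule.finrank_mono (dir_mono h)

theorem dir_eq_of_subset (hP : IsCompatible P E.ι) (hQ : IsCompatible Q E.ι) {κ σ : Set X}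
    (hκ : κ ∈ Q.cells) (hσ : σ ∈ P.cells) (h : κ ⊆ σ) (hd : P.dim σ ≤ Q.dim κ) :
    E.dir κ = E.dir σ := by
  rw [dim_eq hP hσ, dim_eq hQ hκ] at hd
  exact Submodule.eq_of_le_of_finrank_le (dir_mono h) hd

/-- The intersection of the two polyhedra contains `κ`, so it already has full dimension in each.
This makes the choice in `pullback` harmless. -/
theorem cell_unique (hP : IsCompatible P E.ι) (hQ : IsCompatible Q E.ι) {κ σ₁ σ₂ : Set X}
    (hκ : κ ∈ Q.cells) (hσ₁ : σ₁ ∈ P.cells) (hσ₂ : σ₂ ∈ P.cells) (h₁ : κ ⊆ σ₁) (h₂ : κ ⊆ σ₂)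
    (hd₁ : P.dim σ₁ ≤ Q.dim κ) (hd₂ : P.dim σ₂ ≤ Q.dim κ) : σ₁ = σ₂ := by
  obtain ⟨x, hx⟩ := (Q.isPolyhedron κ hκ).nonempty
  have hmem := P.inter_mem hσ₁ hσ₂ ⟨x, h₁ hx, h₂ hx⟩
  have hle := dim_le_dim_of_subset hP hQ hκ hmem (Set.subset_inter h₁ h₂)
  rw [← eq_of_dim_le hP hσ₁ hmem Set.inter_subset_left (hd₁.trans hle)]
  exact eq_of_dim_le hP hσ₂ hmem Set.inter_subset_right (hd₂.trans hle)

theorem pullback_eq (hP : IsCompatible P E.ι) (hQ : IsCompatible Q E.ι) {U : Set X}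
    (c : Set X → ℝ) {κ σ : Set X} (hκ : κ ∈ Q.cells) (hσ : σ ∈ P.restrict U) (h : κ ⊆ σ)
    (hd : P.dim σ = Q.dim κ) : P.pullback Q U c κ = c σ := by
  have hex : ∃ σ, σ ∈ P.restrict U ∧ κ ⊆ σ ∧ P.dim σ = Q.dim κ := ⟨σ, hσ, h, hd⟩
  rw [PolyhedralStructure.pullback, dif_pos hex]
  obtain ⟨h1, h2, h3⟩ := hex.choose_spec
  rw [cell_unique hP hQ hκ h1.1 hσ.1 h2 h h3.le hd.le]

/-- Facets with the same normal inside a set on which `ι` is injective coincide. -/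
theorem eq_of_unitNormal_eq (hQ : IsCompatible Q E.ι) {κ₁ κ₂ τ Z : Set X}
    (h₁ : Q.IsFacet κ₁ τ) (h₂ : Q.IsFacet κ₂ τ) (hZ : Set.InjOn E.ι Z) (hZ₁ : κ₁ ⊆ Z)
    (hZ₂ : κ₂ ⊆ Z) (h : E.unitNormal κ₁ τ = E.unitNormal κ₂ τ) : κ₁ = κ₂ := by
  obtain ⟨x, hx⟩ := (isPoly_of_mem hQ h₁.facet).relint_nonempty
    (Q.isPolyhedron τ h₁.facet).nonempty
  obtain ⟨ε₁, hε₁, H₁⟩ := exists_germ hQ h₁ hx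
  obtain ⟨ε₂, hε₂, H₂⟩ := exists_germ hQ h₂ hx
  obtain ⟨z₁, hz₁, hz₁'⟩ := H₁ (min ε₁ ε₂) (by positivity) (min_le_left _ _)
  obtain ⟨z₂, hz₂, hz₂'⟩ := H₂ (min ε₁ ε₂) (by positivity) (min_le_right _ _)
  have : z₁ = z₂ := hZ (hZ₁ hz₁.1) (hZ₂ hz₂.1) (by rw [hz₁', hz₂', h])
  subst this
  rw [← carrier_eq hQ h₁.cell hz₁, carrier_eq hQ h₂.cell hz₂]

variable {n : ℕ}

theorem exists_cell_of_top (hn : E.HasPureDimension n) (hP : E.IsComplex P) (hQ : E.IsComplex Q)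
    (hQP : Q.IsSubdivision P) {κ : Set X} (hκ : κ ∈ Q.cells) (hd : Q.dim κ = n) :
    ∃ σ ∈ P.cells, κ ⊆ σ ∧ P.dim σ = n := by
  obtain ⟨σ, hσ, hsub, -⟩ := hQP κ hκ
  have h1 := dim_le_dim_of_subset hP.2 hQ.2 hκ hσ hsub
  have h2 := hn.dim_le hP hσ
  exact ⟨σ, hσ, hsub, by omega⟩

/-- Here `τ'` has the dimension of the polyhedron of `P` carrying it. Each cofacet of `τ'` lies in a
unique cofacet of that polyhedron, with the same normal and value, and this correspondence is
bijective; the sum is the old balancing sum. -/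
theorem sum_pullback_of_dim_succ (hn : E.HasPureDimension n) (hP : E.IsComplex P)
    (hQ : E.IsComplex Q) (hQP : Q.IsSubdivision P) {U : Set X} {c : Set X → ℝ}
    (hc : E.IsMinkowskiWeight P U n c) {τ' : Set X} (hτ' : τ' ∈ Q.restrict U)
    (hd' : Q.dim τ' + 1 = n) {x : X} (hx : x ∈ E.relint τ') (hd : P.dim (P.carrier x) + 1 = n) :
    ∑ᶠ (σ : Set X) (_ : σ ∈ Q.cofacets U τ'), P.pullback Q U c σ • E.unitNormal σ τ' = 0 := by
  classical
  have hττ := subset_carrier hP.2 hQP hτ'.1 hx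
  set τ := P.carrier x with hτdef
  have hτ : τ ∈ P.restrict U :=
    ⟨P.carrier_mem x, hτ'.2.mono (Set.inter_subset_inter_left _ hττ)⟩
  have hxτ : x ∈ E.relint τ := mem_relint_carrier hP.2 x
  choose! e he using fun κ (h : κ ∈ Q.cofacets U τ') => by
    have hf := (PolyhedralStructure.mem_cofacets_iff hτ').1 h
    exact exists_cell_of_top hn hP hQ hQP hf.cell (by rw [hf.dim_eq, hd'])
  have hfac : ∀ κ ∈ Q.cofacets U τ', P.IsFacet (e κ) τ := fun κ h => by
    obtain ⟨h1, h2, h3⟩ := he κ h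
    have hf := (PolyhedralStructure.mem_cofacets_iff hτ').1 h
    exact ⟨h1, hτ.1, P.carrier_subset h1 (h2 (hf.subset hx.1)), by omega⟩
  have hdirτ : E.dir τ' = E.dir τ := dir_eq_of_subset hP.2 hQ.2 hτ'.1 hτ.1 hττ (by omega)
  have hnormal : ∀ κ ∈ Q.cofacets U τ', E.unitNormal κ τ' = E.unitNormal (e κ) τ := fun κ h => by
    have hf := (PolyhedralStructure.mem_cofacets_iff hτ').1 h
    obtain ⟨h1, h2, h3⟩ := he κ h
    have hdirκ := dir_eq_of_subset hP.2 hQ.2 hf.cell h1 h2 (by rw [h3, hf.dim_eq, hd'])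
    obtain ⟨v1, v2, v3, v4⟩ := isUnitNormal_iff.1 (isUnitNormal_unitNormal hP.2 (hfac κ h))
    refine unitNormal_eq hQ.2 hf (isUnitNormal_iff.2 ⟨v1, hdirκ ▸ v2, hdirτ ▸ v3, ?_⟩)
    exact fun a ha b hb => v4 a (h2 ha) b (hττ hb)
  have hval : ∀ κ ∈ Q.cofacets U τ', P.pullback Q U c κ = c (e κ) := fun κ h => by
    have hf := (PolyhedralStructure.mem_cofacets_iff hτ').1 h
    obtain ⟨h1, h2, h3⟩ := he κ h
    refine pullback_eq hP.2 hQ.2 c hf.cell ⟨h1, ?_⟩ h2 (by rw [h3, hf.dim_eq, hd'])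
    exact hτ'.2.mono (Set.inter_subset_inter_left _ (hf.subset.trans h2))
  have hbij : Set.BijOn e (Q.cofacets U τ') (P.cofacets U τ) := by
    refine ⟨fun κ h => (PolyhedralStructure.mem_cofacets_iff hτ).2 (hfac κ h), ?_, ?_⟩
    · intro κ₁ h₁ κ₂ h₂ heq
      have hf₁ := (PolyhedralStructure.mem_cofacets_iff hτ').1 h₁
      have hf₂ := (PolyhedralStructure.mem_cofacets_iff hτ').1 h₂
      refine eq_of_unitNormal_eq hQ.2 hf₁ hf₂ (hP.2 _ (he κ₁ h₁).1).2 (he κ₁ h₁).2.1 ?_ ?_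
      · rw [heq]; exact (he κ₂ h₂).2.1
      · rw [hnormal κ₁ h₁, hnormal κ₂ h₂, heq]
    · intro σ hσ
      have hf := (PolyhedralStructure.mem_cofacets_iff hτ).1 hσ
      -- A point of `σ` close to `x` in the normal direction has as its carrier in `Q` a cofacet of
      -- `τ'` contained in `σ`.
      obtain ⟨V, -, hVo, hxV, hV⟩ := Q.exists_isOpen_forall_mem (Filter.univ_mem (f := nhds x))
      obtain ⟨ε, hε, H⟩ := exists_germ hP.2 hf hxτ
      obtain ⟨δ, hδ, K⟩ := exists_forall_smul_mem hP.2 hf.cell (hf.subset hxτ.1)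
        (hVo.mem_nhds hxV) (E.unitNormal σ τ)
      obtain ⟨z, hz, hz'⟩ := H (min ε δ) (by positivity) (min_le_left _ _)
      have hzV := K _ (by positivity) (min_le_right _ _) z hz.1 hz'
      have hκ := Q.carrier_mem z
      have hxκ := hV _ hκ ⟨z, Q.mem_carrier z, hzV⟩
      have hτκ := subset_of_mem_relint hQ.2 hκ hτ'.1 hx hxκ
      have hκσ : Q.carrier z ⊆ σ := by
        have := subset_carrier hP.2 hQP hκ (mem_relint_carrier hQ.2 z)
        rwa [carrier_eq hP.2 hf.cell hz] at this
      have hzτ : z ∉ τ' := fun h => by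
        have h1 := dim_le_of_subset hP.2 hτ.1 hf.cell
          (subset_of_mem_relint hP.2 hτ.1 hf.cell hz (hττ h))
        have := hf.dim_eq
        omega
      have d1 := dim_lt_of_notMem hQ.2 hκ hτ'.1 hτκ (Q.mem_carrier z) hzτ
      have d2 := dim_le_dim_of_subset hP.2 hQ.2 hκ hf.cell hκσ
      have d3 := hf.dim_eq
      have hmem : Q.carrier z ∈ Q.cofacets U τ' :=
        (PolyhedralStructure.mem_cofacets_iff hτ').2 ⟨hκ, hτ'.1, hτκ, by omega⟩
      obtain ⟨h1, h2, h3⟩ := he _ hmem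
      exact ⟨_, hmem, cell_unique hP.2 hQ.2 hκ h1 hf.cell h2 hκσ (by omega) (by omega)⟩
  rw [finsum_mem_eq_of_bijOn (g := fun σ => c σ • E.unitNormal σ τ) e hbij fun κ h => by rw [hval κ h, hnormal κ h]]
  exact hc τ hτ hd

/-- Inside a polyhedron of the coarser complex, every normal direction is realised. -/
theorem exists_facet_of_normal (hP : IsCompatible P E.ι) (hQ : IsCompatible Q E.ι)
    (hQP : Q.IsSubdivision P) {τ' : Set X} (hτ' : τ' ∈ Q.cells) {x : X} (hx : x ∈ E.relint τ')
    (hd : P.dim (P.carrier x) = Q.dim τ' + 1) {v : N} (hv : v ∈ E.dir (P.carrier x))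
    (hv1 : ‖v‖ = 1) (hvτ : ∀ w ∈ E.dir τ', ⟪w, v⟫_ℝ = 0) :
    ∃ κ, Q.IsFacet κ τ' ∧ E.unitNormal κ τ' = v := by
  have hττ := subset_carrier hP hQP hτ' hx
  have hτ := P.carrier_mem x
  have hxτ : x ∈ E.relint (P.carrier x) := mem_relint_carrier hP x
  obtain ⟨V, -, hVo, hxV, hV⟩ := Q.exists_isOpen_forall_mem (Filter.univ_mem (f := nhds x))
  obtain ⟨ε, hε, H⟩ := (isPoly_of_mem hP hτ).exists_extend_relint hxτ hv
  obtain ⟨δ, hδ, K⟩ := exists_forall_smul_mem hP hτ hxτ.1 (hVo.mem_nhds hxV) v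
  have ht : 0 < min ε δ := by positivity
  set t := min ε δ
  obtain ⟨z, hz, hz'⟩ := H t ht.le (min_le_left _ _)
  have hzV := K t ht.le (min_le_right _ _) z hz.1 hz'
  have hκ := Q.carrier_mem z
  have hxκ := hV _ hκ ⟨z, Q.mem_carrier z, hzV⟩
  have hτκ := subset_of_mem_relint hQ hκ hτ' hx hxκ
  have hκσ : Q.carrier z ⊆ P.carrier x := by
    have := subset_carrier hP hQP hκ (mem_relint_carrier hQ z)
    rwa [carrier_eq hP hτ hz] at this
  have hzx : E.ι z - E.ι x = t • v := by rw [hz', add_sub_cancel_left]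
  have hzτ : z ∉ τ' := fun h => by
    have h1 := hvτ _ (sub_mem_dir h hx.1)
    rw [hzx, inner_smul_left, real_inner_self_eq_norm_sq, hv1] at h1
    simp [ht.ne'] at h1
  have d1 := dim_lt_of_notMem hQ hκ hτ' hτκ (Q.mem_carrier z) hzτ
  have d2 := dim_le_dim_of_subset hP hQ hκ hτ hκσ
  have hf : Q.IsFacet (Q.carrier z) τ' := ⟨hκ, hτ', hτκ, by omega⟩
  refine ⟨_, hf, ?_⟩
  obtain ⟨u1, u2, u3, u4⟩ := isUnitNormal_iff.1 (isUnitNormal_unitNormal hQ hf)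
  set u := E.unitNormal (Q.carrier z) τ'
  have hdir := dir_eq_of_subset hP hQ hκ hτ hκσ (by omega)
  have h1 := eq_inner_smul (dir_mono hτκ) (finrank_dir_facet hQ hf) u2 u1 u3 (hdir ▸ hv) hvτ
  have h2 := u4 z (Q.mem_carrier z) x hx.1
  rw [hzx, inner_smul_right] at h2
  have h3 : 0 ≤ ⟪u, v⟫_ℝ := nonneg_of_mul_nonneg_right h2 ht
  have h4 : ‖v‖ = |⟪u, v⟫_ℝ| * ‖u‖ := by
    conv_lhs => rw [h1]
    rw [norm_smul, Real.norm_eq_abs]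
  rw [hv1, u1, abs_of_nonneg h3, mul_one] at h4
  rw [h1, ← h4, one_smul]

/-- Here `τ'` runs through the interior of an `n`-dimensional polyhedron of `P`. It has exactly two
cofacets, with opposite normals and equal values, so the sum cancels. -/
theorem sum_pullback_of_dim_eq (hn : E.HasPureDimension n) (hP : E.IsComplex P)
    (hQ : E.IsComplex Q) (hQP : Q.IsSubdivision P) {U : Set X} {c : Set X → ℝ}
    {τ' : Set X} (hτ' : τ' ∈ Q.restrict U) (hd' : Q.dim τ' + 1 = n) {x : X}
    (hx : x ∈ E.relint τ') (hd : P.dim (P.carrier x) = n) :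
    ∑ᶠ (σ : Set X) (_ : σ ∈ Q.cofacets U τ'), P.pullback Q U c σ • E.unitNormal σ τ' = 0 := by
  classical
  have hττ := subset_carrier hP.2 hQP hτ'.1 hx
  have hτ := P.carrier_mem x
  have hle := dir_mono (E := E) hττ
  have hfin : Module.finrank ℝ (E.dir (P.carrier x)) = Module.finrank ℝ (E.dir τ') + 1 := by
    rw [← dim_eq hP.2 hτ, ← dim_eq hQ.2 hτ'.1]; omega
  obtain ⟨w, hw, hwτ⟩ : ∃ w ∈ E.dir (P.carrier x), w ∉ E.dir τ' := by
    by_contra! h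
    have := Submodule.finrank_mono (show E.dir (P.carrier x) ≤ E.dir τ' from h)
    omega
  obtain ⟨v, hv, hv1, hvτ⟩ := exists_unit_orthogonal hle hw hwτ
  have hsub : ∀ κ, Q.IsFacet κ τ' → κ ⊆ P.carrier x := fun κ hf => by
    obtain ⟨σ, hσ, h1, h2⟩ := exists_cell_of_top hn hP hQ hQP hf.cell (by rw [hf.dim_eq, hd'])
    rw [eq_of_dim_le hP.2 hσ hτ (P.carrier_subset hσ (h1 (hf.subset hx.1))) (by omega)]
    exact h1
  have hval : ∀ κ, Q.IsFacet κ τ' → P.pullback Q U c κ = c (P.carrier x) := fun κ hf =>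
    pullback_eq hP.2 hQ.2 c hf.cell ⟨hτ, hτ'.2.mono (Set.inter_subset_inter_left _ hττ)⟩
      (hsub κ hf) (by rw [hf.dim_eq, hd, hd'])
  have hbij : Set.BijOn (fun κ => E.unitNormal κ τ') (Q.cofacets U τ') {v, -v} := by
    refine ⟨fun κ h => ?_, fun κ₁ h₁ κ₂ h₂ heq => ?_, fun u hu => ?_⟩
    · have hf := (PolyhedralStructure.mem_cofacets_iff hτ').1 h
      obtain ⟨u1, u2, u3, -⟩ := isUnitNormal_iff.1 (isUnitNormal_unitNormal hQ.2 hf)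
      have h1 := eq_inner_smul hle hfin hv hv1 hvτ (dir_mono (hsub κ hf) u2) u3
      have h2 : ‖E.unitNormal κ τ'‖ = |⟪v, E.unitNormal κ τ'⟫_ℝ| * ‖v‖ := by
        conv_lhs => rw [h1]
        rw [norm_smul, Real.norm_eq_abs]
      rw [u1, hv1, mul_one] at h2
      change E.unitNormal κ τ' = v ∨ E.unitNormal κ τ' = -v
      rcases eq_or_eq_neg_of_abs_eq h2.symm with h3 | h3
      · left; rw [h1, h3, one_smul]
      · right; rw [h1, h3, neg_one_smul]
    · exact eq_of_unitNormal_eq hQ.2 ((PolyhedralStructure.mem_cofacets_iff hτ').1 h₁)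
        ((PolyhedralStructure.mem_cofacets_iff hτ').1 h₂) (hP.2 _ hτ).2
        (hsub κ₁ ((PolyhedralStructure.mem_cofacets_iff hτ').1 h₁))
        (hsub κ₂ ((PolyhedralStructure.mem_cofacets_iff hτ').1 h₂)) heq
    · obtain ⟨κ, hf, h⟩ : ∃ κ, Q.IsFacet κ τ' ∧ E.unitNormal κ τ' = u := by
        rcases hu with rfl | rfl
        · exact exists_facet_of_normal hP.2 hQ.2 hQP hτ'.1 hx (by omega) hv hv1 hvτ
        · exact exists_facet_of_normal hP.2 hQ.2 hQP hτ'.1 hx (by omega) (neg_mem hv)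
            (by rwa [norm_neg]) (fun w hw => by rw [inner_neg_right, hvτ w hw, neg_zero])
      exact ⟨κ, (PolyhedralStructure.mem_cofacets_iff hτ').2 hf, h⟩
  have hvne : v ≠ -v := fun h => by
    have h2 : (2 : ℝ) • v = 0 := by rw [two_smul, ← sub_neg_eq_add, ← h, sub_self]
    have : v = 0 := (smul_eq_zero.1 h2).resolve_left two_ne_zero
    simp [this] at hv1
  rw [finsum_mem_eq_of_bijOn (g := fun u => c (P.carrier x) • u) _ hbij fun κ h => by
    rw [hval κ ((PolyhedralStructure.mem_cofacets_iff hτ').1 h)], finsum_mem_pair hvne]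
  simp

/-- The pullback of a top-dimensional Minkowski weight to a subdivision is a Minkowski weight. -/
theorem isMinkowskiWeight_pullback (hn : E.HasPureDimension n) (hP : E.IsComplex P)
    (hQ : E.IsComplex Q) (hQP : Q.IsSubdivision P) {U : Set X} {c : Set X → ℝ}
    (hc : E.IsMinkowskiWeight P U n c) : E.IsMinkowskiWeight Q U n (P.pullback Q U c) := by
  intro τ' hτ' hd'
  obtain ⟨x, hx⟩ := (isPoly_of_mem hQ.2 hτ'.1).relint_nonempty
    (Q.isPolyhedron τ' hτ'.1).nonempty
  have h1 := dim_le_dim_of_subset hP.2 hQ.2 hτ'.1 (P.carrier_mem x)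
    (subset_carrier hP.2 hQP hτ'.1 hx)
  have h2 := hn.dim_le hP (P.carrier_mem x)
  rcases h2.eq_or_lt with h | h
  · exact sum_pullback_of_dim_eq hn hP hQ hQP hτ' hd' hx h
  · exact sum_pullback_of_dim_succ hn hP hQ hQP hc hτ' hd' hx (by omega)

theorem pullback_pos (hn : E.HasPureDimension n) (hP : E.IsComplex P)
    (hQ : E.IsComplex Q) (hQP : Q.IsSubdivision P) {U : Set X} {c : Set X → ℝ}
    (hc : ∀ σ ∈ P.restrictDim U n, 0 < c σ) {κ : Set X} (hκ : κ ∈ Q.restrictDim U n) :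
    0 < P.pullback Q U c κ := by
  obtain ⟨σ, hσ, hsub, hd⟩ := exists_cell_of_top hn hP hQ hQP hκ.1.1 hκ.2
  have hσU : σ ∈ P.restrict U := ⟨hσ, hκ.1.2.mono (Set.inter_subset_inter_left _ hsub)⟩
  rw [pullback_eq hP.2 hQ.2 c hκ.1.1 hσU hsub (by rw [hd, hκ.2])]
  exact hc σ ⟨hσU, hd⟩

end EuclideanPolyhedralSpace

/-! ### The concave functions `-|l|` and positivity of their products. -/

namespace EuclideanPolyhedralSpace

variable {E : EuclideanPolyhedralSpace X N} {P Q : PolyhedralStructure X}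

variable (E) in
/-- The concave function `-|l|` on `X` defined by a linear function `l` on `N`. -/
def negAbs (l : N →ₗ[ℝ] ℝ) (x : X) : ℝ := -|l (E.ι x)|

theorem definedOn_negAbs (hQ : IsCompatible Q E.ι) {l : N →ₗ[ℝ] ℝ}
    (hl : ∀ κ ∈ Q.cells, (∀ x ∈ κ, 0 ≤ l (E.ι x)) ∨ ∀ x ∈ κ, l (E.ι x) ≤ 0) (U : Set X) :
    Q.DefinedOn U (E.negAbs l) := by
  intro κ hκ
  rcases hl κ hκ.1 with h | h
  · refine ⟨_, pullFuns_mem hQ hκ.1 (-l), fun x hx _ => ?_⟩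
    simp [negAbs, abs_of_nonneg (h x hx)]
  · refine ⟨_, pullFuns_mem hQ hκ.1 l, fun x hx _ => ?_⟩
    simp [negAbs, abs_of_nonpos (h x hx)]

variable [FiniteDimensional ℝ N]

/-- For `|s| ≤ 1` one has `-|l| ≤ -s * l`, with equality at `x`, so slopes compare along a short
move from `x`. Where `l` vanishes, both `s = 1` and `s = -1` are allowed. -/
theorem linearPart_negAbs_le (hP : IsCompatible P E.ι) {V : Set X} (hV : IsOpen V)
    {l : N →ₗ[ℝ] ℝ} (hf : P.DefinedOn V (E.negAbs l)) {σ τ : Set X} (h : P.IsFacet σ τ)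
    {x : X} (hx : x ∈ E.relint τ) (hxV : x ∈ V) {s : ℝ} (hs : |s| ≤ 1)
    (hsx : s * l (E.ι x) = |l (E.ι x)|) :
    E.linearPart V (E.negAbs l) σ (E.unitNormal σ τ) ≤ -(s * l (E.unitNormal σ τ)) := by
  have hxσ := h.subset hx.1
  have hσ : σ ∈ P.restrict V := ⟨h.cell, x, hxσ, hxV⟩
  obtain ⟨ε, hε, H⟩ := exists_germ hP h hx
  obtain ⟨δ, hδ, K⟩ := exists_forall_smul_mem hP h.cell hxσ (hV.mem_nhds hxV) (E.unitNormal σ τ)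
  have ht : 0 < min ε δ := by positivity
  set t := min ε δ
  obtain ⟨z, hz, hz'⟩ := H t ht (min_le_left _ _)
  have hzV := K t ht.le (min_le_right _ _) z hz.1 hz'
  have h1 := linearPart_spec hP hf hσ hz.1 hzV
  have h2 := linearPart_spec hP hf hσ hxσ hxV
  rw [hz', map_add, map_smul, ← h2, negAbs, negAbs, hz', map_add, map_smul, smul_eq_mul,
    smul_eq_mul, ← hsx] at h1
  set r := l (E.ι x) + t * l (E.unitNormal σ τ) with hr
  have h3 : s * r ≤ |r| := by
    calc s * r ≤ |s * r| := le_abs_self _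
      _ = |s| * |r| := abs_mul _ _
      _ ≤ 1 * |r| := mul_le_mul_of_nonneg_right hs (abs_nonneg _)
      _ = |r| := one_mul _
  have h4 : t * E.linearPart V (E.negAbs l) σ (E.unitNormal σ τ) ≤
      t * -(s * l (E.unitNormal σ τ)) := by
    rw [hr] at h3 h1
    linarith
  exact le_of_mul_le_mul_left h4 ht

/-- Around `τ` the function lies below the linear function `-s * l` and touches it on `τ`. Replacing
slopes by those of the linear function bounds the product from below by a balancing sum, which is
zero. -/
theorem isConcave_negAbs {U : Set X} {l : N →ₗ[ℝ] ℝ} (h : E.IsPiecewiseAffine U (E.negAbs l)) :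
    E.IsConcavePiecewiseAffine U (E.negAbs l) := by
  classical
  refine ⟨h, fun V hV hVU P hP hf k c hc => ?_⟩
  refine ⟨isMinkowskiWeight_product hP.2 hV hf hc.1, ?_⟩
  rintro τ ⟨hτ, hd⟩
  obtain ⟨y, hy, hyV⟩ := hτ.2
  obtain ⟨x, hx, hxV⟩ := exists_mem_relint_inter hP.2 hτ.1 hy (hV.mem_nhds hyV)
  obtain ⟨s, hs, hsx⟩ : ∃ s : ℝ, |s| ≤ 1 ∧ s * l (E.ι x) = |l (E.ι x)| := by
    rcases le_total 0 (l (E.ι x)) with h | h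
    · exact ⟨1, by simp, by rw [abs_of_nonneg h, one_mul]⟩
    · exact ⟨-1, by simp, by rw [abs_of_nonpos h, neg_one_mul]⟩
  have hbal := hc.1 τ hτ (by omega)
  rw [PolyhedralStructure.finsum_cofacets hτ hx.1] at hbal
  rw [product, PolyhedralStructure.finsum_cofacets hτ hx.1, neg_nonneg]
  calc _ ≤ ∑ σ ∈ (P.cellsAt x).filter (fun σ => P.IsFacet σ τ),
        c σ * -(s * l (E.unitNormal σ τ)) := by
        refine Finset.sum_le_sum fun σ hσ => ?_
        have hf' := (Finset.mem_filter.1 hσ).2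
        refine mul_le_mul_of_nonneg_left (linearPart_negAbs_le hP.2 hV hf hf' hx hxV hs hsx)
          (hc.2 σ ⟨⟨hf'.cell, x, hf'.subset hx.1, hxV⟩, by rw [hf'.dim_eq, hd]⟩)
    _ = -s * l (∑ σ ∈ (P.cellsAt x).filter (fun σ => P.IsFacet σ τ),
        c σ • E.unitNormal σ τ) := by
        rw [map_sum, Finset.mul_sum]
        refine Finset.sum_congr rfl fun σ _ => ?_
        rw [map_smul, smul_eq_mul]
        ring
    _ = 0 := by rw [hbal]; simp
    _ ≤ 0 := le_rfl

omit [FiniteDimensional ℝ N] in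
theorem isPositive_iteratedProduct {U : Set X} (hU : IsOpen U) (hQ : E.IsComplex Q) {n : ℕ}
    {w : Set X → ℝ} (hw : E.IsPositiveMinkowskiWeight Q U n w) (fs : List (X → ℝ))
    (hfs : ∀ f ∈ fs, E.IsConcavePiecewiseAffine U f ∧ Q.DefinedOn U f) {k : ℕ}
    (hk : k + fs.length = n) :
    E.IsPositiveMinkowskiWeight Q U k (E.iteratedProduct Q U fs w) := by
  induction fs generalizing k with
  | nil =>
    simp only [List.length_nil, add_zero] at hk
    subst hk
    exact hw
  | cons f fs ih =>
    have h1 := ih (fun g hg => hfs g (List.mem_cons_of_mem _ hg)) (k := k + 1)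
      (by simp only [List.length_cons] at hk; omega)
    obtain ⟨h2, h3⟩ := hfs f List.mem_cons_self
    exact h2.2 U hU subset_rfl Q hQ h3 k _ h1

/-- The vectors of `D` on which all functions of a list vanish. -/
def commonKer (D : Submodule ℝ N) : List (N →ₗ[ℝ] ℝ) → Submodule ℝ N
  | [] => D
  | l :: ls => commonKer D ls ⊓ LinearMap.ker l

/-- The functions of the list are linearly independent on `D`. -/
def IndepOn (D : Submodule ℝ N) : List (N →ₗ[ℝ] ℝ) → Prop
  | [] => True
  | l :: ls => IndepOn D ls ∧ ∃ w ∈ commonKer D ls, l w ≠ 0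

omit [FiniteDimensional ℝ N] in
theorem mem_commonKer {D : Submodule ℝ N} {ls : List (N →ₗ[ℝ] ℝ)} {w : N} :
    w ∈ commonKer D ls ↔ w ∈ D ∧ ∀ l ∈ ls, l w = 0 := by
  induction ls with
  | nil => simp [commonKer]
  | cons l ls ih =>
    rw [commonKer, Submodule.mem_inf, ih, LinearMap.mem_ker, List.forall_mem_cons]
    tauto

theorem finrank_commonKer {D : Submodule ℝ N} {ls : List (N →ₗ[ℝ] ℝ)} (h : IndepOn D ls) :
    Module.finrank ℝ (commonKer D ls) + ls.length = Module.finrank ℝ D := by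
  induction ls with
  | nil => rfl
  | cons l ls ih =>
    obtain ⟨h1, w, hw, hlw⟩ := h
    have h2 := ih h1
    have h3 := finrank_inf_ker_add_one hw hlw
    rw [commonKer, List.length_cons]
    omega

/-- While the common kernel has dimension above one, it contains some `w` outside the line of `u`,
and a functional kills `u` but not `w`. Subtracting a multiple of `height` makes it vanish at `ι y`
without changing it on directions. -/
theorem exists_indepOn {σ : Set X} {u : N} (hu : u ∈ E.dir σ) (y : X) {m : ℕ}
    (hm : m + 1 ≤ Module.finrank ℝ (E.dir σ)) :
    ∃ ls : List (N →ₗ[ℝ] ℝ), ls.length = m ∧ IndepOn (E.dir σ) ls ∧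
      ∀ l ∈ ls, l u = 0 ∧ l (E.ι y) = 0 := by
  induction m with
  | zero => exact ⟨[], rfl, trivial, by simp⟩
  | succ m ih =>
    obtain ⟨ls, hlen, hind, hls⟩ := ih (by omega)
    have h1 := finrank_commonKer hind
    obtain ⟨w, hw, hwu⟩ : ∃ w ∈ commonKer (E.dir σ) ls, w ∉ Submodule.span ℝ {u} := by
      by_contra! h
      have h2 := Submodule.finrank_mono
        (show commonKer (E.dir σ) ls ≤ Submodule.span ℝ {u} from h)
      have h3 := finrank_span_le_card (R := ℝ) ({u} : Set N)
      simp only [Set.toFinset_singleton, Finset.card_singleton] at h3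
      omega
    obtain ⟨l, hlw, hker⟩ := Submodule.exists_le_ker_of_notMem hwu
    have hlu : l u = 0 := hker (Submodule.mem_span_singleton_self u)
    refine ⟨(l - l (E.ι y) • E.height) :: ls, by simp [hlen], ⟨hind, w, hw, ?_⟩, ?_⟩
    · simpa [height_dir (mem_commonKer.1 hw).1] using hlw
    · intro l' hl'
      rcases List.mem_cons.1 hl' with rfl | hl'
      · simp [hlu, height_dir hu]
      · exact hls l' hl'

omit [FiniteDimensional ℝ N] in
theorem eq_zero_of_mem_relint {κ : Set X} {l : N →ₗ[ℝ] ℝ}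
    (hl : (∀ x ∈ κ, 0 ≤ l (E.ι x)) ∨ ∀ x ∈ κ, l (E.ι x) ≤ 0) {p : X} (hp : p ∈ E.relint κ)
    (h0 : l (E.ι p) = 0) : ∀ x ∈ κ, l (E.ι x) = 0 := by
  rcases hl with h | h
  · exact hp.2 l h h0
  · intro x hx
    have := hp.2 (-l) (fun x hx => by simpa using h x hx) (by simp [h0]) x hx
    simpa using this

/-- Positivity of an iterated product of functions `-|l|` on the common zero set of the `l`. -/
theorem iteratedProduct_pos {U : Set X} (hU : IsOpen U) (hP : E.IsComplex P) (hQ : E.IsComplex Q)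
    (hQP : Q.IsSubdivision P) {n : ℕ} {w : Set X → ℝ} (hw : E.IsPositiveMinkowskiWeight Q U n w)
    (hpos : ∀ κ ∈ Q.restrictDim U n, 0 < w κ) {σ : Set X} (hσ : σ ∈ P.cells) (hdσ : P.dim σ = n)
    (ls : List (N →ₗ[ℝ] ℝ)) (hind : IndepOn (E.dir σ) ls)
    (hsign : ∀ l ∈ ls, ∀ κ ∈ Q.cells, (∀ x ∈ κ, 0 ≤ l (E.ι x)) ∨ ∀ x ∈ κ, l (E.ι x) ≤ 0)
    {κ : Set X} (hκ : κ ∈ Q.cells) {p : X} (hp : p ∈ E.relint κ) (hpU : p ∈ U)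
    (hpσ : p ∈ E.relint σ) (hlp : ∀ l ∈ ls, l (E.ι p) = 0) (hd : Q.dim κ + ls.length = n) :
    0 < E.iteratedProduct Q U (ls.map E.negAbs) w κ := by
  classical
  induction ls generalizing κ p with
  | nil => exact hpos κ ⟨⟨hκ, p, hp.1, hpU⟩, by simpa using hd⟩
  | cons l ls ih =>
    obtain ⟨hind, v, hv, hlv⟩ := hind
    obtain ⟨hvσ, hvls⟩ := mem_commonKer.1 hv
    simp only [List.length_cons] at hd
    have hlκ := eq_zero_of_mem_relint (hsign l List.mem_cons_self κ hκ) hp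
      (hlp l List.mem_cons_self)
    obtain ⟨V, hVU, hVo, hpV, hV⟩ := Q.exists_isOpen_forall_mem (hU.mem_nhds hpU)
    -- Along `v` the functions of `ls` stay zero while `l` does not. The carrier of the new point
    -- `z` therefore has larger dimension than `κ`, and at most one more since `ls` vanishes on it.
    -- It is a cofacet to which the induction hypothesis applies at the new base point `z`.
    obtain ⟨ε, hε, H⟩ := (isPoly_of_mem hP.2 hσ).exists_extend_relint hpσ hvσ
    obtain ⟨δ, hδ, K⟩ := exists_forall_smul_mem hP.2 hσ hpσ.1 (hVo.mem_nhds hpV) v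
    have ht : 0 < min ε δ := by positivity
    set t := min ε δ
    obtain ⟨z, hz, hz'⟩ := H t ht.le (min_le_left _ _)
    have hzV := K t ht.le (min_le_right _ _) z hz.1 hz'
    have hκ' := Q.carrier_mem z
    have hzκ' : z ∈ E.relint (Q.carrier z) := mem_relint_carrier hQ.2 z
    set κ' := Q.carrier z
    have hsub : κ ⊆ κ' := subset_of_mem_relint hQ.2 hκ' hκ hp (hV _ hκ' ⟨z, hzκ'.1, hzV⟩)
    have hκσ : κ' ⊆ σ := by
      have := subset_carrier hP.2 hQP hκ' hzκ'
      rwa [carrier_eq hP.2 hσ hz] at this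
    have hlz : l (E.ι z) ≠ 0 := by
      rw [hz', map_add, map_smul, hlp l List.mem_cons_self, zero_add, smul_eq_mul]
      exact mul_ne_zero ht.ne' hlv
    have hlsz : ∀ l' ∈ ls, l' (E.ι z) = 0 := fun l' hl' => by
      rw [hz', map_add, map_smul, hlp l' (List.mem_cons_of_mem _ hl'), hvls l' hl']
      simp
    have hzκ : z ∉ κ := fun h => hlz (hlκ z h)
    have d1 := dim_lt_of_notMem hQ.2 hκ' hκ hsub hzκ'.1 hzκ
    have d2 : Q.dim κ' + ls.length ≤ n := by
      have hle : E.dir κ' ≤ commonKer (E.dir σ) ls := fun u hu => by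
        refine mem_commonKer.2 ⟨dir_mono hκσ hu, fun l' hl' => ?_⟩
        exact apply_eq_zero_of_subset_zeroSet (eq_zero_of_mem_relint
          (hsign l' (List.mem_cons_of_mem _ hl') κ' hκ') hzκ' (hlsz l' hl')) hu
      have h1 := Submodule.finrank_mono hle
      have h2 := finrank_commonKer hind
      rw [← dim_eq hP.2 hσ, hdσ] at h2
      rw [dim_eq hQ.2 hκ']
      omega
    have hf : Q.IsFacet κ' κ := ⟨hκ', hκ, hsub, by omega⟩
    have hc' := ih hind (fun l' hl' => hsign l' (List.mem_cons_of_mem _ hl')) hκ' hzκ' (hVU hzV) hz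
      hlsz (by omega)
    have hdef : ∀ l' ∈ l :: ls, Q.DefinedOn U (E.negAbs l') := fun l' hl' =>
      definedOn_negAbs hQ.2 (hsign l' hl') U
    have hcpos := isPositive_iteratedProduct hU hQ hw (ls.map E.negAbs) (fun f hf => by
      obtain ⟨l', hl', rfl⟩ := List.mem_map.1 hf
      have := hdef l' (List.mem_cons_of_mem _ hl')
      exact ⟨isConcave_negAbs ⟨Q, hQ, this⟩, this⟩) (k := Q.dim κ + 1)
      (by rw [List.length_map]; omega)
    change 0 < E.product Q U (E.negAbs l) (E.iteratedProduct Q U (ls.map E.negAbs) w) κ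
    set c := E.iteratedProduct Q U (ls.map E.negAbs) w
    have hκU : κ ∈ Q.restrict U := ⟨hκ, p, hp.1, hpU⟩
    rw [product, PolyhedralStructure.finsum_cofacets hκU hp.1, ← Finset.sum_neg_distrib]
    have hlp0 := hlp l List.mem_cons_self
    -- As `l` vanishes at `p`, both signs of `s` are allowed, which bounds every slope by minus an
    -- absolute value. All terms are then nonnegative, and the one of `κ'` is positive.
    have hbound : ∀ {ρ}, Q.IsFacet ρ κ →
        E.linearPart U (E.negAbs l) ρ (E.unitNormal ρ κ) ≤ -|l (E.unitNormal ρ κ)| := fun {ρ} h => by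
      have key := fun s hs => linearPart_negAbs_le hQ.2 hU (hdef l List.mem_cons_self) h hp hpU
        (s := s) hs (by rw [hlp0]; simp)
      rcases le_total 0 (l (E.unitNormal ρ κ)) with h | h
      · simpa [abs_of_nonneg h] using key 1 (by simp)
      · simpa [abs_of_nonpos h] using key (-1) (by simp)
    have hcn : ∀ {ρ}, Q.IsFacet ρ κ → 0 ≤ c ρ := fun h =>
      hcpos.2 _ ⟨⟨h.cell, p, h.subset hp.1, hpU⟩, h.dim_eq⟩
    refine Finset.sum_pos' (fun ρ hρ => ?_) ⟨κ', ?_, ?_⟩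
    · have h := (Finset.mem_filter.1 hρ).2
      have h1 := hbound h
      have h2 := abs_nonneg (l (E.unitNormal ρ κ))
      have h3 := hcn h
      rw [← mul_neg]
      exact mul_nonneg h3 (by linarith)
    · exact Finset.mem_filter.2 ⟨PolyhedralStructure.mem_cellsAt.2 ⟨hκ', hsub hp.1⟩, hf⟩
    · have h1 := hbound hf
      have h2 : l (E.unitNormal κ' κ) ≠ 0 := fun h0 => hlz (by
        obtain ⟨u1, u2, u3, -⟩ := isUnitNormal_iff.1 (isUnitNormal_unitNormal hQ.2 hf)
        have h3 := apply_eq_zero_of_subset_zeroSet hlκ (sub_inner_smul_mem (dir_mono hsub)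
          (finrank_dir_facet hQ.2 hf) u2 u1 u3 (sub_mem_dir hzκ'.1 (hsub hp.1)))
        rw [map_sub, map_smul, h0, map_sub, hlp0] at h3
        simpa using h3)
      have h3 := abs_pos.2 h2
      rw [← mul_neg]
      exact mul_pos hc' (by linarith)

end EuclideanPolyhedralSpace

/-! ### Propagation of a minimum along segments and the local dichotomy. -/

theorem sum_equivFin {κ M : Type*} [AddCommMonoid M] (T : Finset κ) (F : κ → M) :
    ∑ i : Fin T.card, F (T.equivFin.symm i) = ∑ a ∈ T, F a :=
  (T.equivFin.symm.sum_comp fun a : T => F a).trans (Finset.sum_coe_sort T F)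

namespace EuclideanPolyhedralSpace

variable {E : EuclideanPolyhedralSpace X N}

theorem dir_singleton (y : X) : E.dir {y} = ⊥ := by
  rw [dir, Set.image_singleton, vectorSpan_singleton]

theorem isMinkowskiWeight_mul {P : PolyhedralStructure X} {U : Set X} {k : ℕ} {c : Set X → ℝ}
    (hc : E.IsMinkowskiWeight P U k c) (a : ℝ) :
    E.IsMinkowskiWeight P U k fun σ => a * c σ := by
  classical
  intro τ hτ hk
  obtain ⟨x, hx⟩ := (P.isPolyhedron τ hτ.1).nonempty
  have h := hc τ hτ hk
  rw [PolyhedralStructure.finsum_cofacets hτ hx] at h ⊢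
  simp only [mul_smul, ← Finset.smul_sum, h, smul_zero]

variable [FiniteDimensional ℝ N]

variable (E) in
/-- The coordinate functions of `N`, made to vanish at `ι y`. -/
def coordsAt (y : X) : List (N →ₗ[ℝ] ℝ) :=
  List.ofFn fun i => (Module.finBasis ℝ N).coord i -
    (Module.finBasis ℝ N).coord i (E.ι y) • E.height

theorem apply_coordsAt {y : X} {l : N →ₗ[ℝ] ℝ} (hl : l ∈ E.coordsAt y) : l (E.ι y) = 0 := by
  obtain ⟨i, rfl⟩ := (List.mem_ofFn' _ _).1 hl
  simp

theorem ι_eq_of_coordsAt {y z : X} (h : ∀ l ∈ E.coordsAt y, l (E.ι z) = 0) : E.ι z = E.ι y := by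
  refine (Module.finBasis ℝ N).ext_elem fun i => ?_
  have := h _ ((List.mem_ofFn' _ _).2 ⟨i, rfl⟩)
  simpa [sub_eq_zero] using this

/-- A minimum propagates along a short segment through the interior of a top-dimensional
polyhedron. -/
theorem BalancingCondition.WeaklyConcave.eq_of_segment {n : ℕ} (hn : E.HasPureDimension n)
    {U : Set X} (hU : IsOpen U) {β : E.BalancingCondition n U} {f : X → ℝ}
    (hf : β.WeaklyConcave f) {y x : X} (hmin : ∀ z ∈ U, f y ≤ f z) (hy : y ∈ U) (hne : x ≠ y)
    {σ : Set X} (hσ : σ ∈ β.complex.cells) (hd : β.complex.dim σ = n) (hyσ : y ∈ σ) (hxσ : x ∈ σ)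
    (hrel : y ∈ E.relint σ ∨ x ∈ E.relint σ) {G : List (N →ₗ[ℝ] ℝ)}
    (hGy : ∀ g ∈ G, 0 < g (E.ι y)) (hGx : ∀ g ∈ G, 0 < g (E.ι x))
    (hstar : ∀ κ ∈ β.complex.cells, y ∈ κ → ∀ z ∈ κ, (∀ g ∈ G, 0 ≤ g (E.ι z)) → z ∈ U) :
    f x = f y := by
  classical
  have hB := β.isComplex
  set B := β.complex with hBdef
  have hιne : E.ι x ≠ E.ι y := fun h => hne ((hB.2 σ hσ).2 hxσ hyσ h)
  -- the midpoint of the segment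
  obtain ⟨p, hp, hιp⟩ := (isPoly_of_mem hB.2 hσ).exists_combo hyσ hxσ (t := 1 / 2) (by norm_num)
    (by norm_num)
  have hpσ : p ∈ E.relint σ := by
    rcases hrel with h | h
    · exact mem_relint_of_combo h hxσ hp (by norm_num) (by norm_num) hιp
    · refine mem_relint_of_combo h hyσ hp (t := 1 / 2) (by norm_num) (by norm_num) ?_
      rw [hιp]; module
  have hlp : ∀ l : N →ₗ[ℝ] ℝ, l (E.ι p) = (l (E.ι y) + l (E.ι x)) / 2 := fun l => by
    rw [hιp]; simp only [map_add, map_smul, map_sub, smul_eq_mul]; ring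
  have hGp : ∀ g ∈ G, 0 < g (E.ι p) := fun g hg => by
    rw [hlp]; linarith [hGy g hg, hGx g hg]
  have hpU : p ∈ U := hstar σ hσ hyσ p hp fun g hg => (hGp g hg).le
  -- functions cutting out the line through `x` and `y`
  have hu := sub_mem_dir hxσ hyσ (E := E)
  have hu0 : E.ι x - E.ι y ≠ 0 := sub_ne_zero.2 hιne
  have hfin : Module.finrank ℝ (E.dir σ) = n := by rw [← dim_eq hB.2 hσ, hd]
  have hn1 : 1 ≤ n := by
    rw [← hfin, Nat.one_le_iff_ne_zero]
    intro h0
    rw [Submodule.finrank_eq_zero.1 h0] at hu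
    exact hu0 ((Submodule.mem_bot ℝ).1 hu)
  obtain ⟨ls, hlen, hind, hls⟩ := exists_indepOn hu y (m := n - 1) (by omega)
  -- the subdivision
  obtain ⟨Q, hQ, hQB, hsign, hsat⟩ := exists_subdivision hB (G ++ (E.coordsAt y ++ ls))
  have hsignG : ∀ g ∈ G, ∀ κ ∈ Q.cells, (∀ x ∈ κ, 0 ≤ g (E.ι x)) ∨ ∀ x ∈ κ, g (E.ι x) ≤ 0 :=
    fun g hg => hsign g (by simp [hg])
  have hsignC : ∀ l ∈ E.coordsAt y, ∀ κ ∈ Q.cells,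
      (∀ x ∈ κ, 0 ≤ l (E.ι x)) ∨ ∀ x ∈ κ, l (E.ι x) ≤ 0 := fun l hl => hsign l (by simp [hl])
  have hsignL : ∀ l ∈ ls, ∀ κ ∈ Q.cells, (∀ x ∈ κ, 0 ≤ l (E.ι x)) ∨ ∀ x ∈ κ, l (E.ι x) ≤ 0 :=
    fun l hl => hsign l (by simp [hl])
  have hvanish : ∀ l ∈ E.coordsAt y ++ ls, l (E.ι y) = 0 := fun l hl => by
    rcases List.mem_append.1 hl with h | h
    · exact apply_coordsAt h
    · exact (hls l h).2
  set ρ := Q.carrier p with hρdef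
  have hρ : ρ ∈ Q.cells := Q.carrier_mem p
  have hpρ : p ∈ E.relint ρ := mem_relint_carrier hQ.2 p
  have hρσ : ρ ⊆ σ := by
    have := subset_carrier hB.2 hQB hρ hpρ
    rwa [carrier_eq hB.2 hσ hpσ] at this
  -- The subdivision is no finer than the signs require: every weak sign condition satisfied at the
  -- midpoint `p` holds at both endpoints, so they lie in its carrier.
  have hyρ : y ∈ ρ := by
    refine hsat ρ hρ p hpρ.1 y
      (fun κ hκ h => subset_of_mem_relint hB.2 hκ hσ hpσ h hyσ) fun l hl => ?_
    rcases List.mem_append.1 hl with h | h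
    · exact ⟨fun _ => (hGy l h).le, fun h' => absurd h' (not_le.2 (hGp l h))⟩
    · rw [hvanish l h]
      exact ⟨fun _ => le_rfl, fun _ => le_rfl⟩
  have hxρ : x ∈ ρ := by
    refine hsat ρ hρ p hpρ.1 x
      (fun κ hκ h => subset_of_mem_relint hB.2 hκ hσ hpσ h hxσ) fun l hl => ?_
    rcases List.mem_append.1 hl with h | h
    · exact ⟨fun _ => (hGx l h).le, fun h' => absurd h' (not_le.2 (hGp l h))⟩
    · rw [hlp, hvanish l h]
      exact ⟨fun h => by linarith, fun h => by linarith⟩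
  -- the vertex `y`
  have hycell : ({y} : Set X) ∈ Q.cells := by
    have : Q.carrier y = {y} := by
      refine Set.Subset.antisymm (fun z hz => ?_) (by simpa using Q.mem_carrier y)
      refine (hQ.2 _ (Q.carrier_mem y)).2 hz (Q.mem_carrier y) (ι_eq_of_coordsAt fun l hl => ?_)
      exact eq_zero_of_mem_relint (hsignC l hl _ (Q.carrier_mem y)) (mem_relint_carrier hQ.2 y)
        (apply_coordsAt hl) z hz
    rw [← this]
    exact Q.carrier_mem y
  have hyU : ({y} : Set X) ∈ Q.restrict U := ⟨hycell, y, rfl, hy⟩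
  have hdy : Q.dim {y} = 0 := by rw [dim_eq hQ.2 hycell, dir_singleton, finrank_bot]
  have hdρ : Q.dim ρ = 1 := by
    have h1 := dim_lt_of_notMem hQ.2 hρ hycell (by simpa using hyρ) hxρ (by simpa using hne)
    -- All functions of `ls` vanish on `ρ`, which leaves only the direction of the line.
    have hle : E.dir ρ ≤ commonKer (E.dir σ) ls := fun v hv => by
      refine mem_commonKer.2 ⟨dir_mono hρσ hv, fun l hl => ?_⟩
      refine apply_eq_zero_of_subset_zeroSet (eq_zero_of_mem_relint (hsignL l hl ρ hρ) hpρ ?_) hv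
      have h2 := (hls l hl).1
      rw [map_sub, (hls l hl).2, sub_zero] at h2
      rw [hlp, (hls l hl).2, h2]; norm_num
    have h2 := Submodule.finrank_mono hle
    have h3 := finrank_commonKer hind
    rw [← dim_eq hQ.2 hρ] at h2
    omega
  have hρf : Q.IsFacet ρ {y} := ⟨hρ, hycell, by simpa using hyρ, by omega⟩
  -- the weight
  set w := B.pullback Q U β.weight with hw
  have hwpos : ∀ κ ∈ Q.restrictDim U n, 0 < w κ := fun κ hκ =>
    pullback_pos hn hB hQ hQB β.pos hκ
  have hwmink : E.IsPositiveMinkowskiWeight Q U n w :=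
    ⟨isMinkowskiWeight_pullback hn hB hQ hQB β.isMinkowskiWeight, fun κ hκ => (hwpos κ hκ).le⟩
  set c := E.iteratedProduct Q U (ls.map E.negAbs) w with hc
  have hconc : ∀ g ∈ ls.map E.negAbs, E.IsConcavePiecewiseAffine U g ∧ Q.DefinedOn U g := by
    intro g hg
    obtain ⟨l, hl, rfl⟩ := List.mem_map.1 hg
    have := definedOn_negAbs hQ.2 (hsignL l hl) U
    exact ⟨isConcave_negAbs ⟨Q, hQ, this⟩, this⟩
  have hcpos : E.IsPositiveMinkowskiWeight Q U 1 c :=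
    isPositive_iteratedProduct hU hQ hwmink _ hconc (by rw [List.length_map]; omega)
  have hcρ : 0 < c ρ :=
    iteratedProduct_pos hU hB hQ hQB hwmink hwpos hσ hd ls hind hsignL hρ hpρ hpU hpσ
      (fun l hl => by
        have h2 := (hls l hl).1
        rw [map_sub, (hls l hl).2, sub_zero] at h2
        rw [hlp, (hls l hl).2, h2]; norm_num) (by omega)
  -- the edges at `y`
  set T := (Q.cellsAt y).filter fun κ => Q.IsFacet κ {y} with hT
  have hTf : ∀ {κ}, κ ∈ T ↔ Q.IsFacet κ {y} := fun {κ} => by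
    rw [hT, Finset.mem_filter, PolyhedralStructure.mem_cellsAt]
    exact ⟨fun h => h.2, fun h => ⟨⟨h.cell, h.subset rfl⟩, h⟩⟩
  -- Functions of `G` are positive at `y` and do not change sign on polyhedra of `Q`, so edges at
  -- `y` stay within the cube described by `G`.
  have hTU : ∀ κ ∈ T, κ ⊆ U := fun κ hκ z hz => by
    have h := hTf.1 hκ
    obtain ⟨μ, hμ, hsub, -⟩ := hQB κ h.cell
    refine hstar μ hμ (hsub (h.subset rfl)) z (hsub hz) fun g hg => ?_
    rcases hsignG g hg κ h.cell with h' | h'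
    · exact h' z hz
    · exact absurd (h' y (h.subset rfl)) (not_le.2 (hGy g hg))
  have hpt : ∀ κ ∈ T, ∃ z ∈ κ, z ≠ y ∧ (κ = ρ → z = x) := fun κ hκ => by
    by_cases h : κ = ρ
    · exact ⟨x, h ▸ hxρ, hne, fun _ => rfl⟩
    · obtain ⟨z, hz, hzy⟩ := (hTf.1 hκ).exists_notMem
      exact ⟨z, hz, by simpa using hzy, fun h' => absurd h' h⟩
  have : Nonempty X := ⟨y⟩
  choose! pt hpt1 hpt2 hpt3 using hpt
  have hcT : ∀ κ ∈ T, 0 ≤ c κ := fun κ hκ => by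
    have h := hTf.1 hκ
    exact hcpos.2 κ ⟨⟨h.cell, y, h.subset rfl, hy⟩, by rw [h.dim_eq, hdy]⟩
  have hdpos : ∀ κ ∈ T, 0 < ‖E.ι (pt κ) - E.ι y‖ := fun κ hκ => by
    have h := hTf.1 hκ
    refine norm_pos_iff.2 (sub_ne_zero.2 fun h' => hpt2 κ hκ ?_)
    exact (hQ.2 κ h.cell).2 (hpt1 κ hκ) (h.subset rfl) h'
  have hvec : ∀ κ ∈ T, E.ι (pt κ) - E.ι y =
      ‖E.ι (pt κ) - E.ι y‖ • E.unitNormal κ {y} := fun κ hκ => by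
    have h := hTf.1 hκ
    obtain ⟨v1, v2, v3, v4⟩ := isUnitNormal_iff.1 (isUnitNormal_unitNormal hQ.2 h)
    have h1 := eq_inner_smul (dir_mono h.subset) (finrank_dir_facet hQ.2 h) v2 v1 v3
      (sub_mem_dir (hpt1 κ hκ) (h.subset rfl)) (fun z hz => by
        rw [dir_singleton] at hz
        rw [(Submodule.mem_bot ℝ).1 hz, inner_zero_left])
    have h2 := v4 _ (hpt1 κ hκ) y rfl
    have h3 : ‖E.ι (pt κ) - E.ι y‖ = ⟪E.unitNormal κ {y}, E.ι (pt κ) - E.ι y⟫_ℝ := by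
      conv_lhs => rw [h1]
      rw [norm_smul, v1, mul_one, Real.norm_of_nonneg h2]
    rw [h3]
    exact h1
  have hρT : ρ ∈ T := hTf.2 hρf
  set s := ∑ κ ∈ T, c κ / ‖E.ι (pt κ) - E.ι y‖ with hs
  have hspos : 0 < s :=
    Finset.sum_pos' (fun κ hκ => div_nonneg (hcT κ hκ) (norm_nonneg _))
      ⟨ρ, hρT, div_pos hcρ (hdpos ρ hρT)⟩
  -- Dividing the weight by the edge length turns balancing at `y` into a barycentre identity. The
  -- normalisation by `s` makes `s⁻¹ * c` the `β`-positive weight of the combination.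
  set ν : Set X → ℝ := fun κ => s⁻¹ * c κ / ‖E.ι (pt κ) - E.ι y‖ with hν
  have hν0 : ∀ κ ∈ T, 0 ≤ ν κ := fun κ hκ =>
    div_nonneg (mul_nonneg (inv_nonneg.2 hspos.le) (hcT κ hκ)) (norm_nonneg _)
  have hνd : ∀ κ ∈ T, ν κ * ‖E.ι (pt κ) - E.ι y‖ = s⁻¹ * c κ := fun κ hκ =>
    div_mul_cancel₀ _ (hdpos κ hκ).ne'
  have hνsum : ∑ κ ∈ T, ν κ = 1 := by
    simp only [hν, mul_div_assoc]
    rw [← Finset.mul_sum, ← hs, inv_mul_cancel₀ hspos.ne']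
  have hνι : ∑ κ ∈ T, ν κ • E.ι (pt κ) = E.ι y := by
    have h1 : ∀ κ ∈ T, ν κ • E.ι (pt κ) = ν κ • E.ι y + s⁻¹ • c κ • E.unitNormal κ {y} :=
      fun κ hκ => by
        have h2 : E.ι (pt κ) = E.ι y + ‖E.ι (pt κ) - E.ι y‖ • E.unitNormal κ {y} := by
          rw [← hvec κ hκ, add_sub_cancel]
        conv_lhs => rw [h2]
        rw [smul_add, smul_smul, hνd κ hκ, mul_smul]
    have h2 := hcpos.1 {y} hyU (by rw [hdy])
    rw [PolyhedralStructure.finsum_cofacets hyU (Set.mem_singleton y)] at h2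
    rw [Finset.sum_congr rfl h1, Finset.sum_add_distrib, ← Finset.sum_smul, hνsum, one_smul,
      ← Finset.smul_sum, h2, smul_zero, add_zero]
  have hcomb : β.IsBalancedCombination y (fun i => pt (T.equivFin.symm i))
      (fun i => ν (T.equivFin.symm i)) := by
    refine ⟨Q, {y}, fun i => T.equivFin.symm i, ?_, ?_, ?_, fun κ => s⁻¹ * c κ, ?_, ?_⟩
    · refine ⟨⟨hy, fun i => hTU _ (T.equivFin.symm i).2 (hpt1 _ (T.equivFin.symm i).2),
        fun i => hν0 _ (T.equivFin.symm i).2, (sum_equivFin T ν).trans hνsum,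
        (sum_equivFin T fun κ => ν κ • E.ι (pt κ)).trans hνι⟩, hQ, hycell, rfl,
        fun i => (hTf.1 (T.equivFin.symm i).2).cell, fun i => ?_,
        fun i => hTU _ (T.equivFin.symm i).2, fun i => hpt1 _ (T.equivFin.symm i).2⟩
      have h := hTf.1 (T.equivFin.symm i).2
      exact Q.isFaceOf_of_subset h.cell hycell h.subset
    · exact Subtype.val_injective.comp T.equivFin.symm.injective
    · ext κ
      have : κ ∈ Set.range (fun i => (T.equivFin.symm i : Set X)) ↔ κ ∈ T :=
        ⟨by rintro ⟨i, rfl⟩; exact (T.equivFin.symm i).2,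
          fun h => ⟨T.equivFin ⟨κ, h⟩, by simp⟩⟩
      rw [this, hTf, ← PolyhedralStructure.mem_cofacets_iff hyU]
      constructor
      · rintro ⟨⟨⟨h1, -⟩, h2⟩, h3⟩
        exact ⟨h1, h2, h3⟩
      · rintro ⟨h1, h2, h3⟩
        refine ⟨⟨⟨h1, y, ?_, hy⟩, h2⟩, h3⟩
        obtain ⟨m, -, -, hF⟩ := h3
        have hy' : y ∈ ({y} : Set X) := rfl
        rw [hF] at hy'
        exact hy'.1
    · rw [hdy, zero_add]
      -- A single product with coefficient `s⁻¹`; `Q` serves both as the complex and as the common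
      -- subdivision.
      refine ⟨isMinkowskiWeight_mul hcpos.1 _, 1, fun _ => s⁻¹, fun _ => ls.map E.negAbs, Q,
        one_pos, fun _ => inv_pos.2 hspos, fun _ => by rw [List.length_map]; omega,
        fun _ => hconc, hQ, ?_, hQB, fun κ hκ => ?_⟩
      · rw [isSubdivision_iff hQ.2 hQ.2]
        exact fun σ hσ => ⟨σ, hσ, subset_rfl⟩
      · rw [pullback_eq hQ.2 hQ.2 _ hκ.1.1 hκ.1 subset_rfl rfl]
        simp [hc, hw, hBdef]
    · intro i
      have h := hνd _ (T.equivFin.symm i).2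
      rw [span, Set.image_singleton, AffineSubspace.coe_affineSpan_singleton,
        Metric.infDist_singleton, dist_eq_norm]
      exact h
  have hle := hf _ _ _ _ hcomb
  rw [sum_equivFin T fun κ => ν κ * f (pt κ)] at hle
  have hsum : ∑ κ ∈ T, ν κ * (f (pt κ) - f y) ≤ 0 := by
    simp only [mul_sub, Finset.sum_sub_distrib]
    rw [← Finset.sum_mul, hνsum, one_mul]
    linarith
  have hterm : ∀ κ ∈ T, 0 ≤ ν κ * (f (pt κ) - f y) := fun κ hκ =>
    mul_nonneg (hν0 κ hκ) (sub_nonneg.2 (hmin _ (hTU κ hκ (hpt1 κ hκ))))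
  -- Nonnegative terms with nonpositive sum: the term of `ρ`, where the chosen point is `x`, is at
  -- most zero.
  have h1 := (Finset.single_le_sum hterm hρT).trans hsum
  rw [hpt3 ρ hρT rfl] at h1
  have hνρ : 0 < ν ρ := div_pos (mul_pos (inv_pos.2 hspos) hcρ) (hdpos ρ hρT)
  have h2 := hmin x (hstar σ hσ hyσ x hxσ fun g hg => (hGx g hg).le)
  nlinarith

/-- Small cubes around a point, described by linear inequalities. -/
theorem exists_cube (y : X) {δ : ℝ} (hδ : 0 < δ) :
    ∃ G : List (N →ₗ[ℝ] ℝ), (∀ g ∈ G, 0 < g (E.ι y)) ∧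
      ∀ z, (∀ g ∈ G, 0 ≤ g (E.ι z)) → ‖E.ι z - E.ι y‖ < δ := by
  set b := stdOrthonormalBasis ℝ N
  set d := Module.finrank ℝ N
  -- With `d` coordinates bounded by `r` the norm is at most `d * r`; the extra one makes this less
  -- than `δ` and covers `d = 0`.
  set r := δ / (d + 1) with hr
  have hr0 : 0 < r := by positivity
  let g : Fin d → N →ₗ[ℝ] ℝ := fun i =>
    b.toBasis.coord i - b.toBasis.coord i (E.ι y) • E.height
  refine ⟨List.ofFn (fun i => r • E.height + g i) ++ List.ofFn (fun i => r • E.height - g i),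
    fun l hl => ?_, fun z hz => ?_⟩
  · rcases List.mem_append.1 hl with h | h
    · obtain ⟨i, rfl⟩ := (List.mem_ofFn' _ _).1 h
      simpa [g] using hr0
    · obtain ⟨i, rfl⟩ := (List.mem_ofFn' _ _).1 h
      simpa [g] using hr0
  · have hg : ∀ i, g i (E.ι z) = b.toBasis.coord i (E.ι z - E.ι y) := fun i => by simp [g]
    have hle : ∀ i, |b.toBasis.coord i (E.ι z - E.ι y)| ≤ r := fun i => by
      have h1 := hz _ (List.mem_append_left _ ((List.mem_ofFn' _ _).2 ⟨i, rfl⟩))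
      have h2 := hz _ (List.mem_append_right _ ((List.mem_ofFn' _ _).2 ⟨i, rfl⟩))
      simp only [LinearMap.add_apply, LinearMap.sub_apply, LinearMap.smul_apply, height_ι,
        smul_eq_mul, mul_one, hg] at h1 h2
      exact abs_le.2 ⟨by linarith, by linarith⟩
    calc ‖E.ι z - E.ι y‖ = ‖∑ i, b.toBasis.coord i (E.ι z - E.ι y) • b.toBasis i‖ := by
          congr 1
          exact (b.toBasis.sum_repr _).symm
      _ ≤ ∑ i, ‖b.toBasis.coord i (E.ι z - E.ι y) • b.toBasis i‖ := norm_sum_le _ _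
      _ ≤ ∑ _i : Fin d, r := Finset.sum_le_sum fun i _ => by
          rw [norm_smul, Real.norm_eq_abs]
          have : ‖b.toBasis i‖ = 1 := by simp
          rw [this, mul_one]
          exact hle i
      _ = d * r := by simp
      _ < δ := by
          have : (d + 1) * r = δ := by rw [hr]; field_simp
          linarith

/-- Near every point, the minimum is attained everywhere or nowhere. -/
theorem BalancingCondition.WeaklyConcave.exists_nhds {n : ℕ} (hn : E.HasPureDimension n)
    {U : Set X} (hU : IsOpen U) {β : E.BalancingCondition n U} {f : X → ℝ}
    (hf : β.WeaklyConcave f) {m : ℝ} (hmin : ∀ z ∈ U, m ≤ f z) {y : X} (hy : y ∈ U) :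
    ∃ W ⊆ U, IsOpen W ∧ y ∈ W ∧ ∀ z ∈ W, f z = m → ∀ x ∈ W, f x = m := by
  have hB := β.isComplex
  set B := β.complex with hBdef
  obtain ⟨V, hVU, hVo, hyV, hV⟩ := B.exists_isOpen_forall_mem (hU.mem_nhds hy)
  obtain ⟨δ, hδ, hball⟩ : ∃ δ > 0, ∀ κ ∈ B.cellsAt y, ∀ z ∈ κ, ‖E.ι z - E.ι y‖ < δ → z ∈ V := by
    have h1 : ∀ᶠ δ in nhdsWithin (0 : ℝ) (Set.Ioi 0),
        ∀ κ ∈ B.cellsAt y, ∀ z ∈ κ, ‖E.ι z - E.ι y‖ < δ → z ∈ V := by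
      rw [Filter.eventually_all_finset]
      intro κ hκ
      obtain ⟨hκ, hyκ⟩ := PolyhedralStructure.mem_cellsAt.1 hκ
      obtain ⟨δ, hδ, H⟩ := exists_forall_norm_lt_mem hB.2 hκ hyκ (hVo.mem_nhds hyV)
      filter_upwards [Ioo_mem_nhdsGT hδ] with ε hε z hz hzy
      exact H z hz (hzy.trans hε.2)
    obtain ⟨δ, h, hδ⟩ := (h1.and self_mem_nhdsWithin).exists
    exact ⟨δ, hδ, h⟩
  obtain ⟨G, hGy, hG⟩ := exists_cube (E := E) y hδ
  set W : Set X := V ∩ ⋂ g ∈ {g | g ∈ G}, {x | 0 < g (E.ι x)} with hW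
  have hWo : IsOpen W := by
    refine hVo.inter ((List.finite_toSet G).isOpen_biInter fun g _ => ?_)
    exact isOpen_lt continuous_const (g.continuous_of_finiteDimensional.comp (continuous_ι E))
  have hWG : ∀ x ∈ W, ∀ g ∈ G, 0 < g (E.ι x) := fun x hx g hg =>
    Set.mem_iInter₂.1 hx.2 g hg
  have hyW : y ∈ W := ⟨hyV, Set.mem_iInter₂.2 fun g hg => hGy g hg⟩
  have hWU : W ⊆ U := Set.inter_subset_left.trans hVU
  have hcell : ∀ x ∈ W, ∀ κ ∈ B.cells, x ∈ κ → y ∈ κ := fun x hx κ hκ hxκ =>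
    hV κ hκ ⟨x, hxκ, hx.1⟩
  -- Polyhedra through a point of `W` also contain `y`, so one cube centred at `y` controls the star
  -- of every point of `W`.
  have step : ∀ z ∈ W, ∀ x ∈ W, ∀ σ ∈ B.cells, B.dim σ = n → z ∈ σ → x ∈ σ →
      (z ∈ E.relint σ ∨ x ∈ E.relint σ) → f z = m → f x = m := by
    intro z hz x hx σ hσ hd hzσ hxσ hrel hfz
    by_cases hne : x = z
    · rw [hne, hfz]
    rw [← hfz]
    refine hf.eq_of_segment hn hU (fun u hu => hfz.le.trans (hmin u hu)) (hWU hz) hne hσ hd hzσ hxσ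
      hrel (hWG z hz) (hWG x hx) fun κ hκ hzκ u hu hGu => hVU ?_
    exact hball κ (PolyhedralStructure.mem_cellsAt.2 ⟨hκ, hcell z hz κ hκ hzκ⟩) u hu (hG u hGu)
  have hchain : ∀ z ∈ W, ∃ σ ∈ B.cells, B.dim σ = n ∧ z ∈ σ ∧ y ∈ σ ∧
      ∃ q ∈ E.relint σ, q ∈ W := by
    intro z hz
    obtain ⟨κ, hκ, hzκ⟩ := B.exists_cell z
    obtain ⟨σ, hσ, hsub, hd⟩ := hn.exists_dim_eq hB hκ
    have hyσ := hcell z hz σ hσ (hsub hzκ)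
    exact ⟨σ, hσ, hd, hsub hzκ, hyσ, exists_mem_relint_inter hB.2 hσ hyσ (hWo.mem_nhds hyW)⟩
  refine ⟨W, hWU, hWo, hyW, fun z hz hfz x hx => ?_⟩
  -- A segment needs an endpoint in the relative interior of its top polyhedron, hence the chain
  -- `z`, `q`, `y`, `q'`, `x`.
  obtain ⟨σ, hσ, hd, hzσ, hyσ, q, hq, hqW⟩ := hchain z hz
  have h1 := step z hz q hqW σ hσ hd hzσ hq.1 (Or.inr hq) hfz
  have h2 := step q hqW y hyW σ hσ hd hq.1 hyσ (Or.inl hq) h1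
  obtain ⟨τ, hτ, hd', hxτ, hyτ, q', hq', hqW'⟩ := hchain x hx
  have h3 := step y hyW q' hqW' τ hτ hd' hyτ hq'.1 (Or.inr hq') h2
  exact step q' hqW' x hx τ hτ hd' hq'.1 hxτ (Or.inl hq') h3

end EuclideanPolyhedralSpace

end

end BalancedPolyhedral

theorem proposition5p5 {X : Type*} [TopologicalSpace X] [SecondCountableTopology X]
    {N : Type*} [NormedAddCommGroup N] [InnerProductSpace ℝ N] [FiniteDimensional ℝ N]
    (E : BalancedPolyhedral.EuclideanPolyhedralSpace X N) (n : ℕ) (hn : E.HasPureDimension n)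
    (U : Set X) (hU : IsOpen U) (hconn : IsConnected U)
    (β : E.BalancingCondition n U)
    (f : X → ℝ) (hf : β.WeaklyConcave f)
    (y : X) (hy : y ∈ U) (hmin : IsGLB (f '' U) (f y)) :
    ∃ a : ℝ, ∀ x ∈ U, f x = a := by
  have hle : ∀ z ∈ U, f y ≤ f z := fun z hz => hmin.1 ⟨z, hz, rfl⟩
  have hloc := fun x hx => hf.exists_nhds hn hU hle (y := x) hx
  have hA : IsOpen {x | x ∈ U ∧ f x = f y} := by
    refine isOpen_iff_mem_nhds.2 fun x hx => ?_
    obtain ⟨W, hWU, hWo, hxW, h⟩ := hloc x hx.1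
    exact Filter.mem_of_superset (hWo.mem_nhds hxW) fun z hz => ⟨hWU hz, h x hxW hx.2 z hz⟩
  have hA' : IsOpen {x | x ∈ U ∧ f x ≠ f y} := by
    refine isOpen_iff_mem_nhds.2 fun x hx => ?_
    obtain ⟨W, hWU, hWo, hxW, h⟩ := hloc x hx.1
    exact Filter.mem_of_superset (hWo.mem_nhds hxW) fun z hz =>
      ⟨hWU hz, fun hz' => hx.2 (h z hz hz' x hxW)⟩
  refine ⟨f y, fun x hx => ?_⟩
  have hsub := IsPreconnected.subset_left_of_subset_union hA hA'
    (Set.disjoint_left.2 fun z h h' => h'.2 h.2)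
    (fun z hz => (em (f z = f y)).imp (fun h => ⟨hz, h⟩) fun h => ⟨hz, h⟩)
    ⟨y, hy, hy, rfl⟩ hconn.isPreconnected
  exact (hsub hx).2
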